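/- **Setting.** Fix an integer $N \ge 1$ and non-negative numbers $(\beta_p)_{p \ge 2}$, only finitely many of them non-zero, and let $\xi(r) = \sum_{p \ge 2} \beta_p r^p$. Let $(H_N(\sigma))_{\sigma \in \mathbb{R}^N}$ be the centered Gaussian field $$H_N(\sigma) = \sum_{p \ge 2} \Big(\frac{\beta_p N}{N^{p}}\Big)^{1/2} \sum_{1 \le i_1, \dots, i_p \le N} J_{i_1,\dots,i_p}\, \sigma_{i_1} \cdots \sigma_{i_p},$$ with independent standard Gaussians $J_{i_1,\dots,i_p}$, so that $\mathbb{E}[H_N(\sigma) H_N(\tau)] = N \xi(\sigma \cdot \tau / N)$. Let $P_N$ be a probability measure on $\mathbb{R}^N$ supported in the ball $\{\sigma : |\sigma|^2 \le N\}$. Every probability measure $\mu$ on $\mathbb{R}_+ = [0,\infty)$ with finite support can be written $\mu = \sum_{\ell=0}^k (\zeta_{\ell+1} - \zeta_\ell)\, \delta_{q_\ell}$ with $k \ge 0$, $0 = \zeta_0 < \zeta_1 < \dots < \zeta_k < \zeta_{k+1} = 1$ and $0 = q_{-1} \le q_0 < q_1 < \dots < q_k$. Consider the tree whose vertices are the finite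 sequences $(n_1,\dots,n_\ell) \in \mathbb{N}^\ell$, $0 \le \ell \le k$; for a leaf $\alpha \in \mathbb{N}^k$ let $\alpha_{|\ell}$ be the sequence of its first $\ell$ entries. Let $(z_{\alpha})$, indexed by the vertices, be independent standard Gaussian vectors of $\mathbb{R}^N$, and let $(v_\alpha)_{\alpha \in \mathbb{N}^k}$ be the Poisson-Dirichlet cascade with parameters $\zeta_1, \dots, \zeta_k$: the children of each vertex of depth $\ell \in \{0, \dots, k-1\}$ are decorated with the points, in decreasing order, of an independent Poisson point process on $(0,\infty)$ of intensity $\zeta_{\ell+1} x^{-1-\zeta_{\ell+1}}\, \mathrm{d}x$; $w_\alpha$ is the product of the decorations along the path from the root (excluded) to the leaf $\alpha$ (included), and $v_\alpha = w_\alpha / \sum_{\alpha'} w_{\alpha'}$ (with $v_\emptyset = 1$ if $k = 0$). The families $(J)$, $(z_\alpha)$ and $(v_\alpha)$ are independent. With $H_N'(\sigma,\alpha) = \sum_{\ell=0}^k (2 q_\ell - 2 q_{\ell-1})^{1/2}\, z_{\alpha_{|\ell}} \cdot \sigma$, define, for $t \ge 0$, $$F_N(t,\mu) = -\frac1N \log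 \int \sum_{\alpha \in \mathbb{N}^k} \exp\Big( \sqrt{2t}\, H_N(\sigma) - N t\, \xi\big(N^{-1}|\sigma|^2\big) + H_N'(\sigma,\alpha) - q_k |\sigma|^2 \Big)\, v_\alpha \, \mathrm{d}P_N(\sigma)$$ and $\overline F_N(t,\mu) = \mathbb{E}[F_N(t,\mu)]$. For a probability measure $\mu$ on $\mathbb{R}_+$ let $X_\mu = \inf\{s \ge 0 : \mu([0,s]) > U\}$, where $U$ is one and the same uniform random variable on $[0,1]$ for all $\mu$. Let $W_1(\mu,\mu')$ be the infimum of $\int |x-y| \, \mathrm{d}\pi(x,y)$ over all couplings $\pi$ of $\mu$ and $\mu'$, and let $\mathcal{P}_1(\mathbb{R}_+)$ be the set of probability measures $\mu$ on $\mathbb{R}_+$ with $\int s\, \mathrm{d}\mu(s) < \infty$. **Proposition (continuity and extension of $\overline F_N(t,\mu)$).** For every $t \ge 0$ the following hold. 1. For every $\mu$ with finite support, the integral inside the logarithm is almost surely in $(0,\infty)$ and $F_N(t,\mu)$ is integrable, so that $\overline F_N(t,\mu)$ is well defined. 2. For all $\mu, \mu'$ with finite support, $$\big| \overline F_N(t,\mu')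 - \overline F_N(t,\mu) \big| \le \mathbb{E}\big[ |X_{\mu'} - X_\mu| \big] = W_1(\mu',\mu).$$ 3. The mapping $\mu \mapsto \overline F_N(t,\mu)$ extends, in a unique way, to a function on $\mathcal{P}_1(\mathbb{R}_+)$ that is continuous for the distance $W_1$. -/

import Mathlib

open MeasureTheory ProbabilityTheory
open scoped ENNReal NNReal

namespace SpinGlass

noncomputable section

/-! ### Probability measures on the half-line -/

/-- `μ` is supported on a finite set. -/
def HasFiniteSupport (μ : ProbabilityMeasure ℝ≥0) : Prop :=
  ∃ s : Finset ℝ≥0, (μ : Measure ℝ≥0) ((s : Set ℝ≥0)ᶜ) = 0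

/-- `μ` has a finite first moment. -/
def HasFirstMoment (μ : ProbabilityMeasure ℝ≥0) : Prop :=
  ∫⁻ s, (s : ℝ≥0∞) ∂(μ : Measure ℝ≥0) < ∞

/-- The space of probability measures on the half-line with a finite first moment. -/
abbrev P1 : Type := {μ : ProbabilityMeasure ℝ≥0 // HasFirstMoment μ}

/-- The quantile function `r ↦ inf {s ≥ 0 : μ [0, s] > r}`. -/
def quantile (μ : ProbabilityMeasure ℝ≥0) (r : ℝ) : ℝ≥0 :=
  sInf {s : ℝ≥0 | ENNReal.ofReal r < (μ : Measure ℝ≥0) (Set.Icc 0 s)}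

/-- `E |X_μ - X_ν|`, where `X_μ` and `X_ν` are the quantile functions of `μ` and `ν` evaluated at
the same uniform random variable on `[0, 1]`. -/
def quantileDist (μ ν : ProbabilityMeasure ℝ≥0) : ℝ :=
  ∫ r in Set.Icc (0 : ℝ) 1, |(quantile μ r : ℝ) - (quantile ν r : ℝ)|

/-- The `L¹`-Wasserstein distance: the infimum over all couplings of the expected distance. -/
def W1 (μ ν : ProbabilityMeasure ℝ≥0) : ℝ≥0∞ :=
  ⨅ (π : Measure (ℝ≥0 × ℝ≥0)) (_ : π.map Prod.fst = (μ : Measure ℝ≥0))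
    (_ : π.map Prod.snd = (ν : Measure ℝ≥0)), ∫⁻ x, edist x.1 x.2 ∂π

/-- Continuity of a real function on `P1` for the `L¹`-Wasserstein distance. -/
def W1Continuous (G : P1 → ℝ) : Prop :=
  ∀ μ : P1, ∀ ε : ℝ, 0 < ε → ∃ δ : ℝ≥0∞, 0 < δ ∧
    ∀ ν : P1, W1 μ.1 ν.1 < δ → |G ν - G μ| < ε

/-- A representation `μ = ∑_{ℓ = 0}^k (ζ_{ℓ+1} - ζ_ℓ) δ_{q_ℓ}` with
`0 = ζ_0 < ζ_1 < ⋯ < ζ_k < ζ_{k+1} = 1` and `0 ≤ q_0 < q_1 < ⋯ < q_k`.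
The values `ζ ℓ` for `ℓ > k + 1` and `q ℓ` for `ℓ > k` play no role. -/
structure AtomicRep (μ : ProbabilityMeasure ℝ≥0) where
  k : ℕ
  ζ : ℕ → ℝ
  q : ℕ → ℝ≥0
  ζ_zero : ζ 0 = 0
  ζ_last : ζ (k + 1) = 1
  ζ_lt : ∀ ℓ, ℓ ≤ k → ζ ℓ < ζ (ℓ + 1)
  q_lt : ∀ ℓ, ℓ < k → q ℓ < q (ℓ + 1)
  eq_sum : (μ : Measure ℝ≥0) =
    ∑ ℓ ∈ Finset.range (k + 1), ENNReal.ofReal (ζ (ℓ + 1) - ζ ℓ) • Measure.dirac (q ℓ)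

theorem eq_sum_atoms {μ : Measure ℝ≥0} (s : Finset ℝ≥0) (h : μ ((s : Set ℝ≥0)ᶜ) = 0) :
    μ = ∑ x ∈ s, μ {x} • Measure.dirac x := by
  classical
  ext t ht
  have h1 : μ t = μ (t ∩ s) := by
    refine (measure_inter_add_sdiff t s.measurableSet).symm.trans ?_
    rw [measure_mono_null (fun x hx => hx.2 : t \ (s : Set ℝ≥0) ⊆ (s : Set ℝ≥0)ᶜ) h, add_zero]
  have h2 : t ∩ s = ((s.filter (· ∈ t) : Finset ℝ≥0) : Set ℝ≥0) := by
    ext x; simp [and_comm]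
  rw [h1, h2, ← sum_measure_singleton, Finset.sum_filter]
  simp [Set.indicator_apply, Measure.dirac_apply' _ ht]

/-- Every probability measure of finite support has such a representation. -/
theorem nonempty_atomicRep {μ : ProbabilityMeasure ℝ≥0} (hμ : HasFiniteSupport μ) :
    Nonempty (AtomicRep μ) := by
  classical
  obtain ⟨s, hs⟩ := hμ
  set m : Measure ℝ≥0 := (μ : Measure ℝ≥0) with hm
  set S : Finset ℝ≥0 := s.filter (fun x => m {x} ≠ 0) with hS
  have hsum : m = ∑ x ∈ S, m {x} • Measure.dirac x := by
    conv_lhs => rw [eq_sum_atoms s hs]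
    rw [hS, Finset.sum_filter]
    refine Finset.sum_congr rfl fun x _ => ?_
    by_cases h : m {x} = 0 <;> simp [h]
  have hne : S.card ≠ 0 := by
    intro h
    rw [Finset.card_eq_zero] at h
    rw [h, Finset.sum_empty] at hsum
    exact IsProbabilityMeasure.ne_zero m hsum
  obtain ⟨k, hk⟩ := Nat.exists_eq_succ_of_ne_zero hne
  let e := S.orderIsoOfFin hk
  let q : ℕ → ℝ≥0 := fun ℓ => if h : ℓ < k + 1 then (e ⟨ℓ, h⟩ : ℝ≥0) else 0
  let ζ : ℕ → ℝ := fun ℓ => ∑ j ∈ Finset.range ℓ, (m {q j}).toReal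
  have hdiff : ∀ ℓ, ζ (ℓ + 1) - ζ ℓ = (m {q ℓ}).toReal := fun ℓ => by
    simp [ζ, Finset.sum_range_succ]
  have hq : ∀ i : Fin (k + 1), q i = e i := fun i => dif_pos i.2
  have hrep : m = ∑ ℓ ∈ Finset.range (k + 1),
      ENNReal.ofReal (ζ (ℓ + 1) - ζ ℓ) • Measure.dirac (q ℓ) := by
    conv_lhs => rw [hsum]
    rw [Finset.sum_range, ← Finset.sum_coe_sort S]
    refine (Fintype.sum_equiv e.toEquiv _ _ fun i => ?_).symm
    rw [hdiff, ENNReal.ofReal_toReal (measure_ne_top _ _), hq]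
    rfl
  refine ⟨⟨k, ζ, q, by simp [ζ], ?_, fun ℓ hℓ => ?_, fun ℓ hℓ => ?_, hrep⟩⟩
  · have h1 : m Set.univ = 1 := measure_univ
    rw [hrep] at h1
    simp only [hdiff, ENNReal.ofReal_toReal (measure_ne_top m _)] at h1
    simp only [Measure.coe_finsetSum, Finset.sum_apply, Measure.smul_apply, measure_univ,
      smul_eq_mul, mul_one] at h1
    simp only [ζ]
    rw [← ENNReal.toReal_sum (fun _ _ => measure_ne_top _ _), h1, ENNReal.toReal_one]
  · have h2 : m {q ℓ} ≠ 0 := by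
      have h4 := (Finset.mem_filter.1 (e ⟨ℓ, by omega⟩).2).2
      have h3 := hq ⟨ℓ, by omega⟩
      simp only at h3
      rw [h3]
      exact h4
    have := ENNReal.toReal_pos h2 (measure_ne_top _ _)
    linarith [hdiff ℓ]
  · have h1 := hq ⟨ℓ, by omega⟩
    have h2 := hq ⟨ℓ + 1, by omega⟩
    simp only at h1 h2
    rw [h1, h2, Subtype.coe_lt_coe, e.lt_iff_lt]
    simp

variable {N : ℕ}

/-! ### The randomness

All the random variables are built on one explicit product space. -/

/-- The index set of the couplings `J_{i_1, …, i_p}`, `p ∈ ℕ`, `1 ≤ i_1, …, i_p ≤ N`. -/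
abbrev CouplingIndex (N : ℕ) : Type := Σ p : ℕ, (Fin p → Fin N)

/-- The sample space. A vertex of the infinitary tree is a finite sequence of integers, the root
being the empty sequence. The three components are: the couplings `J`; the variables `z_{α,i}`,
for `α` a vertex and `1 ≤ i ≤ N`; and the variables `e_{α,j}`, for `α` a vertex and `j ∈ ℕ`, from
which the Poisson point process attached to the vertex `α` is built. -/
abbrev Sample (N : ℕ) : Type :=
  (CouplingIndex N → ℝ) × (List ℕ × Fin N → ℝ) × (List ℕ × ℕ → ℝ)

/-- Under the law of the randomness, all coordinates are independent, the `J` and the `z` are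
standard Gaussians, and the `e` are exponential variables of parameter `1`. -/
def law (N : ℕ) : Measure (Sample N) :=
  (Measure.infinitePi fun _ : CouplingIndex N => gaussianReal 0 1).prod
    ((Measure.infinitePi fun _ : List ℕ × Fin N => gaussianReal 0 1).prod
      (Measure.infinitePi fun _ : List ℕ × ℕ => expMeasure 1))

instance (N : ℕ) : IsProbabilityMeasure (law N) := by
  have : IsProbabilityMeasure (expMeasure 1) := isProbabilityMeasure_expMeasure one_pos
  unfold law
  infer_instance

/-! ### The Gaussian fields -/

/-- `ξ(r) = ∑_p β_p r^p`. -/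
def xi (β : ℕ →₀ ℝ) (r : ℝ) : ℝ := β.sum fun p b => b * r ^ p

/-- The field
`H_N(σ) = ∑_p (β_p N / N^p)^{1/2} ∑_{i_1, …, i_p} J_{i_1, …, i_p} σ_{i_1} ⋯ σ_{i_p}`.
It is centered Gaussian and `E [H_N(σ) H_N(τ)] = N ξ(σ ⬝ τ / N)`. -/
def hamiltonian (β : ℕ →₀ ℝ) (ω : Sample N) (σ : EuclideanSpace ℝ (Fin N)) : ℝ :=
  β.sum fun p b => √(b * N / (N : ℝ) ^ p) * ∑ i : Fin p → Fin N, ω.1 ⟨p, i⟩ * ∏ j, σ (i j)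

/-- The ancestor at depth `ℓ` of the leaf `α = (n_1, …, n_k)`, that is, `(n_1, …, n_ℓ)`. -/
def ancestor {k : ℕ} (α : Fin k → ℕ) (ℓ : ℕ) : List ℕ := (List.ofFn α).take ℓ

/-- `q_ℓ - q_{ℓ-1}`, with the convention `q_{-1} = 0`. -/
def increment (q : ℕ → ℝ≥0) : ℕ → ℝ
  | 0 => q 0
  | ℓ + 1 => (q (ℓ + 1) : ℝ) - q ℓ

/-- The field `H'_N(σ, α) = ∑_{ℓ = 0}^k (2 q_ℓ - 2 q_{ℓ-1})^{1/2} z_{α|ℓ} ⬝ σ`. -/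
def cascadeField {k : ℕ} (q : ℕ → ℝ≥0) (ω : Sample N) (σ : EuclideanSpace ℝ (Fin N))
    (α : Fin k → ℕ) : ℝ :=
  ∑ ℓ ∈ Finset.range (k + 1),
    √(2 * increment q ℓ) * ∑ i, ω.2.1 (ancestor α ℓ, i) * σ i

/-! ### The Poisson-Dirichlet cascade -/

/-- The `n`-th largest point (`n = 0, 1, …`) of the Poisson point process on `(0, ∞)` with intensity
measure `ζ x^{-1-ζ} dx` which is attached to the vertex `v`.
The partial sums `e_{v,0} + ⋯ + e_{v,n}` are the successive points of a Poisson point process of unit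
intensity on `(0, ∞)`, and the decreasing map `s ↦ s^{-1/ζ}` sends Lebesgue measure on
`(0, ∞)` to the measure `ζ x^{-1-ζ} dx`, since `s^{-1/ζ} ≥ x` if and only if `s ≤ x^{-ζ}`. -/
def poissonPoint (ω : Sample N) (ζ : ℝ) (v : List ℕ) (n : ℕ) : ℝ :=
  (∑ j ∈ Finset.range (n + 1), ω.2.2 (v, j)) ^ (-1 / ζ)

/-- The weight `w_α` of a leaf before normalization: the product of the decorations of the vertices
on the path from the root (excluded) to the leaf (included). The children of a vertex at depth `ℓ`
are decorated with the points of the process with parameter `ζ_{ℓ+1}` attached to this vertex. -/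
def leafWeight {k : ℕ} (ζ : ℕ → ℝ) (ω : Sample N) (α : Fin k → ℕ) : ℝ :=
  ∏ ℓ : Fin k, poissonPoint ω (ζ ((ℓ : ℕ) + 1)) (ancestor α (ℓ : ℕ)) (α ℓ)

/-- The Poisson-Dirichlet cascade `v_α = w_α / ∑_β w_β`. -/
def cascade {k : ℕ} (ζ : ℕ → ℝ) (ω : Sample N) (α : Fin k → ℕ) : ℝ≥0∞ :=
  ENNReal.ofReal (leafWeight ζ ω α) / ∑' α' : Fin k → ℕ, ENNReal.ofReal (leafWeight ζ ω α')

/-! ### The enriched free energy -/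

/-- The enriched partition function
`∫ ∑_α exp (√(2t) H_N(σ) - N t ξ(|σ|² / N) + H'_N(σ, α) - q_k |σ|²) v_α dP(σ)`. -/
def partitionFunction (β : ℕ →₀ ℝ) (P : Measure (EuclideanSpace ℝ (Fin N))) (t : ℝ)
    {μ : ProbabilityMeasure ℝ≥0} (A : AtomicRep μ) (ω : Sample N) : ℝ≥0∞ :=
  ∫⁻ σ, ∑' α : Fin A.k → ℕ,
    ENNReal.ofReal (Real.exp (√(2 * t) * hamiltonian β ω σ - N * t * xi β (‖σ‖ ^ 2 / N)
      + cascadeField A.q ω σ α - A.q A.k * ‖σ‖ ^ 2)) * cascade A.ζ ω α ∂P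

/-- The (random) enriched free energy `F_N(t, μ)`. -/
def freeEnergy (β : ℕ →₀ ℝ) (P : Measure (EuclideanSpace ℝ (Fin N))) (t : ℝ)
    {μ : ProbabilityMeasure ℝ≥0} (A : AtomicRep μ) (ω : Sample N) : ℝ :=
  -(1 / N) * Real.log (partitionFunction β P t A ω).toReal

/-- The averaged enriched free energy `E [F_N(t, μ)]` of a measure `μ` of finite support. -/
def meanFreeEnergy (β : ℕ →₀ ℝ) (P : Measure (EuclideanSpace ℝ (Fin N))) (t : ℝ)
    (μ : ProbabilityMeasure ℝ≥0) (hμ : HasFiniteSupport μ) : ℝ :=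
  ∫ ω, freeEnergy β P t (nonempty_atomicRep hμ).some ω ∂(law N)

end

end SpinGlass

open SpinGlass

namespace SpinGlass

noncomputable section

/-! ### Independence of disjoint families of coordinates in an infinite product. -/

section InfiniteProducts

/-! Freeze the couplings `J` and put ψ_s(y) = log ∫ exp(U(σ) + y·σ - s|σ|²) dP(σ), where U is the
energy. Since P lives in the ball, ψ_s is √N-Lipschitz. Integrating over σ inside the leaf sum turns
the partition function into the average, with the cascade weights, of exp ψ_{q_k} at the Gaussian
vector of each leaf.

The sum of the points of a Poisson process of intensity ζ x^{-1-ζ} dx, multiplied by independent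
marks Y, has a law that depends on the marks only through E Y^ζ (`map_poissonSum_eq`). Used from the
leaves to the root, this shows that the weighted leaf sum has the law of the total mass times a
deterministic factor, the exponential of a recursion of operators φ ↦ ζ⁻¹ log E exp(ζ φ(· + a z))
(`map_cascadeSum`). The mean logarithm of the normalized sum is then the value of the recursion,
averaged over the root vector, because the mass cancels (`integral_logRatio`).

In terms of F(s) = μ[0, s], the recursion is a backward evolution in s with parameter F(s) and
Gaussian variance 2 ds. Where F is constant the operators form a semigroup (`parisiOp_parisiOp`),
and ψ itself evolves with the parameter 1 (`parisiOp_one_logLaplace`). So the atoms of two measures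
can be merged into one list without changing either value (`evol_eq_of_sublist`). Along this list,
replacing F by F' over a length d costs at most N d |F - F'|: on L-Lipschitz functions the operator
varies in ζ at rate at most a² L² / 2 (`parisiOp_le_add`, a consequence of Prékopa-Leindler), and
the other operators are contractions for the sup norm. Summing and dividing by N leaves ∫ |F - F'|,
which is at most W₁, and W₁ is attained by the quantile coupling (`W1_eq_lintegral_quantile`).

The extension exists because real Lipschitz functions on a subset extend, and it is unique because
measures of finite support are dense. -/

theorem measurePreserving_infinitePi_sum {α β X : Type*} [MeasurableSpace X]
    (P : α ⊕ β → Measure X) [∀ i, IsProbabilityMeasure (P i)] :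
    MeasurePreserving (fun ω : α ⊕ β → X => (fun a => ω (.inl a), fun b => ω (.inr b)))
      (Measure.infinitePi P)
      ((Measure.infinitePi fun a => P (.inl a)).prod (Measure.infinitePi fun b => P (.inr b))) := by
  classical
  have hm : Measurable (fun x : (α → X) × (β → X) => (Sum.elim x.1 x.2 : α ⊕ β → X)) := by
    refine measurable_pi_iff.2 ?_
    rintro (a | b)
    · exact (measurable_pi_apply a).comp measurable_fst
    · exact (measurable_pi_apply b).comp measurable_snd
  -- Gluing is the inverse map, and its image measure is identified on finite boxes, which determine
  -- an infinite product.
  have key : ((Measure.infinitePi fun a => P (.inl a)).prod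
      (Measure.infinitePi fun b => P (.inr b))).map
      (fun x : (α → X) × (β → X) => (Sum.elim x.1 x.2 : α ⊕ β → X)) = Measure.infinitePi P := by
    refine Measure.eq_infinitePi P fun s t ht => ?_
    rw [Measure.map_apply hm (MeasurableSet.pi s.countable_toSet fun i _ => ht i)]
    have : (fun x : (α → X) × (β → X) => (Sum.elim x.1 x.2 : α ⊕ β → X)) ⁻¹' (Set.pi s t) =
        (Set.pi s.toLeft fun a => t (.inl a)) ×ˢ (Set.pi s.toRight fun b => t (.inr b)) := by
      ext x
      simp [Set.mem_pi, Sum.forall]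
    rw [this, Measure.prod_prod, Measure.infinitePi_pi _ (fun i _ => ht _),
      Measure.infinitePi_pi _ (fun i _ => ht _),
      Finset.prod_sum_eq_prod_toLeft_mul_prod_toRight]
  refine ⟨by fun_prop, ?_⟩
  rw [← key, Measure.map_map (by fun_prop) hm]
  exact Measure.map_id

/-- Injectivity of `Sum.elim f g` says that the two families of selected coordinates are disjoint
and without repetition, hence independent. -/
theorem measurePreserving_infinitePi_split {ι α β X : Type*} [MeasurableSpace X]
    (P : ι → Measure X) [∀ i, IsProbabilityMeasure (P i)] (f : α → ι) (g : β → ι)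
    (h : Function.Injective (Sum.elim f g)) :
    MeasurePreserving (fun ω : ι → X => (fun a => ω (f a), fun b => ω (g b)))
      (Measure.infinitePi P)
      ((Measure.infinitePi fun a => P (f a)).prod (Measure.infinitePi fun b => P (g b))) := by
  have h1 : MeasurePreserving (fun (ω : ι → X) i => ω (Sum.elim f g i)) (Measure.infinitePi P)
      (Measure.infinitePi fun i => P (Sum.elim f g i)) :=
    ⟨by fun_prop, Measure.map_infinitePi_infinitePi_of_inj h⟩
  exact (measurePreserving_infinitePi_sum _).comp h1

theorem measurePreserving_infinitePi_nat {X : Type*} [MeasurableSpace X]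
    (ν : Measure X) [IsProbabilityMeasure ν] :
    MeasurePreserving (fun ω : ℕ → X => (ω 0, fun n => ω (n + 1)))
      (Measure.infinitePi fun _ : ℕ => ν) (ν.prod (Measure.infinitePi fun _ : ℕ => ν)) := by
  have h1 := measurePreserving_infinitePi_split (fun _ : ℕ => ν) (fun _ : Unit => 0)
    (fun n : ℕ => n + 1) (by
      rintro (a | a) (b | b) h <;> simp_all)
  exact ((measurePreserving_eval_infinitePi (fun _ : Unit => ν) ()).prod
    (MeasurePreserving.id _)).comp h1

end InfiniteProducts

/-! ### The branching property of the randomness on the tree. -/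

section Tree

instance : IsProbabilityMeasure (expMeasure 1) := isProbabilityMeasure_expMeasure one_pos

/-- The randomness attached to the vertices of the tree: Gaussian and exponential variables. -/
abbrev TreeSample (N : ℕ) : Type := (List ℕ × Fin N → ℝ) × (List ℕ × ℕ → ℝ)

/-- The law of the randomness attached to the vertices of the tree. -/
def treeLaw (N : ℕ) : Measure (TreeSample N) :=
  (Measure.infinitePi fun _ : List ℕ × Fin N => gaussianReal 0 1).prod
    (Measure.infinitePi fun _ : List ℕ × ℕ => expMeasure 1)

instance (N : ℕ) : IsProbabilityMeasure (treeLaw N) := by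
  unfold treeLaw; infer_instance

/-- The sequence of exponential variables attached to the root, and the subtrees of its children. -/
abbrev Forest (N : ℕ) : Type := (ℕ → ℝ) × (ℕ → TreeSample N)

/-- The law of a sequence of independent exponential variables. -/
def expSeq : Measure (ℕ → ℝ) := Measure.infinitePi fun _ : ℕ => expMeasure 1

instance : IsProbabilityMeasure expSeq := by unfold expSeq; infer_instance

def forestLaw (N : ℕ) : Measure (Forest N) :=
  expSeq.prod (Measure.infinitePi fun _ : ℕ => treeLaw N)

instance (N : ℕ) : IsProbabilityMeasure (forestLaw N) := by
  unfold forestLaw; infer_instance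

/-- The Gaussian vector at the root. -/
def rootVec {N : ℕ} (ω : TreeSample N) : EuclideanSpace ℝ (Fin N) :=
  WithLp.toLp 2 fun i => ω.1 ([], i)

/-- The subtree above the `n`-th child of the root. -/
def subtree {N : ℕ} (n : ℕ) (ω : TreeSample N) : TreeSample N :=
  (fun p => ω.1 (n :: p.1, p.2), fun p => ω.2 (n :: p.1, p.2))

/-- Everything but the Gaussian vector at the root. -/
def forest {N : ℕ} (ω : TreeSample N) : Forest N :=
  (fun j => ω.2 ([], j), fun n => subtree n ω)

@[fun_prop]
theorem measurable_rootVec {N : ℕ} : Measurable (rootVec (N := N)) := by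
  unfold rootVec
  refine (WithLp.measurable_toLp 2 _).comp ?_
  fun_prop

@[fun_prop]
theorem measurable_subtree {N : ℕ} (n : ℕ) : Measurable (subtree (N := N) n) := by
  unfold subtree; fun_prop

@[fun_prop]
theorem measurable_forest {N : ℕ} : Measurable (forest (N := N)) := by
  unfold forest; fun_prop

/-- With Gaussian and exponential variables in a single family, the branching property becomes a
relabelling of one product measure by an injection. -/
abbrev VertexIndex (N : ℕ) : Type := List ℕ × (Fin N ⊕ ℕ)

def vertexMeasure (N : ℕ) : (Fin N ⊕ ℕ) → Measure ℝ :=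
  Sum.elim (fun _ => gaussianReal 0 1) (fun _ => expMeasure 1)

instance (N : ℕ) (i) : IsProbabilityMeasure (vertexMeasure N i) := by
  rcases i with i | i <;> simp only [vertexMeasure, Sum.elim_inl, Sum.elim_inr] <;> infer_instance

def splitSample {N : ℕ} (ω : VertexIndex N → ℝ) : TreeSample N :=
  (fun p => ω (p.1, .inl p.2), fun p => ω (p.1, .inr p.2))

theorem measurePreserving_splitSample (N : ℕ) :
    MeasurePreserving (splitSample (N := N))
      (Measure.infinitePi fun p : VertexIndex N => vertexMeasure N p.2) (treeLaw N) :=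
  measurePreserving_infinitePi_split (fun p : VertexIndex N => vertexMeasure N p.2)
    (fun p : List ℕ × Fin N => (p.1, .inl p.2)) (fun p : List ℕ × ℕ => (p.1, .inr p.2)) (by
      rintro (a | a) (b | b) h <;> simp_all [Prod.ext_iff])

/-- The branching property: the root vector, the exponential variables at the root, and the
subtrees are independent, and the subtrees are distributed as the whole tree. -/
theorem measurePreserving_branching (N : ℕ) :
    MeasurePreserving (fun ω : TreeSample N => (rootVec ω, forest ω)) (treeLaw N)
      ((stdGaussian (EuclideanSpace ℝ (Fin N))).prod (forestLaw N)) := by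
  -- A vertex is either the root or `n :: v` with `v` a vertex of the `n`-th subtree; the Gaussian
  -- variables of the root are set apart from everything else.
  have h1 := measurePreserving_infinitePi_split (fun p : VertexIndex N => vertexMeasure N p.2)
    (fun i : Fin N => ([], .inl i))
    (Sum.elim (fun j : ℕ => ([], .inr j)) (fun p : ℕ × VertexIndex N => (p.1 :: p.2.1, p.2.2)))
    (by rintro (a | a | a) (b | b | b) h <;> simp_all [Prod.ext_iff])
  have h2 := measurePreserving_infinitePi_sum (fun b : ℕ ⊕ (ℕ × VertexIndex N) =>
    vertexMeasure N (Sum.elim (fun j : ℕ => (([], .inr j) : VertexIndex N))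
      (fun p : ℕ × VertexIndex N => (p.1 :: p.2.1, p.2.2)) b).2)
  have h3 : MeasurePreserving (MeasurableEquiv.curry ℕ (VertexIndex N) ℝ)
      (Measure.infinitePi fun p : ℕ × VertexIndex N => vertexMeasure N p.2.2)
      (Measure.infinitePi fun _ : ℕ => Measure.infinitePi fun p : VertexIndex N =>
        vertexMeasure N p.2) :=
    ⟨by fun_prop, Measure.infinitePi_map_curry
      (fun (_ : ℕ) (p : VertexIndex N) => vertexMeasure N p.2)⟩
  have h4 : MeasurePreserving (fun (x : ℕ → VertexIndex N → ℝ) n => splitSample (x n))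
      (Measure.infinitePi fun _ : ℕ => Measure.infinitePi fun p : VertexIndex N =>
        vertexMeasure N p.2) (Measure.infinitePi fun _ : ℕ => treeLaw N) := by
    have hm := (measurePreserving_splitSample N).measurable
    refine ⟨by fun_prop, ?_⟩
    rw [Measure.infinitePi_map_pi (μ := fun _ : ℕ => Measure.infinitePi fun p : VertexIndex N =>
      vertexMeasure N p.2) (f := fun _ => splitSample) (fun _ => hm)]
    simp_rw [(measurePreserving_splitSample N).map_eq]
  have h5 : MeasurePreserving (WithLp.toLp 2)
      (Measure.infinitePi fun _ : Fin N => gaussianReal 0 1)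
      (stdGaussian (EuclideanSpace ℝ (Fin N))) :=
    ⟨WithLp.measurable_toLp 2 _, by rw [Measure.infinitePi_eq_pi]; exact map_pi_eq_stdGaussian⟩
  have h6 := (h5.prod (((MeasurePreserving.id expSeq).prod (h4.comp h3)).comp h2)).comp h1
  refine ⟨by fun_prop, ?_⟩
  rw [← (measurePreserving_splitSample N).map_eq, Measure.map_map (by fun_prop)
    (measurePreserving_splitSample N).measurable]
  exact h6.map_eq

end Tree

open Filter Topology Set

/-! ### The function exp(-s) on [0, ∞], infinite values included. -/

section ExpNeg

/-- The function `s ↦ exp (-s)` on `[0, ∞]`. -/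
def expNeg (s : ℝ≥0∞) : ℝ≥0∞ := EReal.exp (-(s : EReal))

theorem continuous_expNeg : Continuous expNeg :=
  EReal.expHomeomorph.continuous.comp (continuous_neg.comp continuous_coe_ennreal_ereal)

@[fun_prop]
theorem measurable_expNeg : Measurable expNeg := continuous_expNeg.measurable

theorem expNeg_add (a b : ℝ≥0∞) : expNeg (a + b) = expNeg a * expNeg b := by
  rw [expNeg, EReal.coe_ennreal_add, EReal.neg_add (Or.inl (by simp)) (Or.inr (by simp)),
    sub_eq_add_neg, EReal.exp_add]
  rfl

@[simp] theorem expNeg_zero : expNeg 0 = 1 := by simp [expNeg]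

@[simp] theorem expNeg_top : expNeg ∞ = 0 := by simp [expNeg]

theorem antitone_expNeg : Antitone expNeg := fun a b h =>
  EReal.exp_monotone (EReal.neg_le_neg_iff.2 (by exact_mod_cast h))

theorem expNeg_le_one (s : ℝ≥0∞) : expNeg s ≤ 1 := by
  simpa using antitone_expNeg (zero_le (a := s))

theorem expNeg_ofReal {x : ℝ} (hx : 0 ≤ x) :
    expNeg (ENNReal.ofReal x) = ENNReal.ofReal (Real.exp (-x)) := by
  rw [expNeg, EReal.coe_ennreal_ofReal, max_eq_left hx, ← EReal.coe_neg, EReal.exp_coe]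

theorem expNeg_sum {ι : Type*} (s : Finset ι) (f : ι → ℝ≥0∞) :
    expNeg (∑ i ∈ s, f i) = ∏ i ∈ s, expNeg (f i) := by
  classical
  induction s using Finset.induction_on with
  | empty => simp
  | insert a s ha ih => rw [Finset.sum_insert ha, Finset.prod_insert ha, expNeg_add, ih]

theorem expNeg_nat_mul (n : ℕ) (s : ℝ≥0∞) : expNeg (n * s) = expNeg s ^ n := by
  simpa using expNeg_sum (Finset.range n) fun _ => s

theorem toENNReal_neg_log_expNeg (s : ℝ≥0∞) : (-(ENNReal.log (expNeg s))).toENNReal = s := by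
  simp [expNeg]

end ExpNeg

/-! ### Laws on [0, ∞] are determined by their Laplace transform at integers. -/

section Moments

/-- On [0, 1] continuous functions are uniform limits of polynomials, whose integrals are fixed by
the moments. -/
theorem ext_of_moments {a b : Measure ℝ} [IsProbabilityMeasure a] [IsProbabilityMeasure b]
    (ha : ∀ᵐ x ∂a, x ∈ Icc (0 : ℝ) 1) (hb : ∀ᵐ x ∂b, x ∈ Icc (0 : ℝ) 1)
    (h : ∀ n : ℕ, ∫ x, x ^ n ∂a = ∫ x, x ^ n ∂b) : a = b := by
  have hint : ∀ (c : Measure ℝ) [IsProbabilityMeasure c], (∀ᵐ x ∂c, x ∈ Icc (0 : ℝ) 1) →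
      ∀ n : ℕ, Integrable (fun x : ℝ => x ^ n) c := by
    intro c _ hc n
    refine Integrable.of_bound (by fun_prop) 1 ?_
    filter_upwards [hc] with x hx
    rw [Real.norm_of_nonneg (pow_nonneg hx.1 _)]
    exact pow_le_one₀ hx.1 hx.2
  have hpoly : ∀ p : Polynomial ℝ, ∫ x, p.eval x ∂a = ∫ x, p.eval x ∂b := by
    intro p
    simp_rw [Polynomial.eval_eq_sum_range]
    rw [integral_finsetSum _ fun i _ => (hint a ha i).const_mul _,
      integral_finsetSum _ fun i _ => (hint b hb i).const_mul _]
    simp_rw [integral_const_mul, h]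
  refine ext_of_forall_integral_eq_of_IsFiniteMeasure fun f => ?_
  refine eq_of_forall_dist_le fun ε hε => ?_
  obtain ⟨p, hp⟩ := exists_polynomial_near_of_continuousOn 0 1 f f.continuous.continuousOn
    (ε / 2) (half_pos hε)
  have hclose : ∀ (c : Measure ℝ) [IsProbabilityMeasure c], (∀ᵐ x ∂c, x ∈ Icc (0 : ℝ) 1) →
      |∫ x, f x ∂c - ∫ x, p.eval x ∂c| ≤ ε / 2 := by
    intro c _ hc
    have hpi : Integrable (fun x : ℝ => p.eval x) c := by
      simp_rw [Polynomial.eval_eq_sum_range]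
      exact integrable_finsetSum _ fun i _ => (hint c hc i).const_mul _
    rw [← integral_sub (f.integrable c) hpi]
    have := norm_integral_le_of_norm_le_const (μ := c) (C := ε / 2)
      (f := fun x => f x - p.eval x) (by
        filter_upwards [hc] with x hx
        rw [Real.norm_eq_abs, abs_sub_comm]
        exact (hp x hx).le)
    simpa using this
  have h1 := hclose a ha
  have h2 := hclose b hb
  rw [hpoly p] at h1
  rw [Real.dist_eq]
  rw [abs_le] at *
  constructor <;> linarith [h1.1, h1.2, h2.1, h2.2]

theorem integral_pow_map_expNeg {Ω : Type*} [MeasurableSpace Ω] (μ : Measure Ω)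
    {R : Ω → ℝ≥0∞} (hR : Measurable R) (n : ℕ) :
    ∫ x, x ^ n ∂(μ.map fun ω => (expNeg (R ω)).toReal) =
      (∫⁻ ω, expNeg (n * R ω) ∂μ).toReal := by
  rw [integral_map (by fun_prop) (by fun_prop)]
  simp_rw [← ENNReal.toReal_pow, ← expNeg_nat_mul]
  rw [integral_toReal (by fun_prop) (ae_of_all _ fun ω => (expNeg_le_one _).trans_lt (by simp))]

theorem ae_mem_Icc_map_expNeg {Ω : Type*} [MeasurableSpace Ω] (μ : Measure Ω)
    {R : Ω → ℝ≥0∞} (hR : Measurable R) :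
    ∀ᵐ x ∂(μ.map fun ω => (expNeg (R ω)).toReal), x ∈ Icc (0 : ℝ) 1 := by
  refine (ae_map_iff (Measurable.aemeasurable (by fun_prop)) measurableSet_Icc).2 ?_
  refine ae_of_all _ fun ω => ⟨ENNReal.toReal_nonneg, ?_⟩
  simpa using ENNReal.toReal_mono (by simp) (expNeg_le_one (R ω))

/-- The hypothesis gives the moments of exp(-S) and exp(-T), which take values in [0, 1]. The map s
↦ exp(-s) is injective on [0, ∞], so no finiteness is required. -/
theorem map_eq_map_of_lintegral_expNeg {Ω Ω' : Type*} [MeasurableSpace Ω] [MeasurableSpace Ω']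
    {μ : Measure Ω} {ν : Measure Ω'} [IsProbabilityMeasure μ] [IsProbabilityMeasure ν]
    {S : Ω → ℝ≥0∞} {T : Ω' → ℝ≥0∞} (hS : Measurable S) (hT : Measurable T)
    (h : ∀ n : ℕ, ∫⁻ ω, expNeg (n * S ω) ∂μ = ∫⁻ ω, expNeg (n * T ω) ∂ν) :
    μ.map S = ν.map T := by
  have hX : (μ.map fun ω => (expNeg (S ω)).toReal) = ν.map fun ω => (expNeg (T ω)).toReal := by
    have := Measure.isProbabilityMeasure_map (μ := μ) (f := fun ω => (expNeg (S ω)).toReal)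
      (by fun_prop)
    have := Measure.isProbabilityMeasure_map (μ := ν) (f := fun ω => (expNeg (T ω)).toReal)
      (by fun_prop)
    refine ext_of_moments (ae_mem_Icc_map_expNeg μ hS) (ae_mem_Icc_map_expNeg ν hT) fun n => ?_
    rw [integral_pow_map_expNeg μ hS, integral_pow_map_expNeg ν hT, h]
  -- A measurable left inverse of s ↦ exp(-s), which brings the equality of laws back to S and T.
  let g : ℝ → ℝ≥0∞ := fun x => (-(ENNReal.log (ENNReal.ofReal x))).toENNReal
  have hg : Measurable g := by
    have h1 : Measurable ENNReal.log := ENNReal.measurable_log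
    have h2 : Measurable EReal.toENNReal := measurable_ereal_toENNReal
    have h3 : Measurable (fun x : EReal => -x) := continuous_neg.measurable
    exact h2.comp (h3.comp (h1.comp ENNReal.measurable_ofReal))
  have hgs : ∀ s, g (expNeg s).toReal = s := fun s => by
    simp only [g]
    rw [ENNReal.ofReal_toReal ((expNeg_le_one s).trans_lt (by simp)).ne, toENNReal_neg_log_expNeg]
  have := congrArg (Measure.map g) hX
  rw [Measure.map_map hg (by fun_prop), Measure.map_map hg (by fun_prop)] at this
  convert this using 2 <;> · ext ω; exact (hgs _).symm

end Moments

/-! ### The generating functional of the unit Poisson process. -/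

section PoissonProcess

theorem lintegral_expMeasure {f : ℝ → ℝ≥0∞} (hf : Measurable f) :
    ∫⁻ s, f s ∂(expMeasure 1) = ∫⁻ s in Ioi 0, ENNReal.ofReal (Real.exp (-s)) * f s := by
  have h1 : expMeasure 1 = volume.withDensity (exponentialPDF 1) := rfl
  have hm : Measurable (exponentialPDF 1) := (measurable_exponentialPDFReal 1).ennreal_ofReal
  rw [h1, lintegral_withDensity_eq_lintegral_mul _ hm hf, ← lintegral_indicator measurableSet_Ioi]
  refine lintegral_congr_ae ?_
  have h0 : ∀ᵐ s : ℝ, s ≠ 0 := by simp [ae_iff]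
  filter_upwards [h0] with s hs
  rcases lt_or_gt_of_ne hs with h | h
  · simp [exponentialPDF_of_neg h, h.le]
  · simp [exponentialPDF_of_nonneg h.le, h]

theorem ae_pos_expMeasure : ∀ᵐ s ∂(expMeasure 1), 0 < s := by
  have h := lintegral_expMeasure (f := (Iic (0 : ℝ)).indicator 1)
    (measurable_one.indicator measurableSet_Iic)
  rw [lintegral_indicator_one measurableSet_Iic] at h
  have h2 : ∫⁻ s in Ioi (0 : ℝ), ENNReal.ofReal (Real.exp (-s)) * (Iic (0 : ℝ)).indicator 1 s = 0 := by
    rw [← lintegral_zero]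
    refine setLIntegral_congr_fun measurableSet_Ioi fun s hs => ?_
    simp [show ¬ s ≤ 0 from not_le.2 hs]
  rw [h2] at h
  rw [ae_iff]
  convert! h using 2
  ext s; simp

theorem ae_pos_expSeq : ∀ᵐ e ∂expSeq, ∀ j, 0 < e j := by
  rw [ae_all_iff]
  intro j
  exact (measurePreserving_eval_infinitePi (fun _ : ℕ => expMeasure 1) j).quasiMeasurePreserving.ae
    ae_pos_expMeasure

/-- The successive points of a Poisson point process of unit intensity. -/
def arrival (e : ℕ → ℝ) (n : ℕ) : ℝ := ∑ j ∈ Finset.range (n + 1), e j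

@[fun_prop]
theorem measurable_arrival (n : ℕ) : Measurable fun e : ℕ → ℝ => arrival e n := by
  unfold arrival; fun_prop

theorem arrival_zero (e : ℕ → ℝ) : arrival e 0 = e 0 := by simp [arrival]

theorem arrival_succ (e : ℕ → ℝ) (n : ℕ) :
    arrival e (n + 1) = e 0 + arrival (fun j => e (j + 1)) n := by
  rw [arrival, Finset.sum_range_succ', add_comm]; rfl

theorem arrival_pos {e : ℕ → ℝ} (h : ∀ j, 0 < e j) (n : ℕ) : 0 < arrival e n :=
  Finset.sum_pos (fun j _ => h j) (by simp)

theorem integrable_id_expMeasure : Integrable (fun x : ℝ => x) (expMeasure 1) := by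
  refine ⟨by fun_prop, ?_⟩
  rw [hasFiniteIntegral_iff_enorm, lintegral_expMeasure (by fun_prop)]
  have h := Real.GammaIntegral_convergent (s := 2) (by norm_num)
  refine lt_of_le_of_lt (le_of_eq ?_) h.2
  refine setLIntegral_congr_fun measurableSet_Ioi fun s hs => ?_
  have hs' : (0 : ℝ) < s := hs
  simp only [enorm_mul, Real.enorm_eq_ofReal hs'.le, Real.enorm_eq_ofReal (Real.exp_pos _).le]
  norm_num
  rw [Real.enorm_eq_ofReal hs'.le]

theorem integral_id_expMeasure_pos : 0 < ∫ x, x ∂(expMeasure 1) := by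
  rw [integral_pos_iff_support_of_nonneg_ae (ae_pos_expMeasure.mono fun x hx => hx.le)
    integrable_id_expMeasure]
  have : (expMeasure 1) (Function.support fun x : ℝ => x) = 1 := by
    refine (prob_compl_eq_zero_iff (measurableSet_support measurable_id)).1 ?_
    refine measure_mono_null ?_ (ae_iff.1 ae_pos_expMeasure)
    intro x hx; simp at hx; simp [hx]
  rw [this]; simp

/-- By the strong law of large numbers, since the exponential variables have a positive mean. -/
theorem tendsto_arrival_atTop : ∀ᵐ e ∂expSeq, Tendsto (arrival e) atTop atTop := by
  have hmp := fun j => measurePreserving_eval_infinitePi (fun _ : ℕ => expMeasure 1) j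
  have hind : iIndepFun (fun (j : ℕ) (e : ℕ → ℝ) => e j) expSeq :=
    iIndepFun_infinitePi (X := fun _ x => x) (fun _ => measurable_id)
  have h := strong_law_ae_real (μ := expSeq) (fun (j : ℕ) (e : ℕ → ℝ) => e j)
    ((hmp 0).integrable_comp_of_integrable integrable_id_expMeasure)
    (fun i j hij => hind.indepFun hij)
    (fun i => ⟨(measurable_pi_apply i).aemeasurable, (measurable_pi_apply 0).aemeasurable, by
      rw [show Measure.map (fun e : ℕ → ℝ => e i) expSeq = _ from (hmp i).map_eq,
        show Measure.map (fun e : ℕ → ℝ => e 0) expSeq = _ from (hmp 0).map_eq]⟩)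
  have hE : ∫ e : ℕ → ℝ, e 0 ∂expSeq = ∫ x, x ∂(expMeasure 1) := by
    rw [← (hmp 0).map_eq, integral_map (measurable_pi_apply 0).aemeasurable (by fun_prop)]; rfl
  filter_upwards [h] with e he
  rw [hE] at he
  have h1 : Tendsto (fun n : ℕ => (∑ i ∈ Finset.range n, e i) / n * n) atTop atTop :=
    he.pos_mul_atTop integral_id_expMeasure_pos tendsto_natCast_atTop_atTop
  have h2 : Tendsto (fun n : ℕ => ∑ i ∈ Finset.range n, e i) atTop atTop := by
    refine h1.congr' ?_
    filter_upwards [eventually_gt_atTop 0] with n hn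
    have : (n : ℝ) ≠ 0 := by positivity
    field_simp
  exact h2.comp (tendsto_add_atTop_nat 1)

variable {g : ℝ → ℝ}

/-- The probability-generating functional of the Poisson points beyond `x`. -/
def voidFun (g : ℝ → ℝ) (x : ℝ) : ℝ :=
  Real.exp (-((∫ s in Ioi 0, (1 - g s)) - ∫ s in (0 : ℝ)..x, (1 - g s)))

theorem voidFun_zero : voidFun g 0 = Real.exp (-∫ s in Ioi 0, (1 - g s)) := by simp [voidFun]

section
variable (hint : IntegrableOn (fun s => 1 - g s) (Ioi 0))
include hint

theorem intervalIntegrable_one_sub {x : ℝ} (hx : 0 ≤ x) :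
    IntervalIntegrable (fun s => 1 - g s) volume 0 x := by
  rw [intervalIntegrable_iff_integrableOn_Ioc_of_le hx]
  exact hint.mono_set Ioc_subset_Ioi_self

theorem continuousOn_voidFun : ContinuousOn (voidFun g) (Ici 0) := by
  have : ContinuousOn (fun x => ∫ s in (0 : ℝ)..x, (1 - g s)) (Ici 0) := by
    intro x hx
    have h1 := intervalIntegral.continuousOn_primitive_interval
      (μ := volume) (f := fun s => 1 - g s) (a := 0) (b := x + 1) (by
        rw [uIcc_of_le (by linarith [mem_Ici.1 hx])]
        rw [integrableOn_Icc_iff_integrableOn_Ioc]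
        exact hint.mono_set Ioc_subset_Ioi_self)
    rw [uIcc_of_le (by linarith [mem_Ici.1 hx])] at h1
    have h2 := h1 x ⟨hx, by linarith⟩
    refine h2.mono_of_mem_nhdsWithin ?_
    rw [mem_nhdsWithin]
    exact ⟨Iio (x + 1), isOpen_Iio, by simp, fun y hy => ⟨hy.2, (mem_Iio.1 hy.1).le⟩⟩
  unfold voidFun
  fun_prop

theorem tendsto_voidFun : Tendsto (voidFun g) atTop (𝓝 1) := by
  have h := intervalIntegral_tendsto_integral_Ioi (0 : ℝ) hint tendsto_id
  have h2 := ((h.const_sub (∫ s in Ioi 0, (1 - g s))).neg).rexp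
  rw [sub_self, neg_zero, Real.exp_zero] at h2
  exact h2

theorem voidFun_le_one (h1 : ∀ s, g s ≤ 1) {x : ℝ} (hx : 0 ≤ x) : voidFun g x ≤ 1 := by
  rw [voidFun, Real.exp_le_one_iff, neg_nonpos, sub_nonneg,
    intervalIntegral.integral_of_le hx]
  exact setIntegral_mono_set hint (ae_of_all _ fun s => by simpa using h1 s)
    (LE.le.eventuallyLE Ioc_subset_Ioi_self)

theorem hasDerivAt_voidFun (hc : ContinuousOn g (Ioi 0)) (hm : Measurable g) {x : ℝ} (hx : 0 < x) :
    HasDerivAt (voidFun g) (voidFun g x * (1 - g x)) x := by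
  have h1 : HasDerivAt (fun x => ∫ s in (0 : ℝ)..x, (1 - g s)) (1 - g x) x := by
    refine intervalIntegral.integral_hasDerivAt_right (intervalIntegrable_one_sub hint hx.le) ?_ ?_
    · exact (measurable_const.sub hm).stronglyMeasurable.stronglyMeasurableAtFilter
    · exact (continuousAt_const.sub (hc.continuousAt (Ioi_mem_nhds hx)))
  have h2 := ((h1.const_sub (∫ s in Ioi 0, (1 - g s))).neg).exp
  rwa [neg_neg] at h2

/-- Renewal equation at the next point, at distance s of density exp(-s). Writing K for `voidFun g`,
one has K' = (1 - g) K, so exp(-s) g(x+s) K(x+s) has the primitive -exp(-s) K(x+s). -/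
theorem lintegral_voidFun_step (hc : ContinuousOn g (Ioi 0)) (hm : Measurable g)
    (h0 : ∀ s, 0 ≤ g s) (h1 : ∀ s, g s ≤ 1) (hKm : Measurable (voidFun g)) {x : ℝ} (hx : 0 ≤ x) :
    ∫⁻ s, ENNReal.ofReal (g (x + s)) * ENNReal.ofReal (voidFun g (x + s)) ∂(expMeasure 1) =
      ENNReal.ofReal (voidFun g x) := by
  rw [lintegral_expMeasure (by fun_prop)]
  have hK0 : ∀ y, 0 < voidFun g y := fun y => Real.exp_pos _
  have e1 : ∀ s : ℝ, ENNReal.ofReal (Real.exp (-s)) *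
      (ENNReal.ofReal (g (x + s)) * ENNReal.ofReal (voidFun g (x + s))) =
      ENNReal.ofReal (Real.exp (-s) * (g (x + s) * voidFun g (x + s))) := fun s => by
    rw [ENNReal.ofReal_mul (Real.exp_pos _).le, ENNReal.ofReal_mul (h0 _)]
  simp_rw [e1]
  have hi : IntegrableOn (fun s => Real.exp (-s) * (g (x + s) * voidFun g (x + s))) (Ioi 0) := by
    refine Integrable.mono' (g := fun s => Real.exp (-s)) ?_ (by fun_prop) ?_
    · exact integrableOn_exp_neg_Ioi 0
    · filter_upwards [ae_restrict_mem measurableSet_Ioi] with s hs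
      have hs' : (0 : ℝ) < s := hs
      rw [Real.norm_of_nonneg (mul_nonneg (Real.exp_pos _).le (mul_nonneg (h0 _) (hK0 _).le))]
      exact mul_le_of_le_one_right (Real.exp_pos _).le
        (mul_le_one₀ (h1 _) (hK0 _).le (voidFun_le_one hint h1 (by linarith)))
  rw [← ofReal_integral_eq_lintegral_ofReal hi (ae_of_all _ fun s =>
    mul_nonneg (Real.exp_pos _).le (mul_nonneg (h0 _) (hK0 _).le))]
  congr 1
  have key := integral_Ioi_of_hasDerivAt_of_tendsto (a := (0 : ℝ)) (m := 0)
    (f := fun s => -(Real.exp (-s) * voidFun g (x + s)))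
    (f' := fun s => Real.exp (-s) * (g (x + s) * voidFun g (x + s))) ?_ ?_ hi ?_
  · rw [key]; simp
  · refine ContinuousWithinAt.neg (ContinuousWithinAt.mul (by fun_prop) ?_)
    have := (continuousOn_voidFun hint) (x + 0) (by simpa using hx)
    exact this.comp (by fun_prop) fun s hs => by
      simp only [mem_Ici] at hs ⊢; linarith
  · intro s hs
    have hs' : (0 : ℝ) < s := hs
    have hd := (hasDerivAt_voidFun hint hc hm (x := x + s) (by linarith)).comp_const_add x s
    have he : HasDerivAt (fun s : ℝ => Real.exp (-s)) (-Real.exp (-s)) s := by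
      simpa using (hasDerivAt_neg s).exp
    convert! (he.mul hd).neg using 1
    ring
  · have hk : Tendsto (fun s => voidFun g (x + s)) atTop (𝓝 1) :=
      (tendsto_voidFun hint).comp (tendsto_atTop_add_const_left _ _ tendsto_id)
    have := ((Real.tendsto_exp_atBot.comp tendsto_neg_atTop_atBot).mul hk).neg
    simpa using this

/-- A martingale property: the factor `voidFun` is the expected contribution of all later points.
The induction removes the first exponential variable and restarts from `x + e 0`. -/
theorem lintegral_prod_arrival_voidFun (hc : ContinuousOn g (Ioi 0)) (hm : Measurable g)
    (h0 : ∀ s, 0 ≤ g s) (h1 : ∀ s, g s ≤ 1) (hKm : Measurable (voidFun g)) (M : ℕ) :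
    ∀ {x : ℝ}, 0 ≤ x →
    ∫⁻ e, (∏ n ∈ Finset.range (M + 1), ENNReal.ofReal (g (x + arrival e n))) *
      ENNReal.ofReal (voidFun g (x + arrival e M)) ∂expSeq = ENNReal.ofReal (voidFun g x) := by
  induction M with
  | zero =>
    intro x hx
    simp only [zero_add, Finset.prod_range_one, arrival_zero]
    rw [← lintegral_voidFun_step hint hc hm h0 h1 hKm hx]
    exact (measurePreserving_eval_infinitePi (fun _ : ℕ => expMeasure 1) 0).lintegral_comp
      (f := fun s => ENNReal.ofReal (g (x + s)) * ENNReal.ofReal (voidFun g (x + s)))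
      (by fun_prop)
  | succ M ih =>
    intro x hx
    have hmp := measurePreserving_infinitePi_nat (expMeasure 1)
    have hF : Measurable (fun p : ℝ × (ℕ → ℝ) => ENNReal.ofReal (g (x + p.1)) *
        ((∏ n ∈ Finset.range (M + 1), ENNReal.ofReal (g (x + p.1 + arrival p.2 n))) *
        ENNReal.ofReal (voidFun g (x + p.1 + arrival p.2 M)))) := by
      fun_prop
    have e1 := hmp.lintegral_comp hF
    have e2 : ∀ e : ℕ → ℝ,
        (∏ n ∈ Finset.range (M + 1 + 1), ENNReal.ofReal (g (x + arrival e n))) *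
          ENNReal.ofReal (voidFun g (x + arrival e (M + 1))) =
        ENNReal.ofReal (g (x + e 0)) *
        ((∏ n ∈ Finset.range (M + 1),
          ENNReal.ofReal (g (x + e 0 + arrival (fun n => e (n + 1)) n))) *
        ENNReal.ofReal (voidFun g (x + e 0 + arrival (fun n => e (n + 1)) M))) := fun e => by
      rw [Finset.prod_range_succ', arrival_zero]
      simp_rw [arrival_succ, ← add_assoc]
      ring
    simp_rw [e2]
    refine e1.trans ?_
    rw [lintegral_prod _ hF.aemeasurable, ← lintegral_voidFun_step hint hc hm h0 h1 hKm hx]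
    refine lintegral_congr_ae ?_
    filter_upwards [ae_pos_expMeasure] with s hs
    rw [lintegral_const_mul _ (by fun_prop)]
    congr 1
    exact ih (by linarith)

/-- The probability-generating functional of a Poisson point process of unit intensity. -/
theorem tendsto_lintegral_prod_arrival (hc : ContinuousOn g (Ioi 0)) (hm : Measurable g)
    (h0 : ∀ s, 0 ≤ g s) (h1 : ∀ s, g s ≤ 1) (hKm : Measurable (voidFun g)) :
    Tendsto (fun M : ℕ => ∫⁻ e, ∏ n ∈ Finset.range (M + 1), ENNReal.ofReal (g (arrival e n)) ∂expSeq)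
      atTop (𝓝 (ENNReal.ofReal (Real.exp (-∫ s in Ioi 0, (1 - g s))))) := by
  have key := fun M => lintegral_prod_arrival_voidFun hint hc hm h0 h1 hKm M (x := 0) le_rfl
  simp only [zero_add, voidFun_zero] at key
  have hprod : ∀ (M : ℕ) (e : ℕ → ℝ),
      ∏ n ∈ Finset.range (M + 1), ENNReal.ofReal (g (arrival e n)) ≤ 1 := fun M e =>
    Finset.prod_le_one' fun n _ => by simpa using h1 _
  -- The cost of dropping the last factor vanishes, as the arrivals tend to infinity and `voidFun`
  -- tends to 1 there.
  have hrest : Tendsto (fun M : ℕ => ∫⁻ e, (1 - ENNReal.ofReal (voidFun g (arrival e M))) ∂expSeq)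
      atTop (𝓝 0) := by
    have := tendsto_lintegral_of_dominated_convergence (μ := expSeq) (f := fun _ => 0)
      (F := fun (M : ℕ) e => 1 - ENNReal.ofReal (voidFun g (arrival e M))) (fun _ => 1)
      (fun M => by fun_prop) (fun M => ae_of_all _ fun e => tsub_le_self) (by simp) (by
        filter_upwards [tendsto_arrival_atTop] with e he
        have h2 := ENNReal.tendsto_ofReal ((tendsto_voidFun hint).comp he)
        have h3 := ENNReal.Tendsto.sub (tendsto_const_nhds (x := (1 : ℝ≥0∞))) h2 (by simp)
        simpa using h3)
    simpa using this
  refine tendsto_of_tendsto_of_tendsto_of_le_of_le tendsto_const_nhds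
    (h := fun M => ENNReal.ofReal (Real.exp (-∫ s in Ioi 0, (1 - g s))) +
      ∫⁻ e, (1 - ENNReal.ofReal (voidFun g (arrival e M))) ∂expSeq)
    (by simpa using hrest.const_add (ENNReal.ofReal (Real.exp (-∫ s in Ioi 0, (1 - g s)))))
    (fun M => ?_) fun M => ?_
  · rw [← key M]
    refine lintegral_mono_ae ?_
    filter_upwards [ae_pos_expSeq] with e he
    exact mul_le_of_le_one_right' (by
      simpa using voidFun_le_one hint h1 (arrival_pos he M).le)
  · simp only
    rw [← key M, ← lintegral_add_right _ (by fun_prop)]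
    refine lintegral_mono fun e => ?_
    set a := ∏ n ∈ Finset.range (M + 1), ENNReal.ofReal (g (arrival e n))
    set k := ENNReal.ofReal (voidFun g (arrival e M))
    calc a ≤ a * (k + (1 - k)) := le_mul_of_one_le_right' le_add_tsub
      _ = a * k + a * (1 - k) := mul_add _ _ _
      _ ≤ a * k + (1 - k) := by gcongr; exact mul_le_of_le_one_left' (hprod M e)

end
end PoissonProcess

/-! ### Sums over the Poisson process of intensity ζ x^{-1-ζ} dx. -/

section StableSums

theorem measurable_voidFun {g : ℝ → ℝ} (hm : Measurable g) (h0 : ∀ s, 0 ≤ g s)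
    (h1 : ∀ s, g s ≤ 1) : Measurable (voidFun g) := by
  have hb : ∀ a b : ℝ, IntervalIntegrable (fun s => 1 - g s) volume a b := fun a b => by
    rw [intervalIntegrable_iff]
    refine Measure.integrableOn_of_bounded (M := 1) (by simp) (by fun_prop) (ae_of_all _ fun s => ?_)
    rw [Real.norm_of_nonneg (by linarith [h1 s])]
    linarith [h0 s]
  have := intervalIntegral.continuous_primitive hb 0
  unfold voidFun
  exact (by fun_prop : Continuous _).measurable

theorem lintegral_Ioi_comp_mul_left {f : ℝ → ℝ≥0∞} (hf : Measurable f) {c : ℝ} (hc : 0 < c) :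
    ∫⁻ s in Ioi 0, f (c * s) = ENNReal.ofReal c⁻¹ * ∫⁻ s in Ioi 0, f s := by
  rw [← lintegral_indicator measurableSet_Ioi, ← lintegral_indicator measurableSet_Ioi]
  have h : ∀ s, (Ioi (0 : ℝ)).indicator (fun s => f (c * s)) s =
      (Ioi (0 : ℝ)).indicator f (c * s) := fun s => by
    by_cases hs : 0 < s
    · simp [hs, hc]
    · have : ¬ 0 < c * s := by rw [mul_pos_iff_of_pos_left hc]; exact hs
      simp [hs, this]
  simp_rw [h]
  rw [← lintegral_map (f := (Ioi (0 : ℝ)).indicator f) (g := fun s => c * s)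
    (hf.indicator measurableSet_Ioi) (by fun_prop)]
  rw [show (fun s : ℝ => c * s) = (c * ·) from rfl, Real.map_volume_mul_left hc.ne',
    lintegral_smul_measure, abs_of_pos (inv_pos.2 hc), smul_eq_mul]

/-- The Laplace exponent at `1` of the sum of the points of the Poisson process with intensity
`ζ x^{-1-ζ} dx`. -/
def stableConst (ζ : ℝ) : ℝ≥0∞ := ∫⁻ s in Ioi 0, (1 - expNeg (ENNReal.ofReal (s ^ (-1 / ζ))))

theorem expNeg_lt_one {x : ℝ≥0∞} (hx : x ≠ 0) : expNeg x < 1 := by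
  refine lt_of_le_of_ne (expNeg_le_one x) fun h => hx ?_
  have := toENNReal_neg_log_expNeg x
  rw [h] at this
  simpa using this.symm

theorem stableConst_ne_zero (ζ : ℝ) : stableConst ζ ≠ 0 := by
  intro h
  rw [stableConst, lintegral_eq_zero_iff (by fun_prop)] at h
  have h2 : ∀ᵐ s ∂(volume.restrict (Ioi (0 : ℝ))), False := by
    filter_upwards [h, ae_restrict_mem measurableSet_Ioi] with s hs hs0
    have := expNeg_lt_one (x := ENNReal.ofReal (s ^ (-1 / ζ)))
      (by simpa using Real.rpow_pos_of_pos hs0 _)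
    simp only [Pi.zero_apply, tsub_eq_zero_iff_le] at hs
    exact absurd hs (not_le.2 this)
  have := ae_iff.1 h2
  simp at this

/-- Substitute y^ζ s for s. This homogeneity is why only the moment of order ζ of the marks will
matter. -/
theorem lintegral_one_sub_expNeg_rpow_mul {ζ : ℝ} (hζ : 0 < ζ) (y : ℝ≥0∞) :
    ∫⁻ s in Ioi 0, (1 - expNeg (ENNReal.ofReal (s ^ (-1 / ζ)) * y)) = y ^ ζ * stableConst ζ := by
  rcases eq_or_ne y ∞ with rfl | hy
  · rw [ENNReal.top_rpow_of_pos hζ, ENNReal.top_mul (stableConst_ne_zero ζ)]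
    rw [setLIntegral_congr_fun (g := fun _ => 1) measurableSet_Ioi fun s hs => ?_]
    · simp
    · have : ENNReal.ofReal (s ^ (-1 / ζ)) ≠ 0 := by simpa using Real.rpow_pos_of_pos hs _
      simp [ENNReal.mul_top this]
  rcases eq_or_ne y 0 with rfl | hy0
  · simp [hζ]
  lift y to ℝ≥0 using hy
  set r : ℝ := (y : ℝ) with hr
  have hr0 : 0 < r := by
    have : y ≠ 0 := by simpa using hy0
    positivity
  have hyr : (y : ℝ≥0∞) = ENNReal.ofReal r := by simp [hr]
  have hc : 0 < r ^ ζ := Real.rpow_pos_of_pos hr0 _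
  have h := lintegral_Ioi_comp_mul_left
    (f := fun s => 1 - expNeg (ENNReal.ofReal (s ^ (-1 / ζ)) * y)) (by fun_prop) hc
  have h2 : ∫⁻ s in Ioi 0, (1 - expNeg (ENNReal.ofReal ((r ^ ζ * s) ^ (-1 / ζ)) * y)) =
      stableConst ζ := by
    refine setLIntegral_congr_fun measurableSet_Ioi fun s hs => ?_
    have hs' : (0 : ℝ) < s := hs
    rw [hyr, ← ENNReal.ofReal_mul (by positivity), Real.mul_rpow hc.le hs'.le, ← Real.rpow_mul hr0.le,
      mul_div_cancel₀ _ hζ.ne', Real.rpow_neg_one]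
    congr 3
    field_simp
  rw [h2] at h
  rw [h, ← mul_assoc, hyr, ENNReal.ofReal_rpow_of_pos hr0, ← ENNReal.ofReal_mul hc.le,
    mul_inv_cancel₀ hc.ne']
  simp

/-- The integrand is at most 1 on (0, 1], and at most c s^p beyond, which is integrable there. -/
theorem lintegral_one_sub_expNeg_rpow_lt_top {p : ℝ} (hp : p < -1) {c : ℝ} (hc : 0 ≤ c) :
    ∫⁻ s in Ioi 0, (1 - expNeg (ENNReal.ofReal (c * s ^ p))) < ∞ := by
  rw [← Ioc_union_Ioi_eq_Ioi (zero_le_one' ℝ)]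
  refine (lintegral_union_le _ _ _).trans_lt (ENNReal.add_lt_top.2 ⟨?_, ?_⟩)
  · refine (lintegral_mono (g := fun _ => 1) fun s => tsub_le_self).trans_lt ?_
    simp
  · have h := ((integrableOn_Ioi_rpow_of_lt hp one_pos).const_mul c).2
    refine lt_of_le_of_lt ?_ h
    refine setLIntegral_mono' measurableSet_Ioi fun s hs => ?_
    have hs' : (0 : ℝ) < s := lt_trans one_pos hs
    have h0 : 0 ≤ c * s ^ p := by positivity
    rw [expNeg_ofReal h0, Real.enorm_of_nonneg h0, ← ENNReal.ofReal_one,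
      ← ENNReal.ofReal_sub _ (Real.exp_pos _).le]
    refine ENNReal.ofReal_le_ofReal ?_
    linarith [Real.add_one_le_exp (-(c * s ^ p))]

theorem stableConst_lt_top {ζ : ℝ} (h0 : 0 < ζ) (h1 : ζ < 1) : stableConst ζ < ∞ := by
  have := lintegral_one_sub_expNeg_rpow_lt_top (p := -1 / ζ) (by
    rw [neg_div, neg_lt_neg_iff]; exact (one_lt_div h0).2 h1) zero_le_one
  simpa [stableConst] using this

/-- The points, in decreasing order, of the Poisson process with intensity `ζ x^{-1-ζ} dx`. -/
def point (ζ : ℝ) (e : ℕ → ℝ) (n : ℕ) : ℝ≥0∞ := ENNReal.ofReal (arrival e n ^ (-1 / ζ))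

@[fun_prop]
theorem measurable_point (ζ : ℝ) (n : ℕ) : Measurable fun e : ℕ → ℝ => point ζ e n := by
  unfold point; fun_prop

variable {Ω Ω' : Type*} [MeasurableSpace Ω] [MeasurableSpace Ω']

/-- The sum of the points of a Poisson process, weighted by independent marks. -/
def poissonSum (ζ : ℝ) (Y : Ω → ℝ≥0∞) (x : (ℕ → ℝ) × (ℕ → Ω)) : ℝ≥0∞ :=
  ∑' n, point ζ x.1 n * Y (x.2 n)

theorem measurable_poissonSum (ζ : ℝ) {Y : Ω → ℝ≥0∞} (hY : Measurable Y) :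
    Measurable (poissonSum ζ Y) := by
  unfold poissonSum; fun_prop

/-- Given the arrivals, the independent marks contribute one factor `G s` per arrival s, so the
generating functional applies. Its exponent ∫ (1 - G) is computed by Tonelli and the homogeneity
above. -/
theorem lintegral_expNeg_poissonSum (ρ : Measure Ω) [IsProbabilityMeasure ρ] {ζ : ℝ} (hζ0 : 0 < ζ)
    (hζ1 : ζ < 1) {Y : Ω → ℝ≥0∞} (hY : Measurable Y) (hfin : ∫⁻ ω, Y ω ^ ζ ∂ρ ≠ ∞) :
    ∫⁻ x, expNeg (poissonSum ζ Y x) ∂(expSeq.prod (Measure.infinitePi fun _ : ℕ => ρ)) =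
      expNeg (stableConst ζ * ∫⁻ ω, Y ω ^ ζ ∂ρ) := by
  set G : ℝ → ℝ≥0∞ := fun s => ∫⁻ ω, expNeg (ENNReal.ofReal (s ^ (-1 / ζ)) * Y ω) ∂ρ with hG
  have hGm : Measurable G := by
    refine Measurable.lintegral_prod_right'
      (f := fun p : ℝ × Ω => expNeg (ENNReal.ofReal (p.1 ^ (-1 / ζ)) * Y p.2)) ?_
    fun_prop
  have hG1 : ∀ s, G s ≤ 1 := fun s =>
    (lintegral_mono fun ω => expNeg_le_one _).trans (by simp)
  have hGt : ∀ s, G s ≠ ∞ := fun s => ((hG1 s).trans_lt (by simp)).ne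
  set g : ℝ → ℝ := fun s => (G s).toReal with hg
  have hgG : ∀ s, ENNReal.ofReal (g s) = G s := fun s => ENNReal.ofReal_toReal (hGt s)
  have hgm : Measurable g := hGm.ennreal_toReal
  have hg0 : ∀ s, 0 ≤ g s := fun s => ENNReal.toReal_nonneg
  have hg1 : ∀ s, g s ≤ 1 := fun s => by simpa using ENNReal.toReal_mono (by simp) (hG1 s)
  have hYfin : ∀ᵐ ω ∂ρ, Y ω ≠ ∞ := by
    filter_upwards [ae_lt_top (by fun_prop) hfin] with ω hω h
    rw [h, ENNReal.top_rpow_of_pos hζ0] at hω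
    exact lt_irrefl _ hω
  -- Dominated convergence; it needs marks that are almost surely finite, which their moment of
  -- order ζ ensures.
  have hgc : ContinuousOn g (Ioi 0) := by
    intro s hs
    refine ContinuousAt.continuousWithinAt ?_
    refine (ENNReal.tendsto_toReal (hGt s)).comp ?_
    refine tendsto_lintegral_filter_of_dominated_convergence (fun _ => 1)
      (Eventually.of_forall fun _ => by fun_prop)
      (Eventually.of_forall fun _ => ae_of_all _ fun _ => expNeg_le_one _) (by simp) ?_
    filter_upwards [hYfin] with ω hω
    refine (continuous_expNeg.tendsto _).comp ?_
    refine ENNReal.Tendsto.mul_const ?_ (Or.inr hω)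
    exact ENNReal.tendsto_ofReal ((Real.continuousAt_rpow_const s _ (Or.inl (ne_of_gt hs))).tendsto)
  have hlint : ∫⁻ s in Ioi 0, ENNReal.ofReal (1 - g s) = stableConst ζ * ∫⁻ ω, Y ω ^ ζ ∂ρ := by
    have e1 : ∀ s, ENNReal.ofReal (1 - g s) =
        ∫⁻ ω, (1 - expNeg (ENNReal.ofReal (s ^ (-1 / ζ)) * Y ω)) ∂ρ := fun s => by
      rw [ENNReal.ofReal_sub _ (hg0 s), hgG, ENNReal.ofReal_one,
        lintegral_sub (by fun_prop) (hGt s) (ae_of_all _ fun _ => expNeg_le_one _)]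
      simp [hG]
    simp_rw [e1]
    rw [lintegral_lintegral_swap (by fun_prop)]
    simp_rw [lintegral_one_sub_expNeg_rpow_mul hζ0]
    rw [lintegral_mul_const _ (by fun_prop), mul_comm]
  have hne : stableConst ζ * ∫⁻ ω, Y ω ^ ζ ∂ρ ≠ ∞ :=
    ENNReal.mul_ne_top (stableConst_lt_top hζ0 hζ1).ne hfin
  have hint : IntegrableOn (fun s => 1 - g s) (Ioi 0) := by
    refine ⟨by fun_prop, ?_⟩
    rw [hasFiniteIntegral_iff_ofReal (ae_of_all _ fun s => by simpa using hg1 s), hlint]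
    exact hne.lt_top
  have hval : Real.exp (-∫ s in Ioi 0, (1 - g s)) =
      (expNeg (stableConst ζ * ∫⁻ ω, Y ω ^ ζ ∂ρ)).toReal := by
    rw [integral_eq_lintegral_of_nonneg_ae (ae_of_all _ fun s => by simpa using hg1 s)
      (by fun_prop), hlint]
    conv_rhs => rw [← ENNReal.ofReal_toReal hne, expNeg_ofReal ENNReal.toReal_nonneg]
    rw [ENNReal.toReal_ofReal (Real.exp_pos _).le]
  have hlim := tendsto_lintegral_prod_arrival hint hgc hgm hg0 hg1 (measurable_voidFun hgm hg0 hg1)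
  rw [hval, ENNReal.ofReal_toReal ((expNeg_le_one _).trans_lt (by simp)).ne] at hlim
  refine tendsto_nhds_unique ?_ hlim
  have e2 : ∀ M : ℕ, ∫⁻ e, ∏ n ∈ Finset.range (M + 1), ENNReal.ofReal (g (arrival e n)) ∂expSeq =
      ∫⁻ x, expNeg (∑ n ∈ Finset.range (M + 1), point ζ x.1 n * Y (x.2 n))
        ∂(expSeq.prod (Measure.infinitePi fun _ : ℕ => ρ)) := fun M => by
    rw [lintegral_prod _ (by fun_prop)]
    refine lintegral_congr fun e => ?_
    simp_rw [expNeg_sum, hgG]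
    rw [lintegral_prod_eq_prod_lintegral_of_indepFun (Finset.range (M + 1))
      (fun n (f : ℕ → Ω) => expNeg (point ζ e n * Y (f n)))
      (iIndepFun_infinitePi (X := fun n ω => expNeg (point ζ e n * Y ω)) fun n => by fun_prop)
      (fun n => by fun_prop)]
    refine Finset.prod_congr rfl fun n _ => ?_
    exact ((measurePreserving_eval_infinitePi (fun _ : ℕ => ρ) n).lintegral_comp
      (f := fun ω => expNeg (point ζ e n * Y ω)) (by fun_prop)).symm
  simp_rw [e2]
  refine tendsto_lintegral_of_dominated_convergence (fun _ => 1) (fun M => by fun_prop)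
    (fun M => ae_of_all _ fun _ => expNeg_le_one _) (by simp) (ae_of_all _ fun x => ?_)
  exact (continuous_expNeg.tendsto _).comp
    ((ENNReal.tendsto_nat_tsum _).comp (tendsto_add_atTop_nat 1))

/-- The law of a Poisson sum with independent marks only depends on the moment of order `ζ`
of the marks. -/
theorem map_poissonSum_eq (ρ : Measure Ω) [IsProbabilityMeasure ρ] (ρ' : Measure Ω')
    [IsProbabilityMeasure ρ'] {ζ : ℝ} (hζ0 : 0 < ζ) (hζ1 : ζ < 1) {Y : Ω → ℝ≥0∞}
    (hY : Measurable Y) {Y' : Ω' → ℝ≥0∞} (hY' : Measurable Y') (hfin : ∫⁻ ω, Y ω ^ ζ ∂ρ ≠ ∞)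
    (h : ∫⁻ ω, Y ω ^ ζ ∂ρ = ∫⁻ ω, Y' ω ^ ζ ∂ρ') :
    (expSeq.prod (Measure.infinitePi fun _ : ℕ => ρ)).map (poissonSum ζ Y) =
      (expSeq.prod (Measure.infinitePi fun _ : ℕ => ρ')).map (poissonSum ζ Y') := by
  -- A multiple of the sum is the sum with multiplied marks, so the transform at 1 yields the
  -- transform at every integer.
  have hscale : ∀ (c : ℝ≥0∞) (x),
      c * poissonSum ζ Y x = poissonSum ζ (fun ω => c * Y ω) x := fun c x => by
    simp_rw [poissonSum, ← ENNReal.tsum_mul_left, mul_left_comm]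
  have hscale' : ∀ (c : ℝ≥0∞) (x),
      c * poissonSum ζ Y' x = poissonSum ζ (fun ω => c * Y' ω) x := fun c x => by
    simp_rw [poissonSum, ← ENNReal.tsum_mul_left, mul_left_comm]
  have hm : ∀ n : ℕ, ∫⁻ ω, (n * Y ω) ^ ζ ∂ρ = (n : ℝ≥0∞) ^ ζ * ∫⁻ ω, Y ω ^ ζ ∂ρ := fun n => by
    simp_rw [ENNReal.mul_rpow_of_nonneg _ _ hζ0.le]
    rw [lintegral_const_mul _ (by fun_prop)]
  have hm' : ∀ n : ℕ, ∫⁻ ω, (n * Y' ω) ^ ζ ∂ρ' = (n : ℝ≥0∞) ^ ζ * ∫⁻ ω, Y' ω ^ ζ ∂ρ' := fun n => by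
    simp_rw [ENNReal.mul_rpow_of_nonneg _ _ hζ0.le]
    rw [lintegral_const_mul _ (by fun_prop)]
  have hnf : ∀ n : ℕ, (n : ℝ≥0∞) ^ ζ * ∫⁻ ω, Y ω ^ ζ ∂ρ ≠ ∞ := fun n =>
    ENNReal.mul_ne_top (ENNReal.rpow_ne_top_of_nonneg hζ0.le (by simp)) hfin
  refine map_eq_map_of_lintegral_expNeg (measurable_poissonSum ζ hY) (measurable_poissonSum ζ hY')
    fun n => ?_
  simp_rw [hscale, hscale']
  rw [lintegral_expNeg_poissonSum ρ hζ0 hζ1 (by fun_prop) (by rw [hm]; exact hnf n),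
    lintegral_expNeg_poissonSum ρ' hζ0 hζ1 (by fun_prop) (by rw [hm', ← h]; exact hnf n), hm, hm', h]

/-- The sum of the points of the Poisson process with intensity `ζ x^{-1-ζ} dx`. -/
def stableSum (ζ : ℝ) (e : ℕ → ℝ) : ℝ≥0∞ := ∑' n, point ζ e n

@[fun_prop]
theorem measurable_stableSum (ζ : ℝ) : Measurable (stableSum ζ) := by
  unfold stableSum; fun_prop

/-- The marks can be replaced by a constant having the same moment of order ζ. -/
theorem map_poissonSum_eq_stableSum (ρ : Measure Ω) [IsProbabilityMeasure ρ] {ζ : ℝ} (hζ0 : 0 < ζ)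
    (hζ1 : ζ < 1) {Y : Ω → ℝ≥0∞} (hY : Measurable Y) {c : ℝ≥0∞} (hc : c ≠ ∞)
    (h : ∫⁻ ω, Y ω ^ ζ ∂ρ = c ^ ζ) :
    (expSeq.prod (Measure.infinitePi fun _ : ℕ => ρ)).map (poissonSum ζ Y) =
      expSeq.map fun e => c * stableSum ζ e := by
  have hfin : c ^ ζ ≠ ∞ := ENNReal.rpow_ne_top_of_nonneg hζ0.le hc
  rw [map_poissonSum_eq ρ (Measure.dirac ()) hζ0 hζ1 hY (Y' := fun _ => c) (by fun_prop)
    (by rwa [h]) (by simpa using h)]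
  have : poissonSum ζ (fun _ : Unit => c) = (fun e => c * stableSum ζ e) ∘ Prod.fst := by
    ext x
    simp only [poissonSum, Function.comp_apply, stableSum]
    rw [ENNReal.tsum_mul_right, mul_comm]
  rw [this, ← Measure.map_map (by fun_prop) measurable_fst, Measure.map_fst_prod]
  simp

theorem lintegral_expNeg_mul_stableSum {ζ : ℝ} (hζ0 : 0 < ζ) (hζ1 : ζ < 1) {c : ℝ≥0∞}
    (hc : c ≠ ∞) : ∫⁻ e, expNeg (c * stableSum ζ e) ∂expSeq = expNeg (stableConst ζ * c ^ ζ) := by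
  have h1 := map_poissonSum_eq_stableSum (Measure.dirac ()) hζ0 hζ1 (Y := fun _ : Unit => c)
    (by fun_prop) hc (by simp)
  have h2 := lintegral_expNeg_poissonSum (Measure.dirac ()) hζ0 hζ1 (Y := fun _ : Unit => c)
    (by fun_prop) (by simpa using ENNReal.rpow_ne_top_of_nonneg hζ0.le hc)
  rw [← lintegral_map (f := expNeg) (by fun_prop) (measurable_poissonSum ζ (by fun_prop)), h1,
    lintegral_map (by fun_prop) (by fun_prop)] at h2
  simpa using h2

/-- Up to a constant, x^r is the integral over s of 1 - exp(-s^{-1/r} x). By Tonelli and the Laplace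
transform of the stable sum, what remains is the integral of 1 - exp(-C s^{-ζ/r}), finite since ζ/r
> 1. -/
theorem lintegral_stableSum_rpow_lt_top {ζ r : ℝ} (hr : 0 < r) (hrζ : r < ζ) (hζ1 : ζ < 1) :
    ∫⁻ e, stableSum ζ e ^ r ∂expSeq < ∞ := by
  have hζ0 : 0 < ζ := hr.trans hrζ
  have h : (∫⁻ e, stableSum ζ e ^ r ∂expSeq) * stableConst r < ∞ := by
    rw [← lintegral_mul_const _ (by fun_prop)]
    simp_rw [← lintegral_one_sub_expNeg_rpow_mul hr]
    rw [lintegral_lintegral_swap (by fun_prop)]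
    have := lintegral_one_sub_expNeg_rpow_lt_top (p := -ζ / r) (by
      rw [neg_div, neg_lt_neg_iff]; exact (one_lt_div hr).2 hrζ)
      (c := (stableConst ζ).toReal) ENNReal.toReal_nonneg
    refine lt_of_le_of_lt (le_of_eq ?_) this
    refine setLIntegral_congr_fun measurableSet_Ioi fun s hs => ?_
    have hs' : (0 : ℝ) < s := hs
    rw [lintegral_sub (by fun_prop) _ (ae_of_all _ fun _ => expNeg_le_one _),
      lintegral_expNeg_mul_stableSum hζ0 hζ1 (by simp), ENNReal.ofReal_rpow_of_pos (by positivity),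
      ← Real.rpow_mul hs'.le, ENNReal.ofReal_mul (by positivity),
      ENNReal.ofReal_toReal (stableConst_lt_top hζ0 hζ1).ne]
    · simp only [lintegral_const, measure_univ, mul_one]
      congr 5
      ring
    · exact ((lintegral_mono fun _ => expNeg_le_one _).trans_lt (by simp)).ne
  by_contra h2
  rw [not_lt_top_iff.1 h2, ENNReal.top_mul (stableConst_ne_zero r)] at h
  exact lt_irrefl _ h

theorem ae_stableSum_pos_lt_top {ζ : ℝ} (hζ0 : 0 < ζ) (hζ1 : ζ < 1) :
    ∀ᵐ e ∂expSeq, 0 < stableSum ζ e ∧ stableSum ζ e < ∞ := by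
  have h := ae_lt_top (by fun_prop)
    (lintegral_stableSum_rpow_lt_top (half_pos hζ0) (half_lt_self hζ0) hζ1).ne
  filter_upwards [h, ae_pos_expSeq] with e he hpos
  constructor
  · refine lt_of_lt_of_le ?_ (ENNReal.le_tsum 0)
    exact ENNReal.ofReal_pos.2 (Real.rpow_pos_of_pos (arrival_pos hpos 0) _)
  · by_contra h2
    rw [not_lt_top_iff.1 h2, ENNReal.top_rpow_of_pos (half_pos hζ0)] at he
    exact lt_irrefl _ he

/-- From above the logarithm is controlled by the moment of order ζ/2, from below by the largest
point `e 0 ^ (-1 / ζ)` alone. -/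
theorem integrable_log_stableSum {ζ : ℝ} (hζ0 : 0 < ζ) (hζ1 : ζ < 1) :
    Integrable (fun e => Real.log (stableSum ζ e).toReal) expSeq := by
  have hr : 0 < ζ / 2 := half_pos hζ0
  have h1 : Integrable (fun e => (stableSum ζ e ^ (ζ / 2)).toReal) expSeq :=
    integrable_toReal_of_lintegral_ne_top (by fun_prop)
      (lintegral_stableSum_rpow_lt_top hr (half_lt_self hζ0) hζ1).ne
  have h2 : Integrable (fun e : ℕ → ℝ => e 0) expSeq :=
    (measurePreserving_eval_infinitePi (fun _ : ℕ => expMeasure 1) 0).integrable_comp_of_integrable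
      integrable_id_expMeasure
  refine ((h1.const_mul (1 / (ζ / 2))).add (h2.const_mul (1 / ζ))).mono'
    ((by fun_prop : Measurable _).aestronglyMeasurable) ?_
  filter_upwards [ae_stableSum_pos_lt_top hζ0 hζ1, ae_pos_expSeq] with e he hpos
  set x := (stableSum ζ e).toReal with hx
  have hx0 : 0 < x := ENNReal.toReal_pos he.1.ne' he.2.ne
  have e1 : (stableSum ζ e ^ (ζ / 2)).toReal = x ^ (ζ / 2) := by
    rw [hx, ENNReal.toReal_rpow]
  have hup : Real.log x ≤ 1 / (ζ / 2) * x ^ (ζ / 2) := by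
    have := Real.log_le_rpow_div hx0.le hr
    rwa [one_div_mul_eq_div]
  have hlow : -Real.log x ≤ 1 / ζ * e 0 := by
    have h3 : e 0 ^ (-1 / ζ) ≤ x := by
      have := ENNReal.toReal_mono he.2.ne (ENNReal.le_tsum (f := point ζ e) 0)
      rwa [point, arrival_zero, ENNReal.toReal_ofReal (Real.rpow_nonneg (hpos 0).le _)] at this
    have h4 := Real.log_le_log (Real.rpow_pos_of_pos (hpos 0) _) h3
    rw [Real.log_rpow (hpos 0)] at h4
    have h5 := Real.log_le_self (hpos 0).le
    have h6 : 1 / ζ * Real.log (e 0) ≤ 1 / ζ * e 0 := by gcongr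
    have : -1 / ζ * Real.log (e 0) = -(1 / ζ * Real.log (e 0)) := by ring
    linarith
  simp only [Pi.add_apply]
  rw [Real.norm_eq_abs, e1, abs_le]
  have h7 : 0 ≤ 1 / (ζ / 2) * x ^ (ζ / 2) := by positivity
  have h8 : 0 ≤ 1 / ζ * e 0 := mul_nonneg (by positivity) (hpos 0).le
  constructor <;> linarith

end StableSums

/-! ### The one-dimensional Prékopa-Leindler inequality. -/

section PrekopaLeindler

open scoped Pointwise in
theorem volume_image_mul_add {l : ℝ} (hl : 0 ≤ l) (c : ℝ) (s : Set ℝ) :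
    volume ((fun x => l * x + c) '' s) = ENNReal.ofReal l * volume s := by
  have h1 : (fun x => l * x + c) '' s = (fun x => x + c) '' (l • s) := by
    rw [← image_smul, image_image]; rfl
  rw [h1, image_add_right, measure_preimage_add_right, Measure.addHaar_smul_of_nonneg _ hl]
  simp

/-- Both l K + m min K' and l max K + m K' lie in C. The first is to the left of the second, and
they meet at one point. -/
theorem volume_add_le_of_isCompact {l m : ℝ} (hl : 0 ≤ l) (hm : 0 ≤ m) {K K' C : Set ℝ}
    (hK : IsCompact K) (hK' : IsCompact K') (hKne : K.Nonempty) (hKne' : K'.Nonempty)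
    (h : ∀ a ∈ K, ∀ b ∈ K', l * a + m * b ∈ C) :
    ENNReal.ofReal l * volume K + ENNReal.ofReal m * volume K' ≤ volume C := by
  obtain ⟨a, haK, ha⟩ := hK.exists_isMaxOn hKne continuous_id.continuousOn
  obtain ⟨b, hbK, hb⟩ := hK'.exists_isMinOn hKne' continuous_id.continuousOn
  have hS : MeasurableSet ((fun x => m * x + l * a) '' K') :=
    (hK'.image (by fun_prop)).measurableSet
  rw [← volume_image_mul_add hl (m * b), ← volume_image_mul_add hm (l * a),
    ← measure_union₀ hS.nullMeasurableSet]
  · refine measure_mono (union_subset ?_ ?_)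
    · rintro _ ⟨x, hx, rfl⟩; exact h x hx b hbK
    · rintro _ ⟨x, hx, rfl⟩
      have := h a haK x hx
      rwa [add_comm] at this
  · refine measure_mono_null (t := {l * a + m * b}) ?_ (by simp)
    rintro z ⟨⟨x, hx, rfl⟩, ⟨y, hy, hxy⟩⟩
    have h1 : x ≤ a := ha hx
    have h2 : b ≤ y := hb hy
    have h3 := mul_le_mul_of_nonneg_left h1 hl
    have h4 := mul_le_mul_of_nonneg_left h2 hm
    simp only at hxy
    simp only [mem_singleton_iff]
    linarith

/-- The one-dimensional Brunn-Minkowski inequality. -/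
theorem volume_add_le {l m : ℝ} (hl : 0 ≤ l) (hm : 0 ≤ m) {A B C : Set ℝ}
    (hA : MeasurableSet A) (hB : MeasurableSet B) (hAne : A.Nonempty) (hBne : B.Nonempty)
    (h : ∀ a ∈ A, ∀ b ∈ B, l * a + m * b ∈ C) :
    ENNReal.ofReal l * volume A + ENNReal.ofReal m * volume B ≤ volume C := by
  obtain ⟨a, ha⟩ := hAne
  obtain ⟨b, hb⟩ := hBne
  rw [hA.measure_eq_iSup_isCompact, hB.measure_eq_iSup_isCompact]
  simp_rw [iSup_and', iSup_subtype', ENNReal.mul_iSup]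
  have : Nonempty {K : Set ℝ // K ⊆ A ∧ IsCompact K} := ⟨∅, by simp⟩
  have : Nonempty {K : Set ℝ // K ⊆ B ∧ IsCompact K} := ⟨∅, by simp⟩
  refine ENNReal.iSup_add_iSup_le fun K K' => ?_
  -- The compact subsets may be empty; adding a point of A and a point of B makes them nonempty.
  refine le_trans ?_ (volume_add_le_of_isCompact hl hm (K := insert a K.1) (K' := insert b K'.1)
    (K.2.2.insert a) (K'.2.2.insert b) (insert_nonempty _ _) (insert_nonempty _ _)
    fun x hx y hy => h x (insert_subset ha K.2.1 hx) y (insert_subset hb K'.2.1 hy))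
  gcongr <;> exact subset_insert _ _

theorem lintegral_ofReal_eq_setLIntegral_Ioo {f : ℝ → ℝ} (hf : Measurable f) (h0 : ∀ x, 0 ≤ f x)
    (h1 : ∀ x, f x ≤ 1) :
    ∫⁻ x, ENNReal.ofReal (f x) = ∫⁻ t in Ioo 0 1, volume {x | t < f x} := by
  rw [lintegral_eq_lintegral_meas_lt _ (ae_of_all _ h0) hf.aemeasurable,
    ← lintegral_indicator measurableSet_Ioi, ← lintegral_indicator measurableSet_Ioo]
  congr 1 with t
  by_cases ht0 : 0 < t
  · by_cases ht1 : t < 1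
    · simp [ht0, ht1]
    · have : {x | t < f x} = ∅ := by
        ext x; simp only [mem_ofPred_eq, mem_empty_iff_false, iff_false, not_lt]
        exact (h1 x).trans (not_lt.1 ht1)
      simp [ht1, this]
  · simp [ht0]

/-- Apply Brunn-Minkowski at each level t to {f > t}, {g > t} and {h > t}, then integrate over t.
The suprema are normalized to 1 so that no level t < 1 has an empty set on the left. -/
theorem prekopa_leindler_normalized {f g h : ℝ → ℝ} {l : ℝ} (hl0 : 0 < l) (hl1 : l < 1)
    (hf : Measurable f) (hg : Measurable g) (hh : Measurable h) (hf0 : ∀ x, 0 ≤ f x)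
    (hg0 : ∀ x, 0 ≤ g x) (hh0 : ∀ x, 0 ≤ h x) (hf1 : ∀ x, f x ≤ 1) (hg1 : ∀ x, g x ≤ 1)
    (hfs : ∀ t < 1, ∃ x, t < f x) (hgs : ∀ t < 1, ∃ x, t < g x)
    (H : ∀ x y, f x ^ l * g y ^ (1 - l) ≤ h (l * x + (1 - l) * y)) :
    ENNReal.ofReal l * (∫⁻ x, ENNReal.ofReal (f x)) +
        ENNReal.ofReal (1 - l) * (∫⁻ x, ENNReal.ofReal (g x))
      ≤ ∫⁻ x, ENNReal.ofReal (h x) := by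
  rw [lintegral_ofReal_eq_setLIntegral_Ioo hf hf0 hf1,
    lintegral_ofReal_eq_setLIntegral_Ioo hg hg0 hg1]
  have hanti : ∀ u : ℝ → ℝ, Measurable fun t : ℝ => volume {x | t < u x} := fun u =>
    Antitone.measurable fun s t hst => measure_mono fun x hx => lt_of_le_of_lt hst hx
  rw [← lintegral_const_mul _ (hanti f), ← lintegral_const_mul _ (hanti g),
    ← lintegral_add_left ((hanti f).const_mul _),
    lintegral_eq_lintegral_meas_lt _ (ae_of_all _ hh0) hh.aemeasurable]
  refine le_trans ?_ (lintegral_mono_set (Ioo_subset_Ioi_self : Ioo (0 : ℝ) 1 ⊆ Ioi 0))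
  refine setLIntegral_mono' measurableSet_Ioo fun t ht => ?_
  refine volume_add_le hl0.le (by linarith) (measurableSet_lt measurable_const hf)
    (measurableSet_lt measurable_const hg) (hfs t ht.2) (hgs t ht.2) fun x hx y hy => ?_
  refine lt_of_lt_of_le ?_ (H x y)
  have e : t = t ^ l * t ^ (1 - l) := by
    rw [← Real.rpow_add ht.1]; simp
  rw [e]
  exact mul_lt_mul'' (Real.rpow_lt_rpow ht.1.le hx hl0) (Real.rpow_lt_rpow ht.1.le hy (by linarith))
    (Real.rpow_nonneg ht.1.le _) (Real.rpow_nonneg ht.1.le _)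

/-- Divide f and g by their suprema A and B, and h by A^l B^(1-l). The arithmetic-geometric
inequality then turns the additive form into the multiplicative one, in which A and B disappear. -/
theorem prekopa_leindler_bounded {f g h : ℝ → ℝ} {l a b : ℝ} (hl0 : 0 < l) (hl1 : l < 1)
    (hf : Measurable f) (hg : Measurable g) (hh : Measurable h) (hf0 : ∀ x, 0 ≤ f x)
    (hg0 : ∀ x, 0 ≤ g x) (hh0 : ∀ x, 0 ≤ h x) (hf1 : ∀ x, f x ≤ a) (hg1 : ∀ x, g x ≤ b)
    (hfi : ∫⁻ x, ENNReal.ofReal (f x) ≠ ∞) (hgi : ∫⁻ x, ENNReal.ofReal (g x) = 1)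
    (H : ∀ x y, f x ^ l * g y ^ (1 - l) ≤ h (l * x + (1 - l) * y)) :
    (∫⁻ x, ENNReal.ofReal (f x)) ^ l ≤ ∫⁻ x, ENNReal.ofReal (h x) := by
  have hbf : BddAbove (range f) := ⟨a, by rintro _ ⟨x, rfl⟩; exact hf1 x⟩
  have hbg : BddAbove (range g) := ⟨b, by rintro _ ⟨x, rfl⟩; exact hg1 x⟩
  set A := ⨆ x, f x
  set B := ⨆ x, g x
  have hfA : ∀ x, f x ≤ A := le_ciSup hbf
  have hgB : ∀ x, g x ≤ B := le_ciSup hbg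
  rcases (le_trans (hf0 0) (hfA 0)).eq_or_lt with hA | hA
  · have : ∀ x, f x = 0 := fun x => le_antisymm (hA ▸ hfA x) (hf0 x)
    simp [this, hl0]
  have hB : 0 < B := by
    refine (le_trans (hg0 0) (hgB 0)).lt_of_ne fun hB => ?_
    have : ∀ x, g x = 0 := fun x => le_antisymm (hB ▸ hgB x) (hg0 x)
    simp [this] at hgi
  set c := A ^ l * B ^ (1 - l) with hc
  have hc0 : 0 < c := mul_pos (Real.rpow_pos_of_pos hA _) (Real.rpow_pos_of_pos hB _)
  have key := prekopa_leindler_normalized hl0 hl1 (f := fun x => f x / A) (g := fun x => g x / B)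
    (h := fun x => h x / c) (by fun_prop) (by fun_prop) (by fun_prop)
    (fun x => div_nonneg (hf0 x) hA.le) (fun x => div_nonneg (hg0 x) hB.le)
    (fun x => div_nonneg (hh0 x) hc0.le) (fun x => (div_le_one hA).2 (hfA x))
    (fun x => (div_le_one hB).2 (hgB x))
    (fun t ht => by
      obtain ⟨x, hx⟩ := exists_lt_of_lt_ciSup (show t * A < ⨆ x, f x by
        have := mul_lt_mul_of_pos_right ht hA; rwa [one_mul] at this)
      exact ⟨x, (lt_div_iff₀ hA).2 hx⟩)
    (fun t ht => by
      obtain ⟨x, hx⟩ := exists_lt_of_lt_ciSup (show t * B < ⨆ x, g x by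
        have := mul_lt_mul_of_pos_right ht hB; rwa [one_mul] at this)
      exact ⟨x, (lt_div_iff₀ hB).2 hx⟩)
    (fun x y => by
      rw [Real.div_rpow (hf0 x) hA.le, Real.div_rpow (hg0 y) hB.le, div_mul_div_comm]
      gcongr
      exact H x y)
  have hdiv : ∀ (u : ℝ → ℝ) (r : ℝ), Measurable u → 0 < r →
      ∫⁻ x, ENNReal.ofReal (u x / r) = ENNReal.ofReal r⁻¹ * ∫⁻ x, ENNReal.ofReal (u x) := by
    intro u r hu hr
    rw [← lintegral_const_mul _ (by fun_prop)]
    congr 1 with x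
    rw [← ENNReal.ofReal_mul (inv_pos.2 hr).le, div_eq_inv_mul]
  rw [hdiv f A hf hA, hdiv g B hg hB, hdiv h c hh hc0, hgi] at key
  set F := (∫⁻ x, ENNReal.ofReal (f x)).toReal with hF
  have hF' : ∫⁻ x, ENNReal.ofReal (f x) = ENNReal.ofReal F := (ENNReal.ofReal_toReal hfi).symm
  have hF0 : 0 ≤ F := ENNReal.toReal_nonneg
  rw [hF'] at key ⊢
  have amgm := Real.geom_mean_le_arith_mean2_weighted hl0.le (by linarith : 0 ≤ 1 - l)
    (mul_nonneg (inv_pos.2 hA).le hF0) (inv_pos.2 hB).le (by ring)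
  have h1 : ENNReal.ofReal (l * (A⁻¹ * F) + (1 - l) * B⁻¹) ≤
      ENNReal.ofReal c⁻¹ * ∫⁻ x, ENNReal.ofReal (h x) := by
    refine le_trans (le_of_eq ?_) key
    rw [ENNReal.ofReal_add (by positivity) (mul_nonneg (by linarith) (inv_pos.2 hB).le),
      ENNReal.ofReal_mul hl0.le, ENNReal.ofReal_mul (inv_pos.2 hA).le,
      ENNReal.ofReal_mul (by linarith : 0 ≤ 1 - l), mul_one]
  have h2 := (ENNReal.ofReal_le_ofReal amgm).trans h1
  have h3 := mul_le_mul_right h2 (ENNReal.ofReal c)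
  rw [← mul_assoc, ← ENNReal.ofReal_mul hc0.le, ← ENNReal.ofReal_mul hc0.le,
    mul_inv_cancel₀ hc0.ne', ENNReal.ofReal_one, one_mul] at h3
  refine le_trans (le_of_eq ?_) h3
  rw [ENNReal.ofReal_rpow_of_nonneg hF0 hl0.le]
  congr 1
  rw [hc, Real.mul_rpow (inv_pos.2 hA).le hF0, Real.inv_rpow hA.le, Real.inv_rpow hB.le]
  have := (Real.rpow_pos_of_pos hA l).ne'
  have := (Real.rpow_pos_of_pos hB (1 - l)).ne'
  field_simp

end PrekopaLeindler

/-! ### Sup-convolution inequality for Gaussian measures. -/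

section GaussianSupConvolution

theorem lintegral_gaussianReal {f : ℝ → ℝ≥0∞} (hf : Measurable f) :
    ∫⁻ x, f x ∂(gaussianReal 0 1) = ∫⁻ x, ENNReal.ofReal (gaussianPDFReal 0 1 x) * f x := by
  rw [gaussianReal_of_var_ne_zero 0 one_ne_zero,
    lintegral_withDensity_eq_lintegral_mul _ (measurable_gaussianPDF 0 1) hf]
  rfl

/-- With w = l x + (1-l) y, one has l x² + (1-l) y² = w² + l (1-l) (x-y)² and x - w = (1-l) (x-y).
-/
theorem gaussianPDFReal_rpow_mul {l : ℝ} (hl1 : l < 1) (x y : ℝ) :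
    gaussianPDFReal 0 1 x ^ l * gaussianPDFReal 0 1 y ^ (1 - l) =
      gaussianPDFReal 0 1 (l * x + (1 - l) * y) *
        Real.exp (-(l / (2 * (1 - l)) * (x - (l * x + (1 - l) * y)) ^ 2)) := by
  have hl : 1 - l ≠ 0 := by linarith
  simp only [gaussianPDFReal, NNReal.coe_one, mul_one, sub_zero]
  set c := (√(2 * Real.pi))⁻¹
  have hc : 0 < c := by positivity
  rw [Real.mul_rpow hc.le (Real.exp_pos _).le, Real.mul_rpow hc.le (Real.exp_pos _).le,
    ← Real.exp_mul, ← Real.exp_mul]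
  calc _ = (c ^ l * c ^ (1 - l)) * (Real.exp (-x ^ 2 / 2 * l) * Real.exp (-y ^ 2 / 2 * (1 - l))) := by
        ring
    _ = c * Real.exp (-x ^ 2 / 2 * l + -y ^ 2 / 2 * (1 - l)) := by
        rw [← Real.rpow_add hc, ← Real.exp_add]; simp
    _ = _ := by
        rw [mul_assoc, ← Real.exp_add]
        congr 2
        field_simp
        ring

theorem gaussianPDFReal_le (x : ℝ) : gaussianPDFReal 0 1 x ≤ gaussianPDFReal 0 1 0 := by
  simp only [gaussianPDFReal]
  refine mul_le_mul_of_nonneg_left (Real.exp_le_exp.2 ?_) (by positivity)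
  simp only [sub_zero, NNReal.coe_one, mul_one]
  have := sq_nonneg x
  linarith

/-- Prékopa-Leindler for f p, p and h p, where p is the Gaussian density: the log-concavity excess
of p pays exactly for the quadratic cost. -/
theorem gaussian_supConvolution_bounded {f h : ℝ → ℝ≥0∞} {l : ℝ} {n : ℝ≥0} (hl0 : 0 < l)
    (hl1 : l < 1) (hf : Measurable f) (hh : Measurable h) (hfn : ∀ x, f x ≤ n)
    (H : ∀ x w, f x ^ l * ENNReal.ofReal (Real.exp (-(l / (2 * (1 - l)) * (x - w) ^ 2))) ≤ h w) :
    (∫⁻ x, f x ∂(gaussianReal 0 1)) ^ l ≤ ∫⁻ x, h x ∂(gaussianReal 0 1) := by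
  set p := gaussianPDFReal 0 1
  have hp0 : ∀ x, 0 ≤ p x := gaussianPDFReal_nonneg 0 1
  have hpm : Measurable p := measurable_gaussianPDFReal 0 1
  have hft : ∀ x, f x ≠ ∞ := fun x => ((hfn x).trans_lt (by simp)).ne
  have hnl : (n : ℝ≥0∞) ^ l ≠ ∞ := ENNReal.rpow_ne_top_of_nonneg hl0.le (by simp)
  -- Since f is at most n and the exponential at most 1, cutting h at this height keeps the
  -- hypothesis and makes h finite.
  set k : ℝ → ℝ≥0∞ := fun w => min (h w) ((n : ℝ≥0∞) ^ l) with hk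
  have hkm : Measurable k := hh.min measurable_const
  have hkt : ∀ w, k w ≠ ∞ := fun w => ((min_le_right _ _).trans_lt hnl.lt_top).ne
  have hexp1 : ∀ x w : ℝ, Real.exp (-(l / (2 * (1 - l)) * (x - w) ^ 2)) ≤ 1 := fun x w => by
    rw [Real.exp_le_one_iff, neg_nonpos]
    have : 0 < 1 - l := by linarith
    positivity
  have Hk : ∀ x w, f x ^ l * ENNReal.ofReal (Real.exp (-(l / (2 * (1 - l)) * (x - w) ^ 2))) ≤ k w := by
    intro x w
    refine le_min (H x w) ?_
    calc _ ≤ (n : ℝ≥0∞) ^ l * 1 := by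
          gcongr
          · exact hfn x
          · simpa using hexp1 x w
      _ = _ := mul_one _
  refine le_trans ?_ (lintegral_mono (f := k) fun w => min_le_left _ _)
  have e1 : ∀ u : ℝ → ℝ≥0∞, Measurable u → (∀ x, u x ≠ ∞) →
      ∫⁻ x, u x ∂(gaussianReal 0 1) = ∫⁻ x, ENNReal.ofReal (p x * (u x).toReal) := by
    intro u hu hut
    rw [lintegral_gaussianReal hu]
    congr 1 with x
    rw [ENNReal.ofReal_mul (hp0 x), ENNReal.ofReal_toReal (hut x)]
  have hfi : ∫⁻ x, f x ∂(gaussianReal 0 1) ≠ ∞ :=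
    ((lintegral_mono hfn).trans_lt (by simp)).ne
  rw [e1 f hf hft] at hfi ⊢
  rw [e1 k hkm hkt]
  have hfr : ∀ x, (f x).toReal ≤ n := fun x => by
    simpa using ENNReal.toReal_mono (by simp) (hfn x)
  refine prekopa_leindler_bounded (g := p) (a := p 0 * n) (b := p 0) hl0 hl1 (by fun_prop) hpm
    (by fun_prop) (fun x => mul_nonneg (hp0 x) ENNReal.toReal_nonneg) hp0
    (fun x => mul_nonneg (hp0 x) ENNReal.toReal_nonneg)
    (fun x => mul_le_mul (gaussianPDFReal_le x) (hfr x) ENNReal.toReal_nonneg (hp0 0))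
    gaussianPDFReal_le hfi (lintegral_gaussianPDFReal_eq_one 0 one_ne_zero) fun x y => ?_
  rw [Real.mul_rpow (hp0 x) ENNReal.toReal_nonneg]
  have h3 := ENNReal.toReal_mono (hkt _) (Hk x (l * x + (1 - l) * y))
  rw [ENNReal.toReal_mul, ENNReal.toReal_ofReal (Real.exp_pos _).le, ← ENNReal.toReal_rpow] at h3
  calc _ = (p x ^ l * p y ^ (1 - l)) * (f x).toReal ^ l := by ring
    _ = p (l * x + (1 - l) * y) * ((f x).toReal ^ l *
        Real.exp (-(l / (2 * (1 - l)) * (x - (l * x + (1 - l) * y)) ^ 2))) := by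
        rw [gaussianPDFReal_rpow_mul hl1]; ring
    _ ≤ _ := mul_le_mul_of_nonneg_left h3 (hp0 _)

theorem gaussian_supConvolution {f h : ℝ → ℝ≥0∞} {l : ℝ} (hl0 : 0 < l)
    (hl1 : l < 1) (hf : Measurable f) (hh : Measurable h)
    (H : ∀ x w, f x ^ l * ENNReal.ofReal (Real.exp (-(l / (2 * (1 - l)) * (x - w) ^ 2))) ≤ h w) :
    (∫⁻ x, f x ∂(gaussianReal 0 1)) ^ l ≤ ∫⁻ x, h x ∂(gaussianReal 0 1) := by
  have hmono : Monotone fun (n : ℕ) x => min (f x) (n : ℝ≥0∞) := fun a b hab x =>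
    min_le_min le_rfl (by exact_mod_cast hab)
  have hlim : Tendsto (fun n : ℕ => (∫⁻ x, min (f x) (n : ℝ≥0∞) ∂(gaussianReal 0 1)) ^ l) atTop
      (𝓝 ((∫⁻ x, f x ∂(gaussianReal 0 1)) ^ l)) := by
    refine (ENNReal.continuous_rpow_const.tendsto _).comp ?_
    refine lintegral_tendsto_of_tendsto_of_monotone (fun n => (hf.min measurable_const).aemeasurable)
      (ae_of_all _ fun x => fun a b hab => hmono hab x) (ae_of_all _ fun x => ?_)
    have := (tendsto_const_nhds (x := f x)).min ENNReal.tendsto_nat_nhds_top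
    simpa using this
  refine le_of_tendsto' hlim fun n => ?_
  refine gaussian_supConvolution_bounded (n := n) hl0 hl1 (hf.min measurable_const) hh
    (fun x => by simp) fun x w => le_trans ?_ (H x w)
  gcongr
  exact min_le_left _ _

theorem lintegral_pi_gaussian_succ {N : ℕ} {f : (Fin (N + 1) → ℝ) → ℝ≥0∞} (hf : Measurable f) :
    ∫⁻ x, f x ∂(Measure.pi fun _ : Fin (N + 1) => gaussianReal 0 1) =
      ∫⁻ a, ∫⁻ v, f (Fin.cons a v) ∂(Measure.pi fun _ : Fin N => gaussianReal 0 1)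
        ∂(gaussianReal 0 1) := by
  have h := (measurePreserving_piFinSuccAbove (fun _ : Fin (N + 1) => gaussianReal 0 1) 0).symm
  rw [← h.lintegral_comp hf, lintegral_prod _ (by fun_prop)]
  simp [MeasurableEquiv.piFinSuccAbove, Fin.consEquiv]

/-- The inequality tensorizes: the quadratic cost is additive over the coordinates, so the last N
coordinates are integrated by induction and the first one by the case of dimension one. -/
theorem pi_gaussian_supConvolution {l : ℝ} (hl0 : 0 < l) (hl1 : l < 1) (N : ℕ) :
    ∀ {f h : (Fin N → ℝ) → ℝ≥0∞}, Measurable f → Measurable h →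
    (∀ x w, f x ^ l * ENNReal.ofReal (Real.exp (-(l / (2 * (1 - l)) * ∑ i, (x i - w i) ^ 2))) ≤ h w) →
    (∫⁻ x, f x ∂(Measure.pi fun _ : Fin N => gaussianReal 0 1)) ^ l ≤
      ∫⁻ x, h x ∂(Measure.pi fun _ : Fin N => gaussianReal 0 1) := by
  induction N with
  | zero =>
    intro f h hf hh H
    rw [Measure.pi_of_empty, lintegral_dirac' _ hf, lintegral_dirac' _ hh]
    simpa using H _ _
  | succ N ih =>
    intro f h hf hh H
    have hcons : Measurable fun p : ℝ × (Fin N → ℝ) => (Fin.cons p.1 p.2 : Fin (N + 1) → ℝ) := by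
      refine measurable_pi_iff.2 fun i => ?_
      refine Fin.cases ?_ (fun j => ?_) i
      · simpa using measurable_fst
      · simp only [Fin.cons_succ]; fun_prop
    have hfc := hf.comp hcons
    have hhc := hh.comp hcons
    have hcs : ∀ a : ℝ, Measurable fun v : Fin N → ℝ => (Fin.cons a v : Fin (N + 1) → ℝ) := fun a =>
      hcons.comp measurable_prodMk_left
    rw [lintegral_pi_gaussian_succ hf, lintegral_pi_gaussian_succ hh]
    refine gaussian_supConvolution hl0 hl1 hfc.lintegral_prod_right' hhc.lintegral_prod_right'
      fun a b => ?_
    set E := ENNReal.ofReal (Real.exp (-(l / (2 * (1 - l)) * (a - b) ^ 2))) with hE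
    have hEt : E ^ l⁻¹ ≠ ∞ := ENNReal.rpow_ne_top_of_nonneg (by positivity) (by simp [hE])
    -- The cost `E` of the first coordinate enters f with the exponent 1/l, since f is raised to the
    -- power l.
    have key := ih (f := fun v => E ^ l⁻¹ * f (Fin.cons a v)) (h := fun v => h (Fin.cons b v))
      ((hf.comp (hcs a)).const_mul _) (hh.comp (hcs b)) fun x w => by
        refine le_trans (le_of_eq ?_) (H (Fin.cons a x) (Fin.cons b w))
        rw [ENNReal.mul_rpow_of_nonneg _ _ hl0.le, ← ENNReal.rpow_mul, inv_mul_cancel₀ hl0.ne',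
          ENNReal.rpow_one, Fin.sum_univ_succ]
        simp only [Fin.cons_zero, Fin.cons_succ]
        rw [mul_add, neg_add, Real.exp_add, ENNReal.ofReal_mul (Real.exp_pos _).le]
        ring
    rw [lintegral_const_mul (E ^ l⁻¹) (f := fun v => f (Fin.cons a v)) (hf.comp (hcs a)),
      ENNReal.mul_rpow_of_nonneg _ _ hl0.le,
      ← ENNReal.rpow_mul, inv_mul_cancel₀ hl0.ne', ENNReal.rpow_one, mul_comm] at key
    exact key

end GaussianSupConvolution

/-! ### The Parisi operator and its dependence on ζ. -/

section ParisiOperator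

variable {N : ℕ}

/-- The standard Gaussian measure on `ℝ^N`. -/
abbrev gauss (N : ℕ) : Measure (EuclideanSpace ℝ (Fin N)) :=
  stdGaussian (EuclideanSpace ℝ (Fin N))

theorem gauss_supConvolution {l : ℝ} (hl0 : 0 < l) (hl1 : l < 1)
    {f h : EuclideanSpace ℝ (Fin N) → ℝ≥0∞} (hf : Measurable f) (hh : Measurable h)
    (H : ∀ x w, f x ^ l * ENNReal.ofReal (Real.exp (-(l / (2 * (1 - l)) * ‖x - w‖ ^ 2))) ≤ h w) :
    (∫⁻ x, f x ∂(gauss N)) ^ l ≤ ∫⁻ x, h x ∂(gauss N) := by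
  have hm : Measurable (WithLp.toLp 2 : (Fin N → ℝ) → EuclideanSpace ℝ (Fin N)) :=
    WithLp.measurable_toLp 2 _
  rw [gauss, ← map_pi_eq_stdGaussian, lintegral_map hf hm, lintegral_map hh hm]
  refine pi_gaussian_supConvolution hl0 hl1 N (hf.comp hm) (hh.comp hm) fun x w => ?_
  have := H (WithLp.toLp 2 x) (WithLp.toLp 2 w)
  rw [EuclideanSpace.real_norm_sq_eq] at this
  exact this

/-- Fernique's theorem gives a Gaussian exponential moment, which dominates after completing the
square. -/
theorem integrable_exp_mul_norm (c : ℝ) : Integrable (fun z => Real.exp (c * ‖z‖)) (gauss N) := by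
  obtain ⟨C, hC, hi⟩ := IsGaussian.exists_integrable_exp_sq (gauss N)
  refine (hi.const_mul (Real.exp (c ^ 2 / (4 * C)))).mono' (by fun_prop) (ae_of_all _ fun z => ?_)
  rw [Real.norm_of_nonneg (Real.exp_pos _).le, ← Real.exp_add, Real.exp_le_exp]
  have : c ^ 2 / (4 * C) + C * ‖z‖ ^ 2 - c * ‖z‖ = C * (‖z‖ - c / (2 * C)) ^ 2 := by
    field_simp; ring
  have h2 : 0 ≤ C * (‖z‖ - c / (2 * C)) ^ 2 := by positivity
  linarith

theorem integrable_norm_gauss : Integrable (fun z : EuclideanSpace ℝ (Fin N) => ‖z‖) (gauss N) :=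
  (IsGaussian.integrable_id (μ := gauss N)).norm

variable {L : ℝ≥0} {φ ψ : EuclideanSpace ℝ (Fin N) → ℝ}

theorem abs_le_of_lipschitzWith (hφ : LipschitzWith L φ) (a : ℝ) (y z : EuclideanSpace ℝ (Fin N)) :
    |φ (y + a • z)| ≤ |φ y| + L * |a| * ‖z‖ := by
  have h := hφ.dist_le_mul (y + a • z) y
  rw [Real.dist_eq, dist_eq_norm, add_sub_cancel_left, norm_smul, Real.norm_eq_abs, ← mul_assoc] at h
  have := abs_sub_abs_le_abs_sub (φ (y + a • z)) (φ y)
  linarith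

theorem integrable_comp_add_smul (hφ : LipschitzWith L φ) (a : ℝ) (y : EuclideanSpace ℝ (Fin N)) :
    Integrable (fun z => φ (y + a • z)) (gauss N) := by
  have := hφ.continuous
  refine ((integrable_const |φ y|).add (integrable_norm_gauss.const_mul (L * |a|))).mono'
    (by fun_prop) (ae_of_all _ fun z => ?_)
  exact abs_le_of_lipschitzWith hφ a y z

theorem integrable_exp_comp_add_smul (hφ : LipschitzWith L φ) (ζ a : ℝ)
    (y : EuclideanSpace ℝ (Fin N)) :
    Integrable (fun z => Real.exp (ζ * φ (y + a • z))) (gauss N) := by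
  have := hφ.continuous
  refine ((integrable_exp_mul_norm (N := N) (|ζ| * (L * |a|))).const_mul
    (Real.exp (|ζ| * |φ y|))).mono' (by fun_prop) (ae_of_all _ fun z => ?_)
  rw [Real.norm_of_nonneg (Real.exp_pos _).le, ← Real.exp_add, Real.exp_le_exp]
  have h1 := abs_le_of_lipschitzWith hφ a y z
  have h2 : ζ * φ (y + a • z) ≤ |ζ| * |φ (y + a • z)| := by
    rw [← abs_mul]; exact le_abs_self _
  have h3 := mul_le_mul_of_nonneg_left h1 (abs_nonneg ζ)
  linarith

theorem integral_exp_comp_pos (hφ : LipschitzWith L φ) (ζ a : ℝ) (y : EuclideanSpace ℝ (Fin N)) :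
    0 < ∫ z, Real.exp (ζ * φ (y + a • z)) ∂(gauss N) :=
  integral_exp_pos (integrable_exp_comp_add_smul hφ ζ a y)

/-- The operator `φ ↦ ζ⁻¹ log E exp (ζ φ (· + a z))`, where `z` is a standard Gaussian vector. -/
def parisiOp (ζ a : ℝ) (φ : EuclideanSpace ℝ (Fin N) → ℝ) (y : EuclideanSpace ℝ (Fin N)) : ℝ :=
  if ζ = 0 then ∫ z, φ (y + a • z) ∂(gauss N)
  else ζ⁻¹ * Real.log (∫ z, Real.exp (ζ * φ (y + a • z)) ∂(gauss N))

theorem exp_mul_parisiOp (hφ : LipschitzWith L φ) {ζ : ℝ} (hζ : ζ ≠ 0) (a : ℝ)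
    (y : EuclideanSpace ℝ (Fin N)) :
    Real.exp (ζ * parisiOp ζ a φ y) = ∫ z, Real.exp (ζ * φ (y + a • z)) ∂(gauss N) := by
  rw [parisiOp, if_neg hζ, mul_inv_cancel_left₀ hζ, Real.exp_log (integral_exp_comp_pos hφ ζ a y)]

theorem parisiOp_zero_right (ζ : ℝ) (φ : EuclideanSpace ℝ (Fin N) → ℝ) : parisiOp ζ 0 φ = φ := by
  ext y
  by_cases hζ : ζ = 0 <;> simp [parisiOp, hζ]

/-- The operator is monotone and commutes with constants. With two base points, the same statement
serves for the Lipschitz bound and for the contraction in sup norm. -/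
theorem parisiOp_le (hφ : LipschitzWith L φ) {L' : ℝ≥0} (hψ : LipschitzWith L' ψ) {ζ : ℝ}
    (hζ : 0 ≤ ζ) {a c : ℝ} {y y' : EuclideanSpace ℝ (Fin N)}
    (h : ∀ z, φ (y + a • z) ≤ ψ (y' + a • z) + c) :
    parisiOp ζ a φ y ≤ parisiOp ζ a ψ y' + c := by
  rcases hζ.eq_or_lt with rfl | hζ
  · simp only [parisiOp, if_true]
    have := integral_mono (integrable_comp_add_smul hφ a y)
      ((integrable_comp_add_smul hψ a y').add (integrable_const c)) h
    simp only [Pi.add_apply] at this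
    rw [integral_add (integrable_comp_add_smul hψ a y') (integrable_const c)] at this
    simpa using this
  · have h1 : ∫ z, Real.exp (ζ * φ (y + a • z)) ∂(gauss N) ≤
        Real.exp (ζ * c) * ∫ z, Real.exp (ζ * ψ (y' + a • z)) ∂(gauss N) := by
      rw [← integral_const_mul]
      refine integral_mono (integrable_exp_comp_add_smul hφ ζ a y)
        ((integrable_exp_comp_add_smul hψ ζ a y').const_mul _) fun z => ?_
      simp only
      rw [← Real.exp_add, Real.exp_le_exp]
      have := mul_le_mul_of_nonneg_left (h z) hζ.le
      linarith
    rw [← exp_mul_parisiOp hφ hζ.ne', ← exp_mul_parisiOp hψ hζ.ne', ← Real.exp_add,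
      Real.exp_le_exp, ← mul_add] at h1
    have := le_of_mul_le_mul_left h1 hζ
    linarith

theorem lipschitzWith_parisiOp (hφ : LipschitzWith L φ) {ζ : ℝ} (hζ : 0 ≤ ζ) (a : ℝ) :
    LipschitzWith L (parisiOp ζ a φ) := by
  refine LipschitzWith.of_le_add_mul L fun x y => ?_
  refine parisiOp_le hφ hφ hζ fun z => ?_
  have := hφ.le_add_mul (x + a • z) (y + a • z)
  rwa [dist_add_right] at this

theorem abs_parisiOp_sub_le (hφ : LipschitzWith L φ) (hψ : LipschitzWith L ψ) {ζ : ℝ}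
    (hζ : 0 ≤ ζ) {a c : ℝ} (h : ∀ x, |φ x - ψ x| ≤ c) (y : EuclideanSpace ℝ (Fin N)) :
    |parisiOp ζ a φ y - parisiOp ζ a ψ y| ≤ c := by
  rw [abs_le]
  have h1 := parisiOp_le hφ hψ hζ (a := a) (c := c) (y := y) (y' := y) fun z => by
    linarith [(abs_le.1 (h (y + a • z))).2]
  have h2 := parisiOp_le hψ hφ hζ (a := a) (c := c) (y := y) (y' := y) fun z => by
    linarith [(abs_le.1 (h (y + a • z))).1]
  constructor <;> linarith

/-- Stability of Gaussian vectors under independent sums, by characteristic functions; it underlies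
the semigroup property. -/
theorem map_prod_gauss (a b : ℝ) :
    ((gauss N).prod (gauss N)).map (fun p => a • p.1 + b • p.2) =
      (gauss N).map (fun z => √(a ^ 2 + b ^ 2) • z) := by
  have h1 : ((gauss N).prod (gauss N)).map (fun p => a • p.1 + b • p.2) =
      ((gauss N).map (a • ·)) ∗ ((gauss N).map (b • ·)) := by
    rw [Measure.conv, Measure.map_prod_map _ _ (by fun_prop) (by fun_prop),
      Measure.map_map (by fun_prop) (by fun_prop)]
    rfl
  have := Measure.isProbabilityMeasure_map (μ := gauss N) (f := fun z => a • z) (by fun_prop)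
  have := Measure.isProbabilityMeasure_map (μ := gauss N) (f := fun z => b • z) (by fun_prop)
  rw [h1]
  apply Measure.ext_of_charFun
  ext t
  rw [charFun_conv, charFun_map_smul, charFun_map_smul, charFun_map_smul, charFun_stdGaussian,
    charFun_stdGaussian, charFun_stdGaussian, ← Complex.exp_add]
  congr 1
  have e : ∀ c : ℝ, ((‖c • t‖ : ℝ) : ℂ) ^ 2 = ((c ^ 2 * ‖t‖ ^ 2 : ℝ) : ℂ) := fun c => by
    rw [norm_smul, ← Complex.ofReal_pow, mul_pow, Real.norm_eq_abs, sq_abs]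
  rw [e, e, e, Real.sq_sqrt (by positivity)]
  push_cast
  ring

theorem integral_integral_gauss {F : EuclideanSpace ℝ (Fin N) → ℝ} (hF : Continuous F) (a b : ℝ)
    (y : EuclideanSpace ℝ (Fin N))
    (hi : Integrable (fun z => F (y + √(a ^ 2 + b ^ 2) • z)) (gauss N)) :
    ∫ z, ∫ z', F (y + a • z + b • z') ∂(gauss N) ∂(gauss N) =
      ∫ z, F (y + √(a ^ 2 + b ^ 2) • z) ∂(gauss N) := by
  have h1 : ∫ z, F (y + √(a ^ 2 + b ^ 2) • z) ∂(gauss N) =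
      ∫ x, F (y + x) ∂((gauss N).map fun z => √(a ^ 2 + b ^ 2) • z) := by
    rw [integral_map (by fun_prop) (by fun_prop)]
  have h2 : Integrable (fun x => F (y + x)) ((gauss N).map fun z => √(a ^ 2 + b ^ 2) • z) := by
    rw [integrable_map_measure (by fun_prop) (by fun_prop)]
    exact hi
  rw [h1, ← map_prod_gauss, integral_map (by fun_prop) (by fun_prop), integral_prod]
  · simp_rw [add_assoc]
  · rw [← map_prod_gauss, integrable_map_measure (by fun_prop) (by fun_prop)] at h2
    exact h2

/-- The semigroup property. -/
theorem parisiOp_parisiOp (hφ : LipschitzWith L φ) (ζ a b : ℝ) :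
    parisiOp ζ a (parisiOp ζ b φ) = parisiOp ζ (√(a ^ 2 + b ^ 2)) φ := by
  have hc := hφ.continuous
  ext y
  by_cases hζ : ζ = 0
  · subst hζ
    simp only [parisiOp, if_true]
    exact integral_integral_gauss hc a b y (integrable_comp_add_smul hφ _ y)
  · have h := integral_integral_gauss (F := fun x => Real.exp (ζ * φ x)) (by fun_prop) a b y
      (integrable_exp_comp_add_smul hφ ζ _ y)
    conv_lhs => rw [parisiOp, if_neg hζ]
    simp_rw [exp_mul_parisiOp hφ hζ, h]
    rw [parisiOp, if_neg hζ]

/-- Jensen's inequality, for the exponential when ζ = 0 and for the power ζ'/ζ otherwise. -/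
theorem parisiOp_mono (hφ : LipschitzWith L φ) {ζ ζ' : ℝ} (h0 : 0 ≤ ζ) (h : ζ < ζ') (a : ℝ)
    (y : EuclideanSpace ℝ (Fin N)) : parisiOp ζ a φ y ≤ parisiOp ζ' a φ y := by
  have hζ' : 0 < ζ' := h0.trans_lt h
  have key : ζ' * parisiOp ζ a φ y ≤ ζ' * parisiOp ζ' a φ y := by
    rw [← Real.exp_le_exp, exp_mul_parisiOp hφ hζ'.ne']
    rcases h0.eq_or_lt with rfl | h0
    · simp only [parisiOp, if_true]
      rw [← integral_const_mul]
      exact convexOn_exp.map_integral_le Real.continuous_exp.continuousOn isClosed_univ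
        (ae_of_all _ fun _ => mem_univ _) ((integrable_comp_add_smul hφ a y).const_mul _)
        (integrable_exp_comp_add_smul hφ ζ' a y)
    · have h1 : (1 : ℝ) ≤ ζ' / ζ := (one_le_div h0).2 h.le
      have e : ∀ x : ℝ, Real.exp (ζ * x) ^ (ζ' / ζ) = Real.exp (ζ' * x) := fun x => by
        rw [← Real.exp_mul]; congr 1; field_simp
      rw [← e, exp_mul_parisiOp hφ h0.ne']
      simp_rw [← e]
      refine (convexOn_rpow h1).map_integral_le
        (Real.continuous_rpow_const (by positivity)).continuousOn isClosed_Ici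
        (ae_of_all _ fun _ => (Real.exp_pos _).le) (integrable_exp_comp_add_smul hφ ζ a y) ?_
      simp only [Function.comp_def, e]
      exact integrable_exp_comp_add_smul hφ ζ' a y
  exact le_of_mul_le_mul_left key hζ'

/-- This is the integrated form of the bound that the logarithmic Sobolev inequality gives for the
derivative in ζ. Here it follows from the sup-convolution inequality with l = ζ/ζ', applied to
exp(ζ'(φ - c)) and exp(ζ φ). -/
theorem parisiOp_le_add_of_pos (hφ : LipschitzWith L φ) {ζ ζ' : ℝ} (h0 : 0 < ζ) (h : ζ < ζ') (a : ℝ)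
    (y : EuclideanSpace ℝ (Fin N)) :
    parisiOp ζ' a φ y ≤ parisiOp ζ a φ y + (ζ' - ζ) * (a ^ 2 * L ^ 2 / 2) := by
  have hc := hφ.continuous
  have hζ' : 0 < ζ' := h0.trans h
  set c := (ζ' - ζ) * (a ^ 2 * L ^ 2 / 2) with hcdef
  set l := ζ / ζ' with hl
  have hl0 : 0 < l := div_pos h0 hζ'
  have hl1 : l < 1 := (div_lt_one hζ').2 h
  have key := gauss_supConvolution hl0 hl1
    (f := fun x => ENNReal.ofReal (Real.exp (ζ' * (φ (y + a • x) - c))))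
    (h := fun x => ENNReal.ofReal (Real.exp (ζ * φ (y + a • x)))) (by fun_prop) (by fun_prop)
    fun x w => by
      rw [ENNReal.ofReal_rpow_of_pos (Real.exp_pos _), ← ENNReal.ofReal_mul (by positivity),
        ← Real.exp_mul, ← Real.exp_add]
      refine ENNReal.ofReal_le_ofReal (Real.exp_le_exp.2 ?_)
      set d := ‖x - w‖
      have h1 : φ (y + a • x) ≤ φ (y + a • w) + L * (|a| * d) := by
        have := hφ.le_add_mul (y + a • x) (y + a • w)
        rwa [dist_add_left, dist_eq_norm, ← smul_sub, norm_smul, Real.norm_eq_abs] at this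
      have h2 : ζ' * (φ (y + a • x) - c) * l = ζ * (φ (y + a • x) - c) := by
        rw [hl]; field_simp
      have h3 : l / (2 * (1 - l)) = ζ / (2 * (ζ' - ζ)) := by
        have : ζ' - ζ ≠ 0 := by linarith
        have : 1 - l ≠ 0 := by linarith
        rw [div_eq_div_iff (by positivity) (by positivity), hl]
        field_simp
      rw [h2, h3]
      have h4 : ζ * (φ (y + a • x) - c) ≤ ζ * (φ (y + a • w) + L * (|a| * d) - c) := by gcongr
      -- The constant `c` is the maximum over d of the Lipschitz gain minus the quadratic cost; the
      -- difference is a square.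
      have h5 : L * (|a| * d) ≤ c + 1 / (2 * (ζ' - ζ)) * d ^ 2 := by
        have hpos : 0 < ζ' - ζ := by linarith
        have e : c + 1 / (2 * (ζ' - ζ)) * d ^ 2 - L * (|a| * d) =
            1 / (2 * (ζ' - ζ)) * ((ζ' - ζ) * (|a| * L) - d) ^ 2 := by
          rw [hcdef, ← sq_abs a]; field_simp; ring
        have : 0 ≤ 1 / (2 * (ζ' - ζ)) * ((ζ' - ζ) * (|a| * L) - d) ^ 2 := by positivity
        linarith
      have h6 := mul_le_mul_of_nonneg_left h5 h0.le
      have h7 : ζ / (2 * (ζ' - ζ)) * d ^ 2 = ζ * (1 / (2 * (ζ' - ζ)) * d ^ 2) := by ring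
      rw [h7]
      linarith
  have hi1 : Integrable (fun x => Real.exp (ζ' * (φ (y + a • x) - c))) (gauss N) := by
    simp_rw [mul_sub, Real.exp_sub]
    exact (integrable_exp_comp_add_smul hφ ζ' a y).div_const _
  rw [← ofReal_integral_eq_lintegral_ofReal hi1 (ae_of_all _ fun _ => (Real.exp_pos _).le),
    ← ofReal_integral_eq_lintegral_ofReal (integrable_exp_comp_add_smul hφ ζ a y)
      (ae_of_all _ fun _ => (Real.exp_pos _).le), ← exp_mul_parisiOp hφ h0.ne'] at key
  have e2 : ∫ x, Real.exp (ζ' * (φ (y + a • x) - c)) ∂(gauss N) =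
      Real.exp (ζ' * parisiOp ζ' a φ y - ζ' * c) := by
    rw [Real.exp_sub, exp_mul_parisiOp hφ hζ'.ne', ← integral_div]
    simp_rw [mul_sub, Real.exp_sub]
  rw [e2, ENNReal.ofReal_rpow_of_pos (Real.exp_pos _), ENNReal.ofReal_le_ofReal_iff
    (Real.exp_pos _).le, ← Real.exp_mul, Real.exp_le_exp, hl] at key
  have e3 : (ζ' * parisiOp ζ' a φ y - ζ' * c) * (ζ / ζ') = ζ * (parisiOp ζ' a φ y - c) := by
    field_simp
  rw [e3] at key
  linarith [le_of_mul_le_mul_left key h0]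

/-- The cumulant generating function vanishes at 0, so its quotient by ζ tends to its derivative at
0, the mean. This carries the estimate in ζ to the endpoint 0. -/
theorem tendsto_parisiOp_zero (hφ : LipschitzWith L φ) (a : ℝ) (y : EuclideanSpace ℝ (Fin N)) :
    Tendsto (fun ζ => parisiOp ζ a φ y) (𝓝[>] 0) (𝓝 (parisiOp 0 a φ y)) := by
  set X := fun z : EuclideanSpace ℝ (Fin N) => φ (y + a • z) with hX
  have hset : integrableExpSet X (gauss N) = univ := by
    ext ζ
    simpa [integrableExpSet] using integrable_exp_comp_add_smul hφ ζ a y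
  have h0 : (0 : ℝ) ∈ interior (integrableExpSet X (gauss N)) := by simp [hset]
  have hd : HasDerivAt (cgf X (gauss N)) (∫ z, X z ∂(gauss N)) 0 := by
    have := (analyticAt_cgf h0).differentiableAt.hasDerivAt
    rw [deriv_cgf_zero h0] at this
    simpa using this
  have h1 := (hasDerivAt_iff_tendsto_slope_zero.1 hd).mono_left
    (nhdsWithin_mono (0 : ℝ) (fun x (hx : x ∈ Ioi (0 : ℝ)) => (ne_of_gt hx : x ≠ 0)))
  have e0 : parisiOp 0 a φ y = ∫ z, X z ∂(gauss N) := by simp [parisiOp, hX]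
  rw [e0]
  refine h1.congr' ?_
  filter_upwards [self_mem_nhdsWithin] with ζ hζ
  have hζ' : ζ ≠ 0 := ne_of_gt hζ
  simp [parisiOp, hζ', cgf, mgf, hX]

/-- The dependence of the operator on `ζ`. -/
theorem parisiOp_le_add (hφ : LipschitzWith L φ) {ζ ζ' : ℝ} (h0 : 0 ≤ ζ) (h : ζ < ζ') (a : ℝ)
    (y : EuclideanSpace ℝ (Fin N)) :
    parisiOp ζ' a φ y ≤ parisiOp ζ a φ y + (ζ' - ζ) * (a ^ 2 * L ^ 2 / 2) := by
  rcases h0.eq_or_lt with rfl | h0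
  · have h1 : Tendsto (fun ζ => parisiOp ζ a φ y + (ζ' - ζ) * (a ^ 2 * L ^ 2 / 2)) (𝓝[>] 0)
        (𝓝 (parisiOp 0 a φ y + (ζ' - 0) * (a ^ 2 * L ^ 2 / 2))) := by
      refine (tendsto_parisiOp_zero hφ a y).add ?_
      exact ((by fun_prop : Continuous fun ζ : ℝ => (ζ' - ζ) * (a ^ 2 * L ^ 2 / 2)).tendsto 0).mono_left
        nhdsWithin_le_nhds
    refine ge_of_tendsto h1 ?_
    filter_upwards [Ioo_mem_nhdsGT h] with ζ hζ
    exact parisiOp_le_add_of_pos hφ hζ.1 hζ.2 a y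
  · exact parisiOp_le_add_of_pos hφ h0 h a y

theorem abs_parisiOp_sub_parisiOp_le (hφ : LipschitzWith L φ) {ζ ζ' : ℝ} (h0 : 0 ≤ ζ) (h0' : 0 ≤ ζ')
    (a : ℝ) (y : EuclideanSpace ℝ (Fin N)) :
    |parisiOp ζ a φ y - parisiOp ζ' a φ y| ≤ |ζ - ζ'| * (a ^ 2 * L ^ 2 / 2) := by
  rcases lt_trichotomy ζ ζ' with h | rfl | h
  · have h1 := parisiOp_mono hφ h0 h a y
    have h2 := parisiOp_le_add hφ h0 h a y
    rw [abs_of_nonpos (by linarith), abs_of_nonpos (by linarith)]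
    linarith
  · simp
  · have h1 := parisiOp_mono hφ h0' h a y
    have h2 := parisiOp_le_add hφ h0' h a y
    rw [abs_of_nonneg (by linarith), abs_of_nonneg (by linarith)]
    linarith

end ParisiOperator

/-! ### Sums along the cascade and their law. -/

section Cascade

variable {N : ℕ}

/-- The sum over the leaves of the tree of the products of the Poisson points along the branches,
weighted by a function of the Gaussian field. The list contains the parameters `(ζ, a)` of the
successive levels. -/
def cascadeSum (Φ : EuclideanSpace ℝ (Fin N) → ℝ≥0∞) :
    List (ℝ × ℝ) → EuclideanSpace ℝ (Fin N) → Forest N → ℝ≥0∞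
  | [], y, _ => Φ y
  | p :: l, y, f => ∑' n, point p.1 f.1 n *
      cascadeSum Φ l (y + p.2 • rootVec (f.2 n)) (forest (f.2 n))

theorem measurable_cascadeSum {Φ : EuclideanSpace ℝ (Fin N) → ℝ≥0∞} (hΦ : Measurable Φ)
    (l : List (ℝ × ℝ)) :
    Measurable fun x : EuclideanSpace ℝ (Fin N) × Forest N => cascadeSum Φ l x.1 x.2 := by
  induction l with
  | nil => exact hΦ.comp measurable_fst
  | cons p l ih =>
    simp only [cascadeSum]
    refine Measurable.tsum fun n => Measurable.mul (by fun_prop) ?_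
    exact ih.comp (f := fun x : EuclideanSpace ℝ (Fin N) × Forest N =>
      (x.1 + p.2 • rootVec (x.2.2 n), forest (x.2.2 n))) (by fun_prop)

/-- The total mass of the unnormalized weights of the leaves. -/
def cascadeMass (l : List (ℝ × ℝ)) (f : Forest N) : ℝ≥0∞ := cascadeSum (fun _ => 1) l 0 f

@[fun_prop]
theorem measurable_cascadeMass (l : List (ℝ × ℝ)) :
    Measurable (cascadeMass l : Forest N → ℝ≥0∞) :=
  (measurable_cascadeSum measurable_const l).comp (f := fun f => (0, f)) (by fun_prop)

theorem cascadeSum_one (l : List (ℝ × ℝ)) :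
    ∀ (y : EuclideanSpace ℝ (Fin N)) (f : Forest N), cascadeSum (fun _ => 1) l y f = cascadeMass l f := by
  induction l with
  | nil => intro y f; rfl
  | cons p l ih =>
    intro y f
    change ∑' n, _ * cascadeSum _ l _ _ = ∑' n, _ * cascadeSum _ l _ _
    simp only [ih]

theorem cascadeMass_cons (p : ℝ × ℝ) (l : List (ℝ × ℝ)) :
    (cascadeMass (p :: l) : Forest N → ℝ≥0∞) = poissonSum p.1 fun ω => cascadeMass l (forest ω) := by
  ext f
  change ∑' n, _ * cascadeSum _ l _ _ = _
  simp only [cascadeSum_one, poissonSum]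

/-- The parameters `ζ` are increasing in `(0, 1)`. -/
def Admissible (l : List (ℝ × ℝ)) : Prop :=
  (∀ p ∈ l, 0 < p.1 ∧ p.1 < 1) ∧ l.Pairwise fun p p' => p.1 < p'.1

theorem Admissible.head {p : ℝ × ℝ} {l : List (ℝ × ℝ)} (h : Admissible (p :: l)) :
    0 < p.1 ∧ p.1 < 1 := h.1 p (by simp)

theorem Admissible.tail {p : ℝ × ℝ} {l : List (ℝ × ℝ)} (h : Admissible (p :: l)) :
    Admissible l := ⟨fun q hq => h.1 q (by simp [hq]), (List.pairwise_cons.1 h.2).2⟩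

theorem measurePreserving_forest : MeasurePreserving (forest (N := N)) (treeLaw N) (forestLaw N) :=
  measurePreserving_snd.comp (measurePreserving_branching N)

/-- The masses of the subtrees are independent marks on the points at the root, so they may be
replaced by a constant. -/
theorem map_cascadeMass_cons {p : ℝ × ℝ} {l : List (ℝ × ℝ)} (hp : 0 < p.1 ∧ p.1 < 1)
    (h0 : ∫⁻ f, cascadeMass l f ^ p.1 ∂(forestLaw N) ≠ 0)
    (h1 : ∫⁻ f, cascadeMass l f ^ p.1 ∂(forestLaw N) ≠ ∞) :
    ∃ c : ℝ≥0∞, c ≠ 0 ∧ c ≠ ∞ ∧ (forestLaw N).map (cascadeMass (p :: l)) =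
      expSeq.map fun e => c * stableSum p.1 e := by
  set m := ∫⁻ f, cascadeMass l f ^ p.1 ∂(forestLaw N)
  have hc : m ^ (1 / p.1) ≠ ∞ := ENNReal.rpow_ne_top_of_nonneg (by have := hp.1; positivity) h1
  refine ⟨m ^ (1 / p.1), ?_, hc, ?_⟩
  · simp [ENNReal.rpow_eq_zero_iff, h0, h1]
  · rw [cascadeMass_cons]
    refine map_poissonSum_eq_stableSum (treeLaw N) hp.1 hp.2 (by fun_prop) hc ?_
    rw [← ENNReal.rpow_mul, one_div_mul_cancel hp.1.ne', ENNReal.rpow_one]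
    exact measurePreserving_forest.lintegral_comp (f := fun f => cascadeMass l f ^ p.1) (by fun_prop)

/-- The mass is in law a multiple of a stable sum, which has moments below its own parameter only.
Since the parameters increase with depth, the moment needed at each level is available one level
higher. -/
theorem lintegral_cascadeMass_rpow {l : List (ℝ × ℝ)} (hl : Admissible l) :
    ∀ {r : ℝ}, 0 < r → (∀ p ∈ l, r < p.1) →
    ∫⁻ f, cascadeMass l f ^ r ∂(forestLaw N) ≠ 0 ∧ ∫⁻ f, cascadeMass l f ^ r ∂(forestLaw N) ≠ ∞ := by
  induction l with
  | nil =>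
    intro r _ _
    simp [cascadeMass, cascadeSum]
  | cons p l ih =>
    intro r hr hrp
    obtain ⟨h0, h1⟩ := ih hl.tail hl.head.1 (List.pairwise_cons.1 hl.2).1
    obtain ⟨c, hc0, hct, hc⟩ := map_cascadeMass_cons hl.head h0 h1
    have hrp' : r < p.1 := hrp p (by simp)
    have e : ∫⁻ f, cascadeMass (p :: l) f ^ r ∂(forestLaw N) =
        c ^ r * ∫⁻ e, stableSum p.1 e ^ r ∂expSeq := by
      rw [← lintegral_map (f := fun x : ℝ≥0∞ => x ^ r) (by fun_prop) (by fun_prop), hc,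
        lintegral_map (by fun_prop) (by fun_prop), ← lintegral_const_mul _ (by fun_prop)]
      simp_rw [ENNReal.mul_rpow_of_nonneg _ _ hr.le]
    rw [e]
    refine ⟨mul_ne_zero (by simp [ENNReal.rpow_eq_zero_iff, hc0, hct]) fun h => ?_,
      ENNReal.mul_ne_top (ENNReal.rpow_ne_top_of_nonneg hr.le hct)
        (lintegral_stableSum_rpow_lt_top hr hrp' hl.head.2).ne⟩
    rw [lintegral_eq_zero_iff (by fun_prop)] at h
    have : ∀ᵐ e ∂expSeq, False := by
      filter_upwards [h, ae_stableSum_pos_lt_top hl.head.1 hl.head.2] with e he he'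
      simp [ENNReal.rpow_eq_zero_iff, he'.1.ne', hr] at he
      exact absurd he.2 (by linarith)
    simp at this
    exact IsProbabilityMeasure.ne_zero expSeq this

theorem ae_cascadeMass_pos_lt_top {l : List (ℝ × ℝ)} (hl : Admissible l) :
    ∀ᵐ f ∂(forestLaw N), 0 < cascadeMass l f ∧ cascadeMass l f < ∞ := by
  cases l with
  | nil => simp [cascadeMass, cascadeSum]
  | cons p l =>
    obtain ⟨h0, h1⟩ := lintegral_cascadeMass_rpow (N := N) hl.tail hl.head.1
      (List.pairwise_cons.1 hl.2).1
    obtain ⟨c, hc0, hct, hc⟩ := map_cascadeMass_cons hl.head h0 h1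
    have hm : MeasurableSet {x : ℝ≥0∞ | 0 < x ∧ x < ∞} := measurableSet_Ioo
    have := (ae_map_iff (μ := expSeq) (f := fun e => c * stableSum p.1 e)
      (by fun_prop) hm).2 (by
        filter_upwards [ae_stableSum_pos_lt_top hl.head.1 hl.head.2] with e he
        exact ⟨ENNReal.mul_pos hc0 he.1.ne', ENNReal.mul_lt_top hct.lt_top he.2⟩)
    rw [← hc] at this
    exact (ae_map_iff (by fun_prop) hm).1 this

theorem integrable_log_cascadeMass {l : List (ℝ × ℝ)} (hl : Admissible l) :
    Integrable (fun f => Real.log (cascadeMass l f).toReal) (forestLaw N) := by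
  cases l with
  | nil => simp [cascadeMass, cascadeSum]
  | cons p l =>
    obtain ⟨h0, h1⟩ := lintegral_cascadeMass_rpow (N := N) hl.tail hl.head.1
      (List.pairwise_cons.1 hl.2).1
    obtain ⟨c, hc0, hct, hc⟩ := map_cascadeMass_cons hl.head h0 h1
    have hm : Measurable fun x : ℝ≥0∞ => Real.log x.toReal := by fun_prop
    have h2 : Integrable (fun x : ℝ≥0∞ => Real.log x.toReal)
        (expSeq.map fun e => c * stableSum p.1 e) := by
      rw [integrable_map_measure hm.aestronglyMeasurable (by fun_prop)]
      refine ((integrable_const (Real.log c.toReal)).add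
        (integrable_log_stableSum hl.head.1 hl.head.2)).congr ?_
      filter_upwards [ae_stableSum_pos_lt_top hl.head.1 hl.head.2] with e he
      simp only [Function.comp_apply, Pi.add_apply, ENNReal.toReal_mul]
      rw [Real.log_mul (ENNReal.toReal_pos hc0 hct).ne' (ENNReal.toReal_pos he.1.ne' he.2.ne).ne']
    rw [← hc, integrable_map_measure hm.aestronglyMeasurable (by fun_prop)] at h2
    exact h2

/-- The composition of the Parisi operators along a list of parameters. -/
def recOp : List (ℝ × ℝ) → (EuclideanSpace ℝ (Fin N) → ℝ) → EuclideanSpace ℝ (Fin N) → ℝ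
  | [], φ => φ
  | p :: l, φ => parisiOp p.1 p.2 (recOp l φ)

variable {L : ℝ≥0} {φ : EuclideanSpace ℝ (Fin N) → ℝ}

theorem lipschitzWith_recOp (hφ : LipschitzWith L φ) {l : List (ℝ × ℝ)} (hl : ∀ p ∈ l, 0 ≤ p.1) :
    LipschitzWith L (recOp l φ) := by
  induction l with
  | nil => exact hφ
  | cons p l ih =>
    exact lipschitzWith_parisiOp (ih fun q hq => hl q (by simp [hq])) (hl p (by simp)) _

theorem Admissible.nonneg {l : List (ℝ × ℝ)} (hl : Admissible l) : ∀ p ∈ l, 0 ≤ p.1 :=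
  fun p hp => (hl.1 p hp).1.le

/-- The invariance of the cascade. By induction, the sum over a subtree has a moment of order ζ
equal to that of its mass times E exp(ζ ψ(y + a z)), that is, times the exponential of ζ times the
operator. Marks with equal moments give Poisson sums with equal laws. -/
theorem map_cascadeSum (hφ : LipschitzWith L φ) {l : List (ℝ × ℝ)} (hl : Admissible l) :
    ∀ y : EuclideanSpace ℝ (Fin N),
    (forestLaw N).map (cascadeSum (fun x => ENNReal.ofReal (Real.exp (φ x))) l y) =
      (forestLaw N).map fun f => ENNReal.ofReal (Real.exp (recOp l φ y)) * cascadeMass l f := by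
  have hc := hφ.continuous
  induction l with
  | nil =>
    intro y
    simp [cascadeSum, cascadeMass, recOp]
  | cons p l ih =>
    intro y
    obtain ⟨h0, h1⟩ := lintegral_cascadeMass_rpow (N := N) hl.tail hl.head.1
      (List.pairwise_cons.1 hl.2).1
    have hp := hl.head.1
    have hψ := lipschitzWith_recOp hφ hl.tail.nonneg
    have hψc := hψ.continuous
    set ψ := recOp l φ
    set Φ : EuclideanSpace ℝ (Fin N) → ℝ≥0∞ := fun x => ENNReal.ofReal (Real.exp (φ x)) with hΦ
    have hΦm : Measurable Φ := by fun_prop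
    have hS := measurable_cascadeSum hΦm l
    set m := ∫⁻ f, cascadeMass l f ^ p.1 ∂(forestLaw N) with hm
    set c := ENNReal.ofReal (Real.exp (recOp (p :: l) φ y)) with hcdef
    set Y : TreeSample N → ℝ≥0∞ := fun ω => cascadeSum Φ l (y + p.2 • rootVec ω) (forest ω) with hY
    have hYm : Measurable Y := hS.comp (f := fun ω => (y + p.2 • rootVec ω, forest ω)) (by fun_prop)
    -- The Gaussian vector of the child is independent of the rest of its subtree, so the induction
    -- hypothesis applies with this vector fixed.
    have e1 : ∫⁻ ω, Y ω ^ p.1 ∂(treeLaw N) =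
        ENNReal.ofReal (Real.exp (p.1 * recOp (p :: l) φ y)) * m := by
      have hF : Measurable (fun x : EuclideanSpace ℝ (Fin N) × Forest N =>
          cascadeSum Φ l (y + p.2 • x.1) x.2 ^ p.1) :=
        (hS.comp (f := fun x : EuclideanSpace ℝ (Fin N) × Forest N => (y + p.2 • x.1, x.2))
          (by fun_prop)).pow_const _
      refine ((measurePreserving_branching N).lintegral_comp hF).trans ?_
      rw [lintegral_prod _ hF.aemeasurable]
      have e2 : ∀ z : EuclideanSpace ℝ (Fin N),
          ∫⁻ f, cascadeSum Φ l (y + p.2 • z) f ^ p.1 ∂(forestLaw N) =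
          ENNReal.ofReal (Real.exp (p.1 * ψ (y + p.2 • z))) * m := fun z => by
        rw [← lintegral_map (f := fun x : ℝ≥0∞ => x ^ p.1) (by fun_prop)
          (g := cascadeSum Φ l (y + p.2 • z)) (hS.comp measurable_prodMk_left), ih hl.tail, lintegral_map (by fun_prop) (by fun_prop)]
        simp_rw [ENNReal.mul_rpow_of_nonneg _ _ hp.le]
        rw [lintegral_const_mul _ (by fun_prop), ENNReal.ofReal_rpow_of_pos (Real.exp_pos _),
          ← Real.exp_mul, mul_comm p.1]
      simp_rw [e2]
      rw [lintegral_mul_const _ (by fun_prop), recOp, exp_mul_parisiOp hψ hp.ne',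
        ofReal_integral_eq_lintegral_ofReal (integrable_exp_comp_add_smul hψ p.1 p.2 y)
          (ae_of_all _ fun _ => (Real.exp_pos _).le)]
    have e3 : ∫⁻ ω, (c * cascadeMass l (forest ω)) ^ p.1 ∂(treeLaw N) =
        ENNReal.ofReal (Real.exp (p.1 * recOp (p :: l) φ y)) * m := by
      simp_rw [ENNReal.mul_rpow_of_nonneg _ _ hp.le]
      rw [lintegral_const_mul _ (by fun_prop), hcdef, ENNReal.ofReal_rpow_of_pos (Real.exp_pos _),
          ← Real.exp_mul, mul_comm p.1, hm]
      congr 1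
      exact measurePreserving_forest.lintegral_comp (f := fun f => cascadeMass l f ^ p.1)
        (by fun_prop)
    have key := map_poissonSum_eq (treeLaw N) (treeLaw N) hp hl.head.2 hYm
      (Y' := fun ω => c * cascadeMass l (forest ω)) (by fun_prop)
      (by rw [e1]; exact ENNReal.mul_ne_top (by simp) h1) (e1.trans e3.symm)
    have e4 : poissonSum p.1 (fun ω : TreeSample N => c * cascadeMass l (forest ω)) =
        fun f => c * cascadeMass (p :: l) f := by
      ext f
      rw [cascadeMass_cons]
      simp only [poissonSum]
      rw [← ENNReal.tsum_mul_left]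
      congr 1 with n
      ring
    rw [e4] at key
    exact key

theorem measurable_cascadeSum_exp (hφ : LipschitzWith L φ) (l : List (ℝ × ℝ)) :
    Measurable fun x : EuclideanSpace ℝ (Fin N) × Forest N =>
      cascadeSum (fun x => ENNReal.ofReal (Real.exp (φ x))) l x.1 x.2 := by
  have := hφ.continuous
  exact measurable_cascadeSum (by fun_prop) l

theorem ae_cascadeSum_pos_lt_top (hφ : LipschitzWith L φ) {l : List (ℝ × ℝ)} (hl : Admissible l)
    (y : EuclideanSpace ℝ (Fin N)) :
    ∀ᵐ f ∂(forestLaw N), 0 < cascadeSum (fun x => ENNReal.ofReal (Real.exp (φ x))) l y f ∧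
      cascadeSum (fun x => ENNReal.ofReal (Real.exp (φ x))) l y f < ∞ := by
  have hm : MeasurableSet {x : ℝ≥0∞ | 0 < x ∧ x < ∞} := measurableSet_Ioo
  have hS : Measurable (cascadeSum (fun x => ENNReal.ofReal (Real.exp (φ x))) l y) :=
    (measurable_cascadeSum_exp hφ l).comp measurable_prodMk_left
  refine (ae_map_iff hS.aemeasurable hm).1 ?_
  rw [map_cascadeSum hφ hl]
  refine (ae_map_iff (by fun_prop) hm).2 ?_
  filter_upwards [ae_cascadeMass_pos_lt_top hl] with f hf
  exact ⟨ENNReal.mul_pos (by simpa using Real.exp_pos _) hf.1.ne', ENNReal.mul_lt_top (by simp) hf.2⟩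

theorem log_mul_cascadeMass_ae_eq {l : List (ℝ × ℝ)} (hl : Admissible l) (c : ℝ) :
    (fun f => Real.log (ENNReal.ofReal (Real.exp c) * cascadeMass l f).toReal) =ᵐ[forestLaw N]
      fun f => c + Real.log (cascadeMass l f).toReal := by
  filter_upwards [ae_cascadeMass_pos_lt_top hl] with f hf
  rw [ENNReal.toReal_mul, ENNReal.toReal_ofReal (Real.exp_pos _).le,
    Real.log_mul (Real.exp_pos _).ne' (ENNReal.toReal_pos hf.1.ne' hf.2.ne).ne', Real.log_exp]

theorem integral_log_cascadeSum (hφ : LipschitzWith L φ) {l : List (ℝ × ℝ)} (hl : Admissible l)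
    (y : EuclideanSpace ℝ (Fin N)) :
    Integrable (fun f => Real.log
      (cascadeSum (fun x => ENNReal.ofReal (Real.exp (φ x))) l y f).toReal) (forestLaw N) ∧
    ∫ f, Real.log (cascadeSum (fun x => ENNReal.ofReal (Real.exp (φ x))) l y f).toReal
        ∂(forestLaw N) =
      recOp l φ y + ∫ f, Real.log (cascadeMass l f).toReal ∂(forestLaw N) := by
  have hm : Measurable fun x : ℝ≥0∞ => Real.log x.toReal := by fun_prop
  have hS : Measurable (cascadeSum (fun x => ENNReal.ofReal (Real.exp (φ x))) l y) :=
    (measurable_cascadeSum_exp hφ l).comp measurable_prodMk_left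
  have hi := integrable_log_cascadeMass (N := N) hl
  constructor
  · have h := (integrable_map_measure (μ := forestLaw N)
      (f := fun f => ENNReal.ofReal (Real.exp (recOp l φ y)) * cascadeMass l f)
      hm.aestronglyMeasurable (by fun_prop)).2
      (((integrable_const (recOp l φ y)).add hi).congr (log_mul_cascadeMass_ae_eq hl _).symm)
    rw [← map_cascadeSum hφ hl, integrable_map_measure hm.aestronglyMeasurable hS.aemeasurable] at h
    exact h
  · rw [← integral_map (f := fun x : ℝ≥0∞ => Real.log x.toReal) hS.aemeasurable
      hm.aestronglyMeasurable, map_cascadeSum hφ hl, integral_map (by fun_prop)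
      hm.aestronglyMeasurable, integral_congr_ae (log_mul_cascadeMass_ae_eq hl _),
      integral_add (integrable_const _) hi]
    simp

/-- Only the term in `recOp` depends on y and φ. This explicit bound serves later to integrate over
the root vector and the couplings. -/
theorem integral_norm_log_cascadeSum_le (hφ : LipschitzWith L φ) {l : List (ℝ × ℝ)}
    (hl : Admissible l) (y : EuclideanSpace ℝ (Fin N)) :
    ∫ f, ‖Real.log (cascadeSum (fun x => ENNReal.ofReal (Real.exp (φ x))) l y f).toReal‖
        ∂(forestLaw N) ≤
      |recOp l φ y| + ∫ f, ‖Real.log (cascadeMass l f).toReal‖ ∂(forestLaw N) := by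
  have hm : Measurable fun x : ℝ≥0∞ => ‖Real.log x.toReal‖ := by fun_prop
  have hS : Measurable (cascadeSum (fun x => ENNReal.ofReal (Real.exp (φ x))) l y) :=
    (measurable_cascadeSum_exp hφ l).comp measurable_prodMk_left
  have hi := integrable_log_cascadeMass (N := N) hl
  rw [← integral_map (f := fun x : ℝ≥0∞ => ‖Real.log x.toReal‖) hS.aemeasurable
    hm.aestronglyMeasurable, map_cascadeSum hφ hl, integral_map (by fun_prop)
    hm.aestronglyMeasurable]
  have h1 := (log_mul_cascadeMass_ae_eq (N := N) hl (recOp l φ y)).fun_comp norm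
  refine (integral_congr_ae h1).trans_le ?_
  have h2 := integral_mono (μ := forestLaw N) ((integrable_const (recOp l φ y)).add hi).norm
    ((integrable_const |recOp l φ y|).add hi.norm) (fun f => norm_add_le _ _)
  simp only [Pi.add_apply] at h2
  rw [integral_add (integrable_const _) hi.norm] at h2
  simpa using h2

end Cascade

/-! ### From sums over leaves to sums by levels. -/

section Enumeration

variable {N : ℕ}

/-- The Gaussian vector at a vertex. -/
def vertexVec (T : TreeSample N) (v : List ℕ) : EuclideanSpace ℝ (Fin N) :=
  WithLp.toLp 2 fun i => T.1 (v, i)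

theorem ancestor_cons_succ {k : ℕ} (n : ℕ) (α : Fin k → ℕ) (ℓ : ℕ) :
    ancestor (Fin.cons n α : Fin (k + 1) → ℕ) (ℓ + 1) = n :: ancestor α ℓ := by
  simp [ancestor]

theorem ancestor_zero {k : ℕ} (α : Fin k → ℕ) : ancestor α 0 = [] := by simp [ancestor]

theorem poissonPoint_nonneg {J : CouplingIndex N → ℝ} {T : TreeSample N}
    (hT : ∀ p, 0 < T.2 p) (ζ : ℝ) (v : List ℕ) (n : ℕ) : 0 ≤ poissonPoint (J, T) ζ v n :=
  Real.rpow_nonneg (Finset.sum_nonneg fun _ _ => (hT _).le) _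

theorem leafWeight_cons {J : CouplingIndex N → ℝ} {T : TreeSample N} {k : ℕ} (ζ : ℕ → ℝ) (n : ℕ)
    (α : Fin k → ℕ) :
    leafWeight ζ (J, T) (Fin.cons n α : Fin (k + 1) → ℕ) =
      poissonPoint (J, T) (ζ 1) [] n * leafWeight (fun i => ζ (i + 1)) (J, subtree n T) α := by
  rw [leafWeight, Fin.prod_univ_succ]
  congr 1
  refine Finset.prod_congr rfl fun ℓ _ => ?_
  simp only [Fin.val_succ, ancestor_cons_succ, Fin.cons_succ]
  rfl

/-- Leaves are grouped by their first entry n; the rest of the leaf is a leaf of the `n`-th subtree.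
The root vector is not in the sum, it belongs to the starting point y. Positive exponential
variables make the Poisson points nonnegative, as splitting `ENNReal.ofReal` of a product requires.
-/
theorem tsum_leaves_eq_cascadeSum (Φ : EuclideanSpace ℝ (Fin N) → ℝ≥0∞)
    (J : CouplingIndex N → ℝ) (k : ℕ) :
    ∀ (ζ a : ℕ → ℝ) (y : EuclideanSpace ℝ (Fin N)) {T : TreeSample N}, (∀ p, 0 < T.2 p) →
    ∑' α : Fin k → ℕ, Φ (y + ∑ ℓ ∈ Finset.range k, a (ℓ + 1) • vertexVec T (ancestor α (ℓ + 1))) *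
      ENNReal.ofReal (leafWeight ζ (J, T) α) =
    cascadeSum Φ (List.ofFn fun ℓ : Fin k => (ζ (ℓ + 1), a (ℓ + 1))) y (forest T) := by
  induction k with
  | zero =>
    intro ζ a y T hT
    rw [tsum_eq_single default (fun b hb => absurd (Subsingleton.elim b default) hb)]
    simp [cascadeSum, leafWeight]
  | succ k ih =>
    intro ζ a y T hT
    rw [← (Fin.consEquiv fun _ : Fin (k + 1) => ℕ).tsum_eq, ENNReal.tsum_prod', List.ofFn_succ,
      cascadeSum]
    congr 1 with n
    have hT' : ∀ p, 0 < (subtree n T).2 p := fun p => hT _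
    have h := ih (fun i => ζ (i + 1)) (fun i => a (i + 1)) (y + a 1 • rootVec (subtree n T)) hT'
    simp only [Fin.val_succ, Fin.val_zero, zero_add]
    change _ = point (ζ 1) (fun j => T.2 ([], j)) n * cascadeSum Φ _ (y + a 1 • rootVec (subtree n T))
      (forest (subtree n T))
    rw [← h, ← ENNReal.tsum_mul_left]
    congr 1 with α
    change Φ (y + ∑ ℓ ∈ Finset.range (k + 1), a (ℓ + 1) •
      vertexVec T (ancestor (Fin.cons n α : Fin (k + 1) → ℕ) (ℓ + 1))) *
      ENNReal.ofReal (leafWeight ζ (J, T) (Fin.cons n α : Fin (k + 1) → ℕ)) = _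
    rw [leafWeight_cons, ENNReal.ofReal_mul (poissonPoint_nonneg hT _ _ _), Finset.sum_range_succ']
    simp only [ancestor_cons_succ, ancestor_zero, zero_add]
    have e1 : point (ζ 1) (fun j => T.2 ([], j)) n =
        ENNReal.ofReal (poissonPoint (J, T) (ζ 1) [] n) := rfl
    have e2 : y + (∑ ℓ ∈ Finset.range k, a (ℓ + 1 + 1) • vertexVec T (n :: ancestor α (ℓ + 1)) +
        a 1 • vertexVec T [n]) = y + a 1 • rootVec (subtree n T) +
        ∑ ℓ ∈ Finset.range k, a (ℓ + 1 + 1) • vertexVec (subtree n T) (ancestor α (ℓ + 1)) := by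
      rw [add_assoc, add_comm (∑ ℓ ∈ Finset.range k, _)]
      rfl
    rw [e1, e2]
    ring

end Enumeration

/-! ### The mean logarithm of the normalized cascade sum. -/

section LogRatio

variable {N : ℕ} {L : ℝ≥0} {φ : EuclideanSpace ℝ (Fin N) → ℝ}

/-- The mean norm of a standard Gaussian vector. -/
def gaussNorm (N : ℕ) : ℝ := ∫ z, ‖z‖ ∂(gauss N)

theorem abs_integral_comp_smul_sub_le (hφ : LipschitzWith L φ) (a : ℝ) :
    |parisiOp 0 a φ 0 - φ 0| ≤ L * |a| * gaussNorm N := by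
  simp only [parisiOp, if_true]
  have hi := integrable_comp_add_smul hφ a 0
  have e : ∫ z, φ (0 + a • z) ∂(gauss N) - φ 0 = ∫ z, (φ (0 + a • z) - φ 0) ∂(gauss N) := by
    rw [integral_sub hi (integrable_const _)]; simp
  rw [e, gaussNorm, ← integral_const_mul, ← Real.norm_eq_abs]
  refine norm_integral_le_of_norm_le (integrable_norm_gauss.const_mul _) (ae_of_all _ fun z => ?_)
  have := hφ.dist_le_mul (0 + a • z) 0
  rw [Real.dist_eq, dist_eq_norm, sub_zero, ← Real.norm_eq_abs] at this
  simpa only [zero_add, norm_smul, Real.norm_eq_abs, mul_assoc] using this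

/-- The constant is the same for all L-Lipschitz φ, hence for all realizations of the couplings.
Each operator is compared with the one at ζ = 0, a plain Gaussian average. -/
theorem exists_abs_recOp_zero_le (L : ℝ≥0) {l : List (ℝ × ℝ)} (hl : ∀ p ∈ l, 0 ≤ p.1) :
    ∃ C : ℝ, ∀ φ : EuclideanSpace ℝ (Fin N) → ℝ, LipschitzWith L φ →
      |recOp l φ 0| ≤ |φ 0| + C := by
  induction l with
  | nil => exact ⟨0, fun φ _ => by simp [recOp]⟩
  | cons p l ih =>
    obtain ⟨C, hC⟩ := ih fun q hq => hl q (by simp [hq])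
    refine ⟨C + (L * |p.2| * gaussNorm N + |p.1 - 0| * (p.2 ^ 2 * L ^ 2 / 2)), fun φ hφ => ?_⟩
    have hψ := lipschitzWith_recOp hφ fun q hq => hl q (List.mem_cons_of_mem p hq)
    have h1 := abs_integral_comp_smul_sub_le hψ p.2
    have h2 := abs_parisiOp_sub_parisiOp_le hψ (hl p (by simp)) le_rfl p.2 0
    have h3 := hC φ hφ
    simp only [recOp]
    rw [abs_le] at *
    constructor <;> linarith [h1.1, h1.2, h2.1, h2.2, h3.1, h3.2]

theorem ae_cascadeSum_root_pos_lt_top (hφ : LipschitzWith L φ) {l : List (ℝ × ℝ)}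
    (hl : Admissible l) (a : ℝ) :
    ∀ᵐ T ∂(treeLaw N),
      (0 < cascadeSum (fun x => ENNReal.ofReal (Real.exp (φ x))) l (a • rootVec T) (forest T) ∧
      cascadeSum (fun x => ENNReal.ofReal (Real.exp (φ x))) l (a • rootVec T) (forest T) < ∞) ∧
      (0 < cascadeMass l (forest T) ∧ cascadeMass l (forest T) < ∞) := by
  refine Eventually.and ?_ ?_
  · have hS : Measurable fun x : EuclideanSpace ℝ (Fin N) × Forest N =>
        cascadeSum (fun x => ENNReal.ofReal (Real.exp (φ x))) l (a • x.1) x.2 :=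
      (measurable_cascadeSum_exp hφ l).comp
        (f := fun x : EuclideanSpace ℝ (Fin N) × Forest N => (a • x.1, x.2)) (by fun_prop)
    have h : ∀ᵐ x ∂((gauss N).prod (forestLaw N)),
        cascadeSum (fun x => ENNReal.ofReal (Real.exp (φ x))) l (a • x.1) x.2 ∈ Ioo 0 ∞ := by
      rw [Measure.ae_prod_iff_ae_ae (hS measurableSet_Ioo)]
      refine ae_of_all _ fun z => ?_
      filter_upwards [ae_cascadeSum_pos_lt_top hφ hl (a • z)] with f hf
      exact ⟨hf.1, hf.2⟩
    exact (measurePreserving_branching N).quasiMeasurePreserving.ae h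
  · exact measurePreserving_forest.quasiMeasurePreserving.ae (ae_cascadeMass_pos_lt_top hl)

/-- The logarithm of the normalized sum over the leaves. -/
def logRatio (φ : EuclideanSpace ℝ (Fin N) → ℝ) (l : List (ℝ × ℝ)) (a : ℝ) (T : TreeSample N) : ℝ :=
  Real.log (cascadeSum (fun x => ENNReal.ofReal (Real.exp (φ x))) l (a • rootVec T) (forest T) /
    cascadeMass l (forest T)).toReal

theorem integrable_prod_of_integral_norm_le {α β : Type*} [MeasurableSpace α] [MeasurableSpace β]
    {μ : Measure α} {ν : Measure β} [SFinite μ] [SFinite ν] {G : α × β → ℝ} (hG : Measurable G)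
    (hi : ∀ x, Integrable (fun y => G (x, y)) ν) {b : α → ℝ} (hb : Integrable b μ)
    (hle : ∀ x, ∫ y, ‖G (x, y)‖ ∂ν ≤ b x) :
    Integrable G (μ.prod ν) ∧ ∫ x, ‖G x‖ ∂(μ.prod ν) ≤ ∫ x, b x ∂μ := by
  have h : Integrable G (μ.prod ν) := by
    rw [integrable_prod_iff hG.aestronglyMeasurable]
    refine ⟨ae_of_all _ hi, hb.mono' hG.norm.aestronglyMeasurable.integral_prod_right'
      (ae_of_all _ fun x => ?_)⟩
    rw [Real.norm_of_nonneg (integral_nonneg fun _ => norm_nonneg _)]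
    exact hle x
  refine ⟨h, ?_⟩
  rw [integral_prod _ h.norm]
  exact integral_mono h.norm.integral_prod_left hb hle

theorem integrable_log_cascadeSum_prod (hφ : LipschitzWith L φ) {l : List (ℝ × ℝ)}
    (hl : Admissible l) (a : ℝ) :
    Integrable (fun x : EuclideanSpace ℝ (Fin N) × Forest N => Real.log
      (cascadeSum (fun x => ENNReal.ofReal (Real.exp (φ x))) l (a • x.1) x.2).toReal)
      ((gauss N).prod (forestLaw N)) ∧
    ∫ x, ‖Real.log (cascadeSum (fun x => ENNReal.ofReal (Real.exp (φ x))) l (a • x.1) x.2).toReal‖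
      ∂((gauss N).prod (forestLaw N)) ≤ |recOp l φ 0| + L * |a| * gaussNorm N +
        ∫ f, ‖Real.log (cascadeMass l f).toReal‖ ∂(forestLaw N) := by
  have hS : Measurable fun x : EuclideanSpace ℝ (Fin N) × Forest N => Real.log
      (cascadeSum (fun x => ENNReal.ofReal (Real.exp (φ x))) l (a • x.1) x.2).toReal :=
    ((measurable_cascadeSum_exp hφ l).comp
      (f := fun x : EuclideanSpace ℝ (Fin N) × Forest N => (a • x.1, x.2))
      (by fun_prop)).ennreal_toReal.log
  have hi := fun z : EuclideanSpace ℝ (Fin N) => (integral_log_cascadeSum hφ hl (a • z)).1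
  have hb : ∀ z : EuclideanSpace ℝ (Fin N), ∫ f, ‖Real.log
      (cascadeSum (fun x => ENNReal.ofReal (Real.exp (φ x))) l (a • z) f).toReal‖ ∂(forestLaw N) ≤
      |recOp l φ 0| + L * |a| * ‖z‖ +
        ∫ f, ‖Real.log (cascadeMass l f).toReal‖ ∂(forestLaw N) := fun z => by
    have h1 := integral_norm_log_cascadeSum_le hφ hl (a • z)
    have h2 := abs_le_of_lipschitzWith (lipschitzWith_recOp hφ hl.nonneg) a 0 z
    rw [zero_add] at h2
    linarith
  generalize ∫ f, ‖Real.log (cascadeMass l f).toReal‖ ∂(forestLaw N) = M at hb ⊢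
  generalize |recOp l φ 0| = R at hb ⊢
  generalize hG : (fun x : EuclideanSpace ℝ (Fin N) × Forest N => Real.log
      (cascadeSum (fun x => ENNReal.ofReal (Real.exp (φ x))) l (a • x.1) x.2).toReal) = G at hS ⊢
  have hi' : ∀ z, Integrable (fun f => G (z, f)) (forestLaw N) := fun z => by
    rw [← hG]; exact hi z
  have hb' : ∀ z, ∫ f, ‖G (z, f)‖ ∂(forestLaw N) ≤ R + L * |a| * ‖z‖ + M := fun z => by
    rw [← hG]; exact hb z
  have hbi : Integrable (fun z : EuclideanSpace ℝ (Fin N) => R + L * |a| * ‖z‖ + M)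
      (gauss N) :=
    ((integrable_const _).add (integrable_norm_gauss.const_mul _)).add (integrable_const _)
  obtain ⟨h1, h2⟩ := integrable_prod_of_integral_norm_le hS hi' hbi hb'
  refine ⟨h1, ?_⟩
  have e : ∫ z, (R + L * |a| * ‖z‖ + M) ∂(gauss N) = R + L * |a| * gaussNorm N + M := by
    have hz : Integrable (fun z : EuclideanSpace ℝ (Fin N) => L * |a| * ‖z‖) (gauss N) :=
      integrable_norm_gauss.const_mul _
    have hz' : Integrable (fun z : EuclideanSpace ℝ (Fin N) => R + L * |a| * ‖z‖) (gauss N) :=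
      (integrable_const R).add hz
    rw [integral_add hz' (integrable_const M), integral_add (integrable_const R) hz,
      integral_const_mul]
    simp [gaussNorm]
  rw [← e]
  simpa only [← hG] using h2

theorem logRatio_ae_eq (hφ : LipschitzWith L φ) {l : List (ℝ × ℝ)} (hl : Admissible l) (a : ℝ) :
    logRatio φ l a =ᵐ[treeLaw N] fun T =>
      Real.log (cascadeSum (fun x => ENNReal.ofReal (Real.exp (φ x))) l (a • rootVec T)
        (forest T)).toReal - Real.log (cascadeMass l (forest T)).toReal := by
  filter_upwards [ae_cascadeSum_root_pos_lt_top hφ hl a] with T hT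
  rw [logRatio, ENNReal.toReal_div,
    Real.log_div (ENNReal.toReal_pos hT.1.1.ne' hT.1.2.ne).ne'
      (ENNReal.toReal_pos hT.2.1.ne' hT.2.2.ne).ne']

/-- The recursive computation of the mean of the logarithm of the cascade average. -/
theorem integral_logRatio (hφ : LipschitzWith L φ) {l : List (ℝ × ℝ)} (hl : Admissible l) (a : ℝ) :
    Integrable (logRatio φ l a) (treeLaw N) ∧
    ∫ T, logRatio φ l a T ∂(treeLaw N) = parisiOp 0 a (recOp l φ) 0 ∧
    ∫ T, ‖logRatio φ l a T‖ ∂(treeLaw N) ≤ |recOp l φ 0| + L * |a| * gaussNorm N +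
        2 * ∫ f, ‖Real.log (cascadeMass l f).toReal‖ ∂(forestLaw N) := by
  have hae := logRatio_ae_eq hφ hl a
  obtain ⟨h1, h2⟩ := integrable_log_cascadeSum_prod hφ hl a
  have hmp := measurePreserving_branching N
  have i1 : Integrable (fun T : TreeSample N => Real.log (cascadeSum
      (fun x => ENNReal.ofReal (Real.exp (φ x))) l (a • rootVec T) (forest T)).toReal) (treeLaw N) :=
    hmp.integrable_comp_of_integrable h1
  have hM := integrable_log_cascadeMass (N := N) hl
  have i2 : Integrable (fun T : TreeSample N => Real.log (cascadeMass l (forest T)).toReal)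
      (treeLaw N) := measurePreserving_forest.integrable_comp_of_integrable hM
  have e1 : ∀ g : ℝ → ℝ, Continuous g → ∫ T, g (Real.log (cascadeSum
      (fun x => ENNReal.ofReal (Real.exp (φ x))) l (a • rootVec T) (forest T)).toReal) ∂(treeLaw N) =
      ∫ x, g (Real.log (cascadeSum (fun x => ENNReal.ofReal (Real.exp (φ x))) l (a • x.1) x.2).toReal)
      ∂((gauss N).prod (forestLaw N)) := fun g hg => by
    rw [← hmp.map_eq, integral_map (by fun_prop)]
    rw [hmp.map_eq]
    exact hg.comp_aestronglyMeasurable h1.1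
  have e2 : ∀ g : ℝ → ℝ, Continuous g → ∫ T, g (Real.log (cascadeMass l (forest T)).toReal)
      ∂(treeLaw N) = ∫ f, g (Real.log (cascadeMass l f).toReal) ∂(forestLaw N) := fun g hg => by
    rw [← measurePreserving_forest.map_eq, integral_map (by fun_prop)]
    rw [measurePreserving_forest.map_eq]
    exact hg.comp_aestronglyMeasurable hM.1
  refine ⟨(i1.sub i2).congr hae.symm, ?_, ?_⟩
  -- Both terms contain the mean of the logarithm of the total mass, which cancels; averaging over
  -- the root vector is the operator at ζ = 0.
  · rw [integral_congr_ae hae, integral_sub i1 i2]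
    have := e1 id continuous_id
    have h3 := e2 id continuous_id
    simp only [id] at this h3
    rw [this, h3, integral_prod _ h1]
    simp_rw [(integral_log_cascadeSum hφ hl _).2]
    have hr := integrable_comp_add_smul (lipschitzWith_recOp hφ hl.nonneg) a 0
    simp only [zero_add] at hr
    rw [integral_add hr (integrable_const _)]
    simp [parisiOp]
  · refine (integral_congr_ae (hae.fun_comp norm)).trans_le ?_
    have h3 := integral_mono (μ := treeLaw N) (i1.sub i2).norm (i1.norm.add i2.norm)
      (fun T => norm_sub_le _ _)
    refine h3.trans ?_
    simp only [Pi.add_apply]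
    rw [integral_add i1.norm i2.norm, e1 norm continuous_norm, e2 norm continuous_norm]
    linarith

end LogRatio

/-! ### The logarithmic Laplace transform of the reference measure. -/

section LogLaplace

variable {N : ℕ}

theorem integral_exp_inner_gauss (a : ℝ) (σ : EuclideanSpace ℝ (Fin N)) :
    ∫ z, Real.exp (a * inner ℝ z σ) ∂(gauss N) = Real.exp (a ^ 2 / 2 * ‖σ‖ ^ 2) := by
  have h := IsGaussian.map_eq_gaussianReal (μ := gauss N) (innerSL ℝ σ)
  rw [integral_strongDual_stdGaussian, variance_dual_stdGaussian, innerSL_apply_norm] at h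
  have h2 := mgf_gaussianReal h a
  rw [mgf] at h2
  simp only [innerSL_apply_apply] at h2
  simp only [real_inner_comm σ]
  rw [h2, Real.coe_toNNReal _ (by positivity)]
  ring_nf

/-- The logarithm of the Laplace transform of the measure with density `exp (U σ - s ‖σ‖²)` with
respect to `P`. -/
def logLaplace (P : Measure (EuclideanSpace ℝ (Fin N))) (U : EuclideanSpace ℝ (Fin N) → ℝ) (s : ℝ)
    (y : EuclideanSpace ℝ (Fin N)) : ℝ :=
  Real.log (∫ σ, Real.exp (U σ + inner ℝ y σ - s * ‖σ‖ ^ 2) ∂P)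

variable {P : Measure (EuclideanSpace ℝ (Fin N))} [IsProbabilityMeasure P]
  {U : EuclideanSpace ℝ (Fin N) → ℝ} {C : ℝ}

theorem norm_le_sqrt_of_sq_le {σ : EuclideanSpace ℝ (Fin N)} (h : ‖σ‖ ^ 2 ≤ N) : ‖σ‖ ≤ √N :=
  Real.le_sqrt_of_sq_le h

theorem abs_exponent_le {σ : EuclideanSpace ℝ (Fin N)} (h : ‖σ‖ ^ 2 ≤ N) (hC : |U σ| ≤ C) (s : ℝ)
    (y : EuclideanSpace ℝ (Fin N)) :
    |U σ + inner ℝ y σ - s * ‖σ‖ ^ 2| ≤ C + ‖y‖ * √N + |s| * N := by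
  have h1 : |inner ℝ y σ| ≤ ‖y‖ * √N := (abs_real_inner_le_norm y σ).trans
    (mul_le_mul_of_nonneg_left (norm_le_sqrt_of_sq_le h) (norm_nonneg _))
  have h2 : |s * ‖σ‖ ^ 2| ≤ |s| * N := by
    rw [abs_mul, abs_of_nonneg (sq_nonneg ‖σ‖)]
    exact mul_le_mul_of_nonneg_left h (abs_nonneg s)
  rw [abs_le] at *
  constructor <;> linarith [h1.1, h1.2, h2.1, h2.2, hC.1, hC.2]

theorem integrable_exp_tilt (hP : ∀ᵐ σ ∂P, ‖σ‖ ^ 2 ≤ N) (hU : Measurable U)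
    (hC : ∀ᵐ σ ∂P, |U σ| ≤ C) (s : ℝ) (y : EuclideanSpace ℝ (Fin N)) :
    Integrable (fun σ => Real.exp (U σ + inner ℝ y σ - s * ‖σ‖ ^ 2)) P := by
  refine (integrable_const (Real.exp (C + ‖y‖ * √N + |s| * N))).mono'
    (by fun_prop) ?_
  filter_upwards [hP, hC] with σ h1 h2
  rw [Real.norm_of_nonneg (Real.exp_pos _).le, Real.exp_le_exp]
  exact (abs_le.1 (abs_exponent_le h1 h2 s y)).2

theorem integral_exp_tilt_pos (hP : ∀ᵐ σ ∂P, ‖σ‖ ^ 2 ≤ N) (hU : Measurable U)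
    (hC : ∀ᵐ σ ∂P, |U σ| ≤ C) (s : ℝ) (y : EuclideanSpace ℝ (Fin N)) :
    0 < ∫ σ, Real.exp (U σ + inner ℝ y σ - s * ‖σ‖ ^ 2) ∂P :=
  integral_exp_pos (integrable_exp_tilt hP hU hC s y)

theorem exp_logLaplace (hP : ∀ᵐ σ ∂P, ‖σ‖ ^ 2 ≤ N) (hU : Measurable U)
    (hC : ∀ᵐ σ ∂P, |U σ| ≤ C) (s : ℝ) (y : EuclideanSpace ℝ (Fin N)) :
    Real.exp (logLaplace P U s y) = ∫ σ, Real.exp (U σ + inner ℝ y σ - s * ‖σ‖ ^ 2) ∂P :=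
  Real.exp_log (integral_exp_tilt_pos hP hU hC s y)

theorem ofReal_exp_logLaplace (hP : ∀ᵐ σ ∂P, ‖σ‖ ^ 2 ≤ N) (hU : Measurable U)
    (hC : ∀ᵐ σ ∂P, |U σ| ≤ C) (s : ℝ) (y : EuclideanSpace ℝ (Fin N)) :
    ENNReal.ofReal (Real.exp (logLaplace P U s y)) =
      ∫⁻ σ, ENNReal.ofReal (Real.exp (U σ + inner ℝ y σ - s * ‖σ‖ ^ 2)) ∂P := by
  rw [exp_logLaplace hP hU hC, ofReal_integral_eq_lintegral_ofReal (integrable_exp_tilt hP hU hC s y)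
    (ae_of_all _ fun _ => (Real.exp_pos _).le)]

theorem lipschitzWith_logLaplace (hP : ∀ᵐ σ ∂P, ‖σ‖ ^ 2 ≤ N) (hU : Measurable U)
    (hC : ∀ᵐ σ ∂P, |U σ| ≤ C) (s : ℝ) :
    LipschitzWith (NNReal.sqrt N) (logLaplace P U s) := by
  refine LipschitzWith.of_le_add_mul _ fun x y => ?_
  rw [← Real.exp_le_exp, Real.exp_add, exp_logLaplace hP hU hC, exp_logLaplace hP hU hC,
    ← integral_mul_const]
  refine integral_mono_ae (integrable_exp_tilt hP hU hC s x)
    ((integrable_exp_tilt hP hU hC s y).mul_const _) ?_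
  filter_upwards [hP] with σ h1
  rw [← Real.exp_add, Real.exp_le_exp]
  have h2 : inner ℝ x σ - inner ℝ y σ ≤ √N * dist x y := by
    rw [← inner_sub_left, dist_eq_norm, mul_comm]
    exact (real_inner_le_norm _ _).trans
      (mul_le_mul_of_nonneg_left (norm_le_sqrt_of_sq_le h1) (norm_nonneg _))
  simp only [Real.coe_sqrt, NNReal.coe_natCast]
  linarith

theorem abs_logLaplace_zero_le (hP : ∀ᵐ σ ∂P, ‖σ‖ ^ 2 ≤ N) (hU : Measurable U)
    (hC : ∀ᵐ σ ∂P, |U σ| ≤ C) (s : ℝ) : |logLaplace P U s 0| ≤ C + |s| * N := by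
  have hb : ∀ᵐ σ ∂P, |U σ + inner ℝ (0 : EuclideanSpace ℝ (Fin N)) σ - s * ‖σ‖ ^ 2| ≤
      C + |s| * N := by
    filter_upwards [hP, hC] with σ h1 h2
    simpa using abs_exponent_le h1 h2 s 0
  have hi := integrable_exp_tilt hP hU hC s 0
  rw [abs_le]
  constructor
  · rw [← Real.exp_le_exp, exp_logLaplace hP hU hC]
    have := integral_mono_ae (integrable_const (Real.exp (-(C + |s| * N)))) hi (by
      filter_upwards [hb] with σ h
      exact Real.exp_le_exp.2 (abs_le.1 h).1)
    simpa using this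
  · rw [← Real.exp_le_exp, exp_logLaplace hP hU hC]
    have := integral_mono_ae hi (integrable_const (Real.exp (C + |s| * N))) (by
      filter_upwards [hb] with σ h
      exact Real.exp_le_exp.2 (abs_le.1 h).2)
    simpa using this

/-- At ζ = 1 the Gaussian average passes inside the integral over σ and produces exp(d |σ|²), which
compensates the change in the correction -s |σ|². Thus levels placed above the last atom have no
effect. -/
theorem parisiOp_one_logLaplace (hP : ∀ᵐ σ ∂P, ‖σ‖ ^ 2 ≤ N) (hU : Measurable U)
    (hC : ∀ᵐ σ ∂P, |U σ| ≤ C) (s : ℝ) {d : ℝ} (hd : 0 ≤ d) :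
    parisiOp 1 √(2 * d) (logLaplace P U (s + d)) = logLaplace P U s := by
  ext y
  set a := √(2 * d) with ha
  have ha2 : a ^ 2 / 2 = d := by rw [ha, Real.sq_sqrt (by positivity)]; ring
  simp only [parisiOp, one_ne_zero, if_false, inv_one, one_mul, exp_logLaplace hP hU hC]
  rw [logLaplace]
  congr 1
  have hi : Integrable (Function.uncurry fun (z σ : EuclideanSpace ℝ (Fin N)) =>
      Real.exp (U σ + inner ℝ (y + a • z) σ - (s + d) * ‖σ‖ ^ 2)) ((gauss N).prod P) := by
    have h1 := ((integrable_exp_mul_norm (N := N) (|a| * √N)).const_mul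
      (Real.exp (C + ‖y‖ * √N + |s + d| * N))).comp_fst P
    refine h1.mono' (by unfold Function.uncurry; fun_prop) ?_
    have h2 : ∀ᵐ x ∂((gauss N).prod P), ‖x.2‖ ^ 2 ≤ N ∧ |U x.2| ≤ C :=
      Measure.quasiMeasurePreserving_snd.ae (hP.and hC)
    filter_upwards [h2] with x hx
    simp only [Function.uncurry]
    rw [Real.norm_of_nonneg (Real.exp_pos _).le, ← Real.exp_add, Real.exp_le_exp]
    have h3 := (abs_le.1 (abs_exponent_le hx.1 hx.2 (s + d) (y + a • x.1))).2
    have h4 : ‖y + a • x.1‖ * √N ≤ (‖y‖ + |a| * ‖x.1‖) * √N := by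
      refine mul_le_mul_of_nonneg_right ((norm_add_le _ _).trans_eq ?_) (Real.sqrt_nonneg _)
      rw [norm_smul, Real.norm_eq_abs]
    nlinarith
  rw [integral_integral_swap hi]
  refine integral_congr_ae (ae_of_all _ fun σ => ?_)
  have e : ∀ z : EuclideanSpace ℝ (Fin N), Real.exp (U σ + inner ℝ (y + a • z) σ -
      (s + d) * ‖σ‖ ^ 2) = Real.exp (U σ + inner ℝ y σ - (s + d) * ‖σ‖ ^ 2) *
        Real.exp (a * inner ℝ z σ) := fun z => by
    rw [← Real.exp_add, inner_add_left, real_inner_smul_left]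
    ring_nf
  simp only [e]
  rw [integral_const_mul, integral_exp_inner_gauss, ← Real.exp_add, ha2]
  ring_nf

end LogLaplace

/-! ### The free energy as a recursion. -/

section FreeEnergy

variable {N : ℕ}

/-- The law of the couplings. -/
def couplingLaw (N : ℕ) : Measure (CouplingIndex N → ℝ) :=
  Measure.infinitePi fun _ : CouplingIndex N => gaussianReal 0 1

instance (N : ℕ) : IsProbabilityMeasure (couplingLaw N) := by
  unfold couplingLaw; infer_instance

theorem law_eq_prod (N : ℕ) : law N = (couplingLaw N).prod (treeLaw N) := rfl

/-- The part of the exponent which depends neither on the cascade nor on the measure `μ`. -/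
def energy (β : ℕ →₀ ℝ) (t : ℝ) (J : CouplingIndex N → ℝ) (σ : EuclideanSpace ℝ (Fin N)) : ℝ :=
  √(2 * t) * hamiltonian β (J, (fun _ => 0, fun _ => 0)) σ - N * t * xi β (‖σ‖ ^ 2 / N)

@[fun_prop]
theorem measurable_hamiltonian (β : ℕ →₀ ℝ) :
    Measurable fun x : Sample N × EuclideanSpace ℝ (Fin N) => hamiltonian β x.1 x.2 := by
  unfold hamiltonian Finsupp.sum
  fun_prop

@[fun_prop]
theorem measurable_xi (β : ℕ →₀ ℝ) : Measurable (xi β) := by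
  unfold xi Finsupp.sum
  fun_prop

theorem measurable_energy (β : ℕ →₀ ℝ) (t : ℝ) (J : CouplingIndex N → ℝ) :
    Measurable (energy β t J) := by
  have h := (measurable_hamiltonian (N := N) β).comp (f := fun σ => ((J, (fun _ => 0, fun _ => 0)), σ))
    measurable_prodMk_left
  unfold energy
  exact (h.const_mul _).sub (by fun_prop)

/-- A bound on the energy in the ball. -/
def energyBound (β : ℕ →₀ ℝ) (t : ℝ) (J : CouplingIndex N → ℝ) : ℝ :=
  √(2 * t) * (β.sum fun p b => √(b * N / (N : ℝ) ^ p) *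
    ∑ i : Fin p → Fin N, |J ⟨p, i⟩| * √N ^ p) + N * |t| * β.sum fun _ b => |b|

theorem integrable_energyBound (β : ℕ →₀ ℝ) (t : ℝ) :
    Integrable (energyBound (N := N) β t) (couplingLaw N) := by
  have h : ∀ c : CouplingIndex N, Integrable (fun J : CouplingIndex N → ℝ => |J c|)
      (couplingLaw N) := fun c => by
    have hm := measurePreserving_eval_infinitePi (fun _ : CouplingIndex N => gaussianReal 0 1) c
    exact (hm.integrable_comp_of_integrable
      (IsGaussian.integrable_id (μ := gaussianReal 0 1))).norm
  unfold energyBound Finsupp.sum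
  refine Integrable.add (Integrable.const_mul (integrable_finsetSum _ fun p _ =>
    Integrable.const_mul (integrable_finsetSum _ fun i _ => (h _).mul_const _) _) _)
    (integrable_const _)

theorem abs_energy_le (β : ℕ →₀ ℝ) (t : ℝ) (J : CouplingIndex N → ℝ)
    {σ : EuclideanSpace ℝ (Fin N)} (h : ‖σ‖ ^ 2 ≤ N) : |energy β t J σ| ≤ energyBound β t J := by
  have hσ : ∀ i, |σ i| ≤ √N := fun i =>
    (PiLp.norm_apply_le σ i).trans (norm_le_sqrt_of_sq_le h)
  unfold energy energyBound
  refine (abs_sub _ _).trans (add_le_add ?_ ?_)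
  · rw [abs_mul, abs_of_nonneg (Real.sqrt_nonneg _)]
    refine mul_le_mul_of_nonneg_left ?_ (Real.sqrt_nonneg _)
    unfold hamiltonian Finsupp.sum
    refine (Finset.abs_sum_le_sum_abs _ _).trans (Finset.sum_le_sum fun p _ => ?_)
    rw [abs_mul, abs_of_nonneg (Real.sqrt_nonneg _)]
    refine mul_le_mul_of_nonneg_left ?_ (Real.sqrt_nonneg _)
    refine (Finset.abs_sum_le_sum_abs _ _).trans (Finset.sum_le_sum fun i _ => ?_)
    rw [abs_mul, Finset.abs_prod]
    refine mul_le_mul_of_nonneg_left ?_ (abs_nonneg _)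
    refine (Finset.prod_le_prod (fun _ _ => abs_nonneg _) fun j _ => hσ (i j)).trans_eq ?_
    simp
  · rw [abs_mul, abs_mul, Nat.abs_cast]
    refine mul_le_mul_of_nonneg_left ?_ (by positivity)
    unfold xi Finsupp.sum
    refine (Finset.abs_sum_le_sum_abs _ _).trans (Finset.sum_le_sum fun p _ => ?_)
    have h1 : ‖σ‖ ^ 2 / N ≤ 1 := div_le_one_of_le₀ h (Nat.cast_nonneg _)
    have h0 : 0 ≤ ‖σ‖ ^ 2 / N := by positivity
    rw [abs_mul, abs_of_nonneg (pow_nonneg h0 p)]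
    exact mul_le_of_le_one_right (abs_nonneg _) (pow_le_one₀ h0 h1)

theorem ae_abs_energy_le {P : Measure (EuclideanSpace ℝ (Fin N))} (hP : ∀ᵐ σ ∂P, ‖σ‖ ^ 2 ≤ N)
    (β : ℕ →₀ ℝ) (t : ℝ) (J : CouplingIndex N → ℝ) :
    ∀ᵐ σ ∂P, |energy β t J σ| ≤ energyBound β t J :=
  hP.mono fun _ h => abs_energy_le β t J h

/-- The parameters of the levels of the cascade attached to a representation. -/
def AtomicRep.levels {μ : ProbabilityMeasure ℝ≥0} (A : AtomicRep μ) : List (ℝ × ℝ) :=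
  List.ofFn fun ℓ : Fin A.k => (A.ζ (ℓ + 1), √(2 * increment A.q (ℓ + 1)))

theorem AtomicRep.ζ_strictMono {μ : ProbabilityMeasure ℝ≥0} (A : AtomicRep μ) {i j : ℕ}
    (hij : i < j) (hj : j ≤ A.k + 1) : A.ζ i < A.ζ j := by
  induction j, hij using Nat.le_induction with
  | base => exact A.ζ_lt _ (by omega)
  | succ j hij ih => exact (ih (by omega)).trans (A.ζ_lt j (by omega))

theorem AtomicRep.admissible_levels {μ : ProbabilityMeasure ℝ≥0} (A : AtomicRep μ) :
    Admissible A.levels := by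
  constructor
  · intro p hp
    obtain ⟨i, rfl⟩ := (List.mem_ofFn' _ _).1 hp
    refine ⟨?_, ?_⟩
    · have := A.ζ_strictMono (i := 0) (j := i + 1) (by omega) (by omega)
      rwa [A.ζ_zero] at this
    · have := A.ζ_strictMono (i := i + 1) (j := A.k + 1) (by omega) le_rfl
      rwa [A.ζ_last] at this
  · rw [AtomicRep.levels, List.pairwise_ofFn]
    intro i j hij
    exact A.ζ_strictMono (by simpa using hij) (by omega)

/-- The logarithmic Laplace transform attached to a realization of the couplings. -/
def couplingLaplace (β : ℕ →₀ ℝ) (P : Measure (EuclideanSpace ℝ (Fin N))) (t : ℝ)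
    (J : CouplingIndex N → ℝ) (s : ℝ) : EuclideanSpace ℝ (Fin N) → ℝ :=
  logLaplace P (energy β t J) s

theorem cascadeField_eq_inner {k : ℕ} (q : ℕ → ℝ≥0) (J : CouplingIndex N → ℝ) (T : TreeSample N)
    (σ : EuclideanSpace ℝ (Fin N)) (α : Fin k → ℕ) :
    cascadeField q (J, T) σ α = inner ℝ (√(2 * increment q 0) • rootVec T +
      ∑ ℓ ∈ Finset.range k, √(2 * increment q (ℓ + 1)) • vertexVec T (ancestor α (ℓ + 1))) σ := by
  have h : ∀ v : List ℕ, ∑ i, T.1 (v, i) * σ i = inner ℝ (vertexVec T v) σ := fun v => by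
    simp only [PiLp.inner_apply, vertexVec]
    exact Finset.sum_congr rfl fun i _ => by simp [mul_comm]
  rw [cascadeField, Finset.sum_range_succ', add_comm, inner_add_left, sum_inner]
  simp only [h, ancestor_zero, real_inner_smul_left]
  rfl

variable {P : Measure (EuclideanSpace ℝ (Fin N))} [IsProbabilityMeasure P]

theorem measurable_exp_term (β : ℕ →₀ ℝ) (t : ℝ) {μ : ProbabilityMeasure ℝ≥0} (A : AtomicRep μ)
    (α : Fin A.k → ℕ) :
    Measurable fun x : Sample N × EuclideanSpace ℝ (Fin N) =>
      ENNReal.ofReal (Real.exp (√(2 * t) * hamiltonian β x.1 x.2 - N * t * xi β (‖x.2‖ ^ 2 / N)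
      + cascadeField A.q x.1 x.2 α - A.q A.k * ‖x.2‖ ^ 2)) := by
  have : Measurable fun x : Sample N × EuclideanSpace ℝ (Fin N) => cascadeField A.q x.1 x.2 α := by
    unfold cascadeField
    fun_prop
  fun_prop

theorem measurable_exp_term_section (β : ℕ →₀ ℝ) (t : ℝ) {μ : ProbabilityMeasure ℝ≥0}
    (A : AtomicRep μ) (α : Fin A.k → ℕ) (ω : Sample N) :
    Measurable fun σ : EuclideanSpace ℝ (Fin N) =>
      ENNReal.ofReal (Real.exp (√(2 * t) * hamiltonian β ω σ - N * t * xi β (‖σ‖ ^ 2 / N)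
      + cascadeField A.q ω σ α - A.q A.k * ‖σ‖ ^ 2)) :=
  (measurable_exp_term β t A α).comp (f := fun σ => (ω, σ)) measurable_prodMk_left

theorem measurable_partitionFunction (β : ℕ →₀ ℝ) (t : ℝ) {μ : ProbabilityMeasure ℝ≥0}
    (A : AtomicRep μ) : Measurable (partitionFunction (N := N) β P t A) := by
  have hw : ∀ α : Fin A.k → ℕ, Measurable fun ω : Sample N => leafWeight A.ζ ω α := fun α => by
    unfold leafWeight poissonPoint
    fun_prop
  have hc : ∀ α : Fin A.k → ℕ, Measurable fun ω : Sample N => cascade A.ζ ω α := fun α => by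
    unfold cascade
    exact (hw α).ennreal_ofReal.div (Measurable.tsum fun α' => (hw α').ennreal_ofReal)
  refine Measurable.lintegral_prod_right'
    (f := fun x : Sample N × EuclideanSpace ℝ (Fin N) => ∑' α : Fin A.k → ℕ,
    ENNReal.ofReal (Real.exp (√(2 * t) * hamiltonian β x.1 x.2 - N * t * xi β (‖x.2‖ ^ 2 / N)
      + cascadeField A.q x.1 x.2 α - A.q A.k * ‖x.2‖ ^ 2)) * cascade A.ζ x.1 α) ?_
  exact Measurable.tsum fun α => (measurable_exp_term β t A α).mul ((hc α).comp measurable_fst)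

/-- Exchange the sum with the integral: on each leaf, the cascade field is the inner product of σ
with the sum of the Gaussian vectors along the branch, so the integral over σ is exp of the
log-Laplace transform there. -/
theorem partitionFunction_eq (hP : ∀ᵐ σ ∂P, ‖σ‖ ^ 2 ≤ N) (β : ℕ →₀ ℝ) (t : ℝ)
    {μ : ProbabilityMeasure ℝ≥0} (A : AtomicRep μ) (J : CouplingIndex N → ℝ) {T : TreeSample N}
    (hT : ∀ p, 0 < T.2 p) :
    partitionFunction β P t A (J, T) =
      cascadeSum (fun x => ENNReal.ofReal (Real.exp (couplingLaplace β P t J (A.q A.k) x))) A.levels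
        (√(2 * increment A.q 0) • rootVec T) (forest T) / cascadeMass A.levels (forest T) := by
  have hZ : ∑' α : Fin A.k → ℕ, ENNReal.ofReal (leafWeight A.ζ (J, T) α) =
      cascadeMass A.levels (forest T) := by
    have := tsum_leaves_eq_cascadeSum (fun _ => 1) J A.k A.ζ
      (fun ℓ => √(2 * increment A.q ℓ)) 0 hT
    simp only [one_mul] at this
    rw [this, cascadeSum_one]
    rfl
  have hΦ := tsum_leaves_eq_cascadeSum
    (fun x => ENNReal.ofReal (Real.exp (couplingLaplace β P t J (A.q A.k) x))) J A.k A.ζ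
    (fun ℓ => √(2 * increment A.q ℓ)) (√(2 * increment A.q 0) • rootVec T) hT
  rw [partitionFunction, AtomicRep.levels, ← hΦ, div_eq_mul_inv, ← ENNReal.tsum_mul_right,
    lintegral_tsum]
  · refine tsum_congr fun α => ?_
    rw [lintegral_mul_const]
    · rw [cascade, hZ, div_eq_mul_inv, ← mul_assoc]
      congr 2
      rw [couplingLaplace, ofReal_exp_logLaplace hP (measurable_energy β t J)
        (ae_abs_energy_le hP β t J)]
      refine lintegral_congr fun σ => ?_
      rw [cascadeField_eq_inner]
      rfl
    · exact measurable_exp_term_section β t A α _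
  · intro α
    exact ((measurable_exp_term_section β t A α _).mul_const _).aemeasurable

theorem ae_pos_treeLaw : ∀ᵐ T ∂(treeLaw N), ∀ p, 0 < T.2 p := by
  have h : ∀ᵐ e ∂(Measure.infinitePi fun _ : List ℕ × ℕ => expMeasure 1), ∀ p, 0 < e p := by
    rw [ae_all_iff]
    intro p
    exact (measurePreserving_eval_infinitePi
      (fun _ : List ℕ × ℕ => expMeasure 1) p).quasiMeasurePreserving.ae ae_pos_expMeasure
  exact Measure.quasiMeasurePreserving_snd.ae h

theorem log_partitionFunction_ae_eq (hP : ∀ᵐ σ ∂P, ‖σ‖ ^ 2 ≤ N) (β : ℕ →₀ ℝ) (t : ℝ)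
    {μ : ProbabilityMeasure ℝ≥0} (A : AtomicRep μ) (J : CouplingIndex N → ℝ) :
    (fun T => Real.log (partitionFunction β P t A (J, T)).toReal) =ᵐ[treeLaw N]
      logRatio (couplingLaplace β P t J (A.q A.k)) A.levels √(2 * increment A.q 0) := by
  filter_upwards [ae_pos_treeLaw] with T hT
  rw [partitionFunction_eq hP β t A J hT, logRatio]

theorem lipschitzWith_couplingLaplace (hP : ∀ᵐ σ ∂P, ‖σ‖ ^ 2 ≤ N) (β : ℕ →₀ ℝ) (t : ℝ)
    (J : CouplingIndex N → ℝ) (s : ℝ) :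
    LipschitzWith (NNReal.sqrt N) (couplingLaplace β P t J s) :=
  lipschitzWith_logLaplace hP (measurable_energy β t J) (ae_abs_energy_le hP β t J) s

theorem ae_partitionFunction_pos_lt_top (hP : ∀ᵐ σ ∂P, ‖σ‖ ^ 2 ≤ N) (β : ℕ →₀ ℝ) (t : ℝ)
    {μ : ProbabilityMeasure ℝ≥0} (A : AtomicRep μ) :
    ∀ᵐ ω ∂(law N), 0 < partitionFunction β P t A ω ∧ partitionFunction β P t A ω < ∞ := by
  have hm : MeasurableSet {ω | 0 < partitionFunction β P t A ω ∧ partitionFunction β P t A ω < ∞} :=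
    measurable_partitionFunction (P := P) β t A measurableSet_Ioo
  rw [law_eq_prod, Measure.ae_prod_iff_ae_ae hm]
  refine ae_of_all _ fun J => ?_
  filter_upwards [ae_pos_treeLaw, ae_cascadeSum_root_pos_lt_top
    (lipschitzWith_couplingLaplace hP β t J (A.q A.k)) A.admissible_levels
    √(2 * increment A.q 0)] with T hT h
  rw [partitionFunction_eq hP β t A J hT]
  exact ⟨ENNReal.div_pos h.1.1.ne' h.2.2.ne, ENNReal.div_lt_top h.1.2.ne h.2.1.ne'⟩

/-- The value of the recursion for a realization of the couplings. -/
def cascadeValue (β : ℕ →₀ ℝ) (P : Measure (EuclideanSpace ℝ (Fin N))) (t : ℝ)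
    {μ : ProbabilityMeasure ℝ≥0} (A : AtomicRep μ) (J : CouplingIndex N → ℝ) : ℝ :=
  parisiOp 0 √(2 * increment A.q 0) (recOp A.levels (couplingLaplace β P t J (A.q A.k))) 0

/-- For fixed couplings the mean absolute value over the tree is at most `energyBound` plus a
constant, and `energyBound` is integrable because it is affine in the |J|. -/
theorem integrable_log_partitionFunction (hP : ∀ᵐ σ ∂P, ‖σ‖ ^ 2 ≤ N) (β : ℕ →₀ ℝ) (t : ℝ)
    {μ : ProbabilityMeasure ℝ≥0} (A : AtomicRep μ) :
    Integrable (fun ω => Real.log (partitionFunction β P t A ω).toReal) (law N) := by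
  have hm : Measurable fun ω => Real.log (partitionFunction β P t A ω).toReal :=
    (measurable_partitionFunction (P := P) β t A).ennreal_toReal.log
  obtain ⟨C, hC⟩ := exists_abs_recOp_zero_le (N := N) (NNReal.sqrt N) A.admissible_levels.nonneg
  set D := (NNReal.sqrt N) * |√(2 * increment A.q 0)| * gaussNorm N +
        2 * ∫ f, ‖Real.log (cascadeMass A.levels f).toReal‖ ∂(forestLaw N) with hD
  have hb : Integrable (fun J => energyBound β t J + (|(A.q A.k : ℝ)| * N + C + D))
      (couplingLaw N) := (integrable_energyBound β t).add (integrable_const _)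
  refine (integrable_prod_of_integral_norm_le hm (fun J => ?_) hb fun J => ?_).1
  · exact (integral_logRatio (lipschitzWith_couplingLaplace hP β t J (A.q A.k))
      A.admissible_levels _).1.congr (log_partitionFunction_ae_eq hP β t A J).symm
  · refine (integral_congr_ae ((log_partitionFunction_ae_eq hP β t A J).fun_comp norm)).trans_le ?_
    have h1 := (integral_logRatio (lipschitzWith_couplingLaplace hP β t J (A.q A.k))
      A.admissible_levels √(2 * increment A.q 0)).2.2
    have h2 := hC _ (lipschitzWith_couplingLaplace hP β t J (A.q A.k))
    have h3 := abs_logLaplace_zero_le hP (measurable_energy β t J) (ae_abs_energy_le hP β t J)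
      (A.q A.k)
    refine h1.trans ?_
    unfold couplingLaplace at h2 ⊢
    linarith

theorem integral_log_partitionFunction (hP : ∀ᵐ σ ∂P, ‖σ‖ ^ 2 ≤ N) (β : ℕ →₀ ℝ) (t : ℝ)
    {μ : ProbabilityMeasure ℝ≥0} (A : AtomicRep μ) :
    Integrable (cascadeValue β P t A) (couplingLaw N) ∧
    ∫ ω, Real.log (partitionFunction β P t A ω).toReal ∂(law N) =
      ∫ J, cascadeValue β P t A J ∂(couplingLaw N) := by
  have hi := integrable_log_partitionFunction hP β t A
  have e : ∀ J, ∫ T, Real.log (partitionFunction β P t A (J, T)).toReal ∂(treeLaw N) =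
      cascadeValue β P t A J := fun J =>
    (integral_congr_ae (log_partitionFunction_ae_eq hP β t A J)).trans
      (integral_logRatio (lipschitzWith_couplingLaplace hP β t J (A.q A.k))
        A.admissible_levels _).2.1
  rw [law_eq_prod] at hi ⊢
  refine ⟨by simpa only [e] using hi.integral_prod_left, ?_⟩
  rw [integral_prod _ hi]
  simp only [e]

end FreeEnergy

/-! ### The recursion as an evolution driven by the distribution function. -/

section Evolution

variable {N : ℕ} {L : ℝ≥0} {F F' : ℝ → ℝ} {ψ : ℝ → EuclideanSpace ℝ (Fin N) → ℝ}

/-- The recursion along the points of a list, starting from the point `s`, with the parameter `F r`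
after the point `r`. -/
def evol (F : ℝ → ℝ) (ψ : ℝ → EuclideanSpace ℝ (Fin N) → ℝ) :
    ℝ → List ℝ → EuclideanSpace ℝ (Fin N) → ℝ
  | s, [] => ψ s
  | s, r :: l => parisiOp (F s) √(2 * (r - s)) (evol F ψ r l)

/-- On `[s, ∞)`, the function `F` may jump only at the points of the list, and is `1` at the end. -/
def IsStep (F : ℝ → ℝ) : ℝ → List ℝ → Prop
  | s, [] => ∀ x, s ≤ x → F x = 1
  | s, r :: l => s ≤ r ∧ (∀ x, s ≤ x → x < r → F x = F s) ∧ IsStep F r l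

/-- On `[s, ∞)`, the function `F` is constant between the successive points of the list. -/
def IsFlat (F : ℝ → ℝ) : ℝ → List ℝ → Prop
  | _, [] => True
  | s, r :: l => (∀ x, s ≤ x → x < r → F x = F s) ∧ IsFlat F r l

/-- The integral of `|F - F'|` over the range of the list, for functions which are constant between
its points. -/
def gap (F F' : ℝ → ℝ) : ℝ → List ℝ → ℝ
  | _, [] => 0
  | s, r :: l => |F s - F' s| * (r - s) + gap F F' r l

theorem lipschitzWith_evol (hF : ∀ s, 0 ≤ F s) (hψ : ∀ s, LipschitzWith L (ψ s)) (l : List ℝ) :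
    ∀ s, LipschitzWith L (evol F ψ s l) := by
  induction l with
  | nil => exact hψ
  | cons r l ih => exact fun s => lipschitzWith_parisiOp (ih r) (hF s) _

/-- Change the parameter one interval at a time. With a² = 2 (r - s) each change costs L² (r - s) |F
s - F' s|, and the earlier operators do not expand the error. -/
theorem abs_evol_sub_evol_le (hF : ∀ s, 0 ≤ F s) (hF' : ∀ s, 0 ≤ F' s)
    (hψ : ∀ s, LipschitzWith L (ψ s)) (l : List ℝ) :
    ∀ s, (s :: l).Pairwise (· ≤ ·) → ∀ y,
      |evol F ψ s l y - evol F' ψ s l y| ≤ L ^ 2 * gap F F' s l := by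
  induction l with
  | nil => intro s _ y; simp [evol, gap]
  | cons r l ih =>
    intro s hs y
    have hsr : s ≤ r := (List.pairwise_cons.1 hs).1 r (by simp)
    have h1 := abs_parisiOp_sub_le (lipschitzWith_evol hF hψ l r) (lipschitzWith_evol hF' hψ l r)
      (hF s) (a := √(2 * (r - s))) (ih r (List.pairwise_cons.1 hs).2) y
    have h2 := abs_parisiOp_sub_parisiOp_le (lipschitzWith_evol hF' hψ l r) (hF s) (hF' s)
      √(2 * (r - s)) y
    rw [Real.sq_sqrt (by linarith)] at h2
    simp only [evol, gap]
    refine (abs_sub_le _ (parisiOp (F s) √(2 * (r - s)) (evol F' ψ r l) y) _).trans ?_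
    linarith

theorem ofReal_gap_le (l : List ℝ) : ∀ s, (s :: l).Pairwise (· ≤ ·) → IsFlat F s l →
    IsFlat F' s l → ENNReal.ofReal (gap F F' s l) ≤ ∫⁻ x in Ici s, ENNReal.ofReal |F x - F' x| := by
  induction l with
  | nil => intro s _ _ _; simp [gap]
  | cons r l ih =>
    intro s hs h h'
    have hsr : s ≤ r := (List.pairwise_cons.1 hs).1 r (by simp)
    have hd : Disjoint (Ico s r) (Ici r) := by
      rw [Set.disjoint_left]; intro x h1 h2; exact absurd h2 (not_le.2 h1.2)
    rw [← Ico_union_Ici_eq_Ici hsr, lintegral_union measurableSet_Ici hd, gap]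
    refine ENNReal.ofReal_add_le.trans (add_le_add (le_of_eq ?_)
      (ih r (List.pairwise_cons.1 hs).2 h.2 h'.2))
    rw [setLIntegral_congr_fun (g := fun _ => ENNReal.ofReal |F s - F' s|) measurableSet_Ico
      fun x hx => ?_]
    · rw [setLIntegral_const, Real.volume_Ico, ENNReal.ofReal_mul (abs_nonneg _)]
    · simp only
      rw [h.1 x hx.1 hx.2, h'.1 x hx.1 hx.2]

theorem IsStep.mono_left {s r : ℝ} {m : List ℝ} (h : IsStep F s m) (hsr : s ≤ r)
    (hr : ∀ q ∈ m, r ≤ q) : IsStep F r m := by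
  cases m with
  | nil => exact fun x hx => h x (hsr.trans hx)
  | cons q m =>
    refine ⟨hr q (by simp), fun x h1 h2 => ?_, h.2.2⟩
    rw [h.2.1 x (hsr.trans h1) h2, h.2.1 r hsr (h1.trans_lt h2)]

theorem IsStep.isFlat {m l : List ℝ} (hml : m.Sublist l) :
    ∀ {s : ℝ}, (s :: l).Pairwise (· ≤ ·) → IsStep F s m → IsFlat F s l := by
  induction hml with
  | slnil => intro s _ _; trivial
  | @cons m l r hml ih =>
    intro s hs h
    obtain ⟨h1, h2⟩ := List.pairwise_cons.1 hs
    have hr : ∀ q ∈ m, r ≤ q := fun q hq => (List.pairwise_cons.1 h2).1 q (hml.subset hq)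
    refine ⟨fun x hx hxr => ?_, ih h2 (h.mono_left (h1 r (by simp)) hr)⟩
    cases m with
    | nil => rw [h x hx, h s le_rfl]
    | cons q m => exact h.2.1 x hx (hxr.trans_le (hr q (by simp)))
  | @cons_cons m l r hml ih =>
    intro s hs h
    exact ⟨h.2.1, ih (List.pairwise_cons.1 hs).2 h.2.2⟩

/-- Adding points to the list has no effect on the recursion. -/
theorem evol_eq_of_sublist (hF : ∀ s, 0 ≤ F s) (hψ : ∀ s, LipschitzWith L (ψ s))
    (hone : ∀ s r, s ≤ r → parisiOp 1 √(2 * (r - s)) (ψ r) = ψ s) {m l : List ℝ}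
    (hml : m.Sublist l) :
    ∀ {s : ℝ}, (s :: l).Pairwise (· ≤ ·) → IsStep F s m → evol F ψ s l = evol F ψ s m := by
  induction hml with
  | slnil => intro s _ _; rfl
  | @cons m l r hml ih =>
    intro s hs h
    obtain ⟨h1, h2⟩ := List.pairwise_cons.1 hs
    have hsr : s ≤ r := h1 r (by simp)
    have hr : ∀ q ∈ m, r ≤ q := fun q hq => (List.pairwise_cons.1 h2).1 q (hml.subset hq)
    rw [evol, ih h2 (h.mono_left hsr hr)]
    cases m with
    -- Beyond the last point of `m` the parameter is 1, and `hone` absorbs the additional step.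
    | nil => rw [evol, evol, h s le_rfl, hone s r hsr]
    | cons q m =>
      have hrq : r ≤ q := hr q (by simp)
      simp only [evol]
      -- If the new point coincides with the next one, that step has length 0 and is the identity
      -- whatever F is at the jump; otherwise F is constant across r and the semigroup property
      -- applies.
      rcases hrq.eq_or_lt with rfl | hlt
      · rw [sub_self, mul_zero, Real.sqrt_zero, parisiOp_zero_right]
      · rw [h.2.1 r hsr hlt, parisiOp_parisiOp (lipschitzWith_evol hF hψ m q),
          Real.sq_sqrt (by linarith), Real.sq_sqrt (by linarith)]
        congr 2
        ring
  | @cons_cons m l r hml ih =>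
    intro s hs h
    simp only [evol]
    rw [ih (List.pairwise_cons.1 hs).2 h.2.2]

/-- Both recursions are refined to the sorted union of the two lists. The bound `D` is chosen before
ψ, so that it is uniform in the couplings. -/
theorem abs_evol_sub_evol_le_of_isStep (hF : ∀ s, 0 ≤ F s) (hF' : ∀ s, 0 ≤ F' s)
    {m m' : List ℝ} {s : ℝ} (hm : (s :: m).Pairwise (· ≤ ·)) (hm' : (s :: m').Pairwise (· ≤ ·))
    (h : IsStep F s m) (h' : IsStep F' s m') :
    ∃ D : ℝ, ENNReal.ofReal D ≤ ∫⁻ x in Ici s, ENNReal.ofReal |F x - F' x| ∧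
      ∀ {L : ℝ≥0} {ψ : ℝ → EuclideanSpace ℝ (Fin N) → ℝ}, (∀ s, LipschitzWith L (ψ s)) →
      (∀ s r, s ≤ r → parisiOp 1 √(2 * (r - s)) (ψ r) = ψ s) →
      ∀ y, |evol F ψ s m y - evol F' ψ s m' y| ≤ L ^ 2 * D := by
  obtain ⟨l, hl, h1, h2⟩ : ∃ l : List ℝ, (s :: l).Pairwise (· ≤ ·) ∧ m.Sublist l ∧ m'.Sublist l := by
    obtain ⟨a, b⟩ := List.pairwise_cons.1 hm
    obtain ⟨a', b'⟩ := List.pairwise_cons.1 hm'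
    refine ⟨(m ++ m').mergeSort (· ≤ ·), List.pairwise_cons.2 ⟨fun q hq => ?_, ?_⟩, ?_, ?_⟩
    · rw [List.mem_mergeSort, List.mem_append] at hq
      exact hq.elim (a q) (a' q)
    · exact List.pairwise_mergeSort' _ _
    · exact List.sublist_mergeSort (by simpa using fun _ _ _ => le_trans)
        (by simpa using fun a b => le_total a b) (by simpa using b) (List.sublist_append_left _ _)
    · exact List.sublist_mergeSort (by simpa using fun _ _ _ => le_trans)
        (by simpa using fun a b => le_total a b) (by simpa using b') (List.sublist_append_right _ _)
  refine ⟨gap F F' s l, ofReal_gap_le l s hl (h.isFlat h1 hl) (h'.isFlat h2 hl),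
    fun hψ hone y => ?_⟩
  rw [← evol_eq_of_sublist hF hψ hone h1 hl h, ← evol_eq_of_sublist hF' hψ hone h2 hl h']
  exact abs_evol_sub_evol_le hF hF' hψ l s hl y

end Evolution

/-! ### Atomic representations and distribution functions. -/

section Representation

variable {N : ℕ} {μ : ProbabilityMeasure ℝ≥0}

/-- The distribution function of a probability measure on the half-line. -/
def distFun (μ : ProbabilityMeasure ℝ≥0) (s : ℝ) : ℝ :=
  (μ : Measure ℝ≥0).real {x | (x : ℝ) ≤ s}

theorem distFun_nonneg (μ : ProbabilityMeasure ℝ≥0) (s : ℝ) : 0 ≤ distFun μ s :=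
  measureReal_nonneg

namespace AtomicRep

variable (A : AtomicRep μ)

theorem ζ_nonneg {ℓ : ℕ} (hℓ : ℓ ≤ A.k + 1) : 0 ≤ A.ζ ℓ := by
  rcases Nat.eq_zero_or_pos ℓ with rfl | h
  · exact A.ζ_zero.ge
  · exact (A.ζ_zero.symm.trans_lt (A.ζ_strictMono h hℓ)).le

theorem q_mono {i j : ℕ} (hij : i ≤ j) (hj : j ≤ A.k) : A.q i ≤ A.q j := by
  induction j, hij using Nat.le_induction with
  | base => exact le_rfl
  | succ j hij ih => exact (ih (by omega)).trans (A.q_lt j (by omega)).le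

/-- Here m counts the atoms not exceeding s, and the sum of their masses telescopes. -/
theorem distFun_eq {m : ℕ} (hm : m ≤ A.k + 1) {s : ℝ} (h1 : ∀ ℓ < m, (A.q ℓ : ℝ) ≤ s)
    (h2 : ∀ ℓ, m ≤ ℓ → ℓ ≤ A.k → s < A.q ℓ) : distFun μ s = A.ζ m := by
  have hs : MeasurableSet {x : ℝ≥0 | (x : ℝ) ≤ s} := measurableSet_le (by fun_prop) measurable_const
  have e : (μ : Measure ℝ≥0) {x : ℝ≥0 | (x : ℝ) ≤ s} =
      ∑ ℓ ∈ Finset.range m, ENNReal.ofReal (A.ζ (ℓ + 1) - A.ζ ℓ) := by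
    rw [A.eq_sum, Measure.finsetSum_apply, ← Finset.sum_range_add_sum_Ico _ hm]
    rw [Finset.sum_eq_zero (s := Finset.Ico m (A.k + 1)), add_zero]
    · refine Finset.sum_congr rfl fun ℓ hℓ => ?_
      have : A.q ℓ ∈ {x : ℝ≥0 | (x : ℝ) ≤ s} := h1 ℓ (Finset.mem_range.1 hℓ)
      simp [Measure.dirac_apply' _ hs, this]
    · intro ℓ hℓ
      have h3 := Finset.mem_Ico.1 hℓ
      have : A.q ℓ ∉ {x : ℝ≥0 | (x : ℝ) ≤ s} := not_le.2 (h2 ℓ h3.1 (by omega))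
      simp [Measure.dirac_apply' _ hs, this]
  rw [distFun, Measure.real, e, ← ENNReal.ofReal_sum_of_nonneg, Finset.sum_range_sub, A.ζ_zero, sub_zero,
    ENNReal.toReal_ofReal (A.ζ_nonneg hm)]
  intro ℓ hℓ
  have := A.ζ_lt ℓ (by have := Finset.mem_range.1 hℓ; omega)
  linarith

theorem distFun_eq_of_lt_zero {s : ℝ} (h : s < A.q 0) : distFun μ s = 0 := by
  rw [A.distFun_eq (m := 0) (by omega) (by simp) fun ℓ _ hℓ => ?_, A.ζ_zero]
  exact h.trans_le (NNReal.coe_le_coe.2 (A.q_mono (Nat.zero_le _) hℓ))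

theorem distFun_eq_of_mem {ℓ : ℕ} (hℓ : ℓ < A.k) {s : ℝ} (h1 : (A.q ℓ : ℝ) ≤ s)
    (h2 : s < A.q (ℓ + 1)) : distFun μ s = A.ζ (ℓ + 1) :=
  A.distFun_eq (by omega)
    (fun _ hi => (NNReal.coe_le_coe.2 (A.q_mono (by omega) hℓ.le)).trans h1)
    fun _ hi hi' => h2.trans_le (NNReal.coe_le_coe.2 (A.q_mono hi hi'))

theorem distFun_eq_one {s : ℝ} (h : (A.q A.k : ℝ) ≤ s) : distFun μ s = 1 := by
  rw [A.distFun_eq le_rfl (fun _ hi => (NNReal.coe_le_coe.2 (A.q_mono (by omega) le_rfl)).trans h)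
    fun _ hi hi' => by omega, A.ζ_last]

/-- The atoms `q_{j+1}, …, q_{j+n}`. -/
def atoms (q : ℕ → ℝ≥0) (j n : ℕ) : List ℝ := (List.range' (j + 1) n).map fun i => (q i : ℝ)

theorem atoms_succ (q : ℕ → ℝ≥0) (j n : ℕ) :
    atoms q j (n + 1) = (q (j + 1) : ℝ) :: atoms q (j + 1) n := by
  simp [atoms, List.range'_succ]

theorem isStep_atoms (n : ℕ) : ∀ j, j + n = A.k → IsStep (distFun μ) (A.q j) (atoms A.q j n) := by
  induction n with
  | zero =>
    intro j hj x hx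
    exact A.distFun_eq_one (by rw [← hj]; exact hx)
  | succ n ih =>
    intro j hj
    have hlt := A.q_lt j (by omega)
    rw [atoms_succ]
    refine ⟨NNReal.coe_le_coe.2 hlt.le, fun x h1 h2 => ?_, ih (j + 1) (by omega)⟩
    rw [A.distFun_eq_of_mem (by omega) h1 h2,
      A.distFun_eq_of_mem (by omega) le_rfl (NNReal.coe_lt_coe.2 hlt)]

theorem isStep_zero : IsStep (distFun μ) 0 ((A.q 0 : ℝ) :: atoms A.q 0 A.k) := by
  refine ⟨NNReal.coe_nonneg _, fun x h1 h2 => ?_, A.isStep_atoms A.k 0 (by omega)⟩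
  rw [A.distFun_eq_of_lt_zero h2, A.distFun_eq_of_lt_zero (h1.trans_lt h2)]

theorem pairwise_atoms : ((0 : ℝ) :: (A.q 0 : ℝ) :: atoms A.q 0 A.k).Pairwise (· ≤ ·) := by
  have e : (A.q 0 : ℝ) :: atoms A.q 0 A.k = (List.range (A.k + 1)).map fun i => (A.q i : ℝ) := by
    rw [List.range_eq_range', List.range'_succ]; rfl
  rw [e]
  refine List.pairwise_cons.2 ⟨fun x hx => ?_, ?_⟩
  · obtain ⟨i, -, rfl⟩ := List.mem_map.1 hx
    exact NNReal.coe_nonneg _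
  · rw [List.pairwise_map]
    refine List.pairwise_lt_range.imp_of_mem fun {i j} _ hj hij => ?_
    exact NNReal.coe_le_coe.2 (A.q_mono hij.le (by have := List.mem_range.1 hj; omega))

theorem evol_atoms (ψ : ℝ → EuclideanSpace ℝ (Fin N) → ℝ) (n : ℕ) : ∀ j, j + n = A.k →
    evol (distFun μ) ψ (A.q j) (atoms A.q j n) =
      recOp (List.ofFn fun ℓ : Fin n => (A.ζ (j + ℓ + 1), √(2 * increment A.q (j + ℓ + 1))))
        (ψ (A.q A.k)) := by
  induction n with
  | zero =>
    intro j hj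
    rw [← hj]
    rfl
  | succ n ih =>
    intro j hj
    rw [atoms_succ, List.ofFn_succ, evol, recOp, ih (j + 1) (by omega),
      A.distFun_eq_of_mem (by omega) le_rfl (NNReal.coe_lt_coe.2 (A.q_lt j (by omega)))]
    simp only [Fin.val_succ, Fin.val_zero, add_zero, increment, add_assoc, add_comm 1]

/-- On [0, q_0) the distribution function vanishes, and the step from 0 to q_0 is the plain average
over the root vector. -/
theorem evol_zero (ψ : ℝ → EuclideanSpace ℝ (Fin N) → ℝ) :
    evol (distFun μ) ψ 0 ((A.q 0 : ℝ) :: atoms A.q 0 A.k) =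
      parisiOp 0 √(2 * increment A.q 0) (recOp A.levels (ψ (A.q A.k))) := by
  have h := A.evol_atoms ψ A.k 0 (by omega)
  simp only [zero_add] at h
  rw [evol, h, sub_zero, levels]
  simp only [increment]
  -- If q_0 = 0 the distribution function is already positive at 0, but the step has length 0 and
  -- the parameter is irrelevant.
  rcases eq_or_ne (A.q 0) 0 with h0 | h0
  · simp [h0, parisiOp_zero_right]
  · rw [A.distFun_eq_of_lt_zero (NNReal.coe_pos.2 (pos_iff_ne_zero.2 h0))]

end AtomicRep

variable {P : Measure (EuclideanSpace ℝ (Fin N))} [IsProbabilityMeasure P]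

/-- For every realization of the couplings the two recursions differ by at most L² D with L² = N,
and the prefactor 1/N removes the N. -/
theorem ofReal_abs_integral_freeEnergy_sub_le (hN : 1 ≤ N) (hP : ∀ᵐ σ ∂P, ‖σ‖ ^ 2 ≤ N)
    (β : ℕ →₀ ℝ) (t : ℝ) {ν : ProbabilityMeasure ℝ≥0} (A : AtomicRep μ) (B : AtomicRep ν) :
    ENNReal.ofReal |∫ ω, freeEnergy β P t A ω ∂(law N) - ∫ ω, freeEnergy β P t B ω ∂(law N)| ≤
      ∫⁻ x in Ici (0 : ℝ), ENNReal.ofReal |distFun μ x - distFun ν x| := by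
  obtain ⟨D, hD, h⟩ := abs_evol_sub_evol_le_of_isStep (N := N) (distFun_nonneg μ) (distFun_nonneg ν)
    A.pairwise_atoms B.pairwise_atoms A.isStep_zero B.isStep_zero
  refine le_trans (ENNReal.ofReal_le_ofReal ?_) hD
  have hJ : ∀ J, |cascadeValue β P t A J - cascadeValue β P t B J| ≤ N * D := fun J => by
    have := h (lipschitzWith_couplingLaplace hP β t J) (fun s r hsr => by
      have := parisiOp_one_logLaplace hP (measurable_energy β t J) (ae_abs_energy_le hP β t J) s
        (sub_nonneg.2 hsr)
      rwa [add_sub_cancel] at this) 0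
    rw [A.evol_zero, B.evol_zero] at this
    simpa [cascadeValue] using this
  obtain ⟨iA, eA⟩ := integral_log_partitionFunction hP β t A
  obtain ⟨iB, eB⟩ := integral_log_partitionFunction hP β t B
  simp only [freeEnergy]
  rw [integral_const_mul, integral_const_mul, eA, eB, ← mul_sub, ← integral_sub iA iB, abs_mul,
    abs_neg, abs_of_nonneg (by positivity)]
  have h1 : |∫ J, (cascadeValue β P t A J - cascadeValue β P t B J) ∂(couplingLaw N)| ≤ N * D := by
    have := norm_integral_le_of_norm_le_const (μ := couplingLaw N)
      (f := fun J => cascadeValue β P t A J - cascadeValue β P t B J) (ae_of_all _ hJ)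
    simpa using this
  have hN' : (0 : ℝ) < N := by exact_mod_cast hN
  calc 1 / (N : ℝ) * _ ≤ 1 / (N : ℝ) * (N * D) := by gcongr
    _ = D := by field_simp

end Representation

/-! ### Wasserstein distance and distribution functions. -/

section Coupling

variable (π : Measure (ℝ≥0 × ℝ≥0)) [SFinite π]

theorem measurableSet_le_lt {X : Type*} [MeasurableSpace X] {f g h : X → ℝ} (hf : Measurable f)
    (hg : Measurable g) (hh : Measurable h) : MeasurableSet {x | f x ≤ g x ∧ g x < h x} :=
  (measurableSet_le hf hg).inter (measurableSet_lt hg hh)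

theorem measurableSet_le_lt_fst : MeasurableSet
    {p : (ℝ≥0 × ℝ≥0) × ℝ | (p.1.1 : ℝ) ≤ p.2 ∧ p.2 < p.1.2} :=
  measurableSet_le_lt (by fun_prop) (by fun_prop) (by fun_prop)

theorem measurableSet_le_lt_snd : MeasurableSet
    {p : (ℝ≥0 × ℝ≥0) × ℝ | (p.1.2 : ℝ) ≤ p.2 ∧ p.2 < p.1.1} :=
  measurableSet_le_lt (by fun_prop) (by fun_prop) (by fun_prop)

theorem volume_Ici_Ico (a b : ℝ≥0) :
    (volume.restrict (Ici (0 : ℝ))) {s | (a : ℝ) ≤ s ∧ s < b} = ENNReal.ofReal ((b : ℝ) - a) := by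
  have e : {s : ℝ | (a : ℝ) ≤ s ∧ s < b} = Ico (a : ℝ) b := rfl
  rw [e, Measure.restrict_apply measurableSet_Ico, inter_eq_left.2, Real.volume_Ico]
  exact fun s hs => a.coe_nonneg.trans hs.1

theorem edist_eq_ofReal_add (a b : ℝ≥0) :
    edist a b = ENNReal.ofReal ((b : ℝ) - a) + ENNReal.ofReal ((a : ℝ) - b) := by
  rw [edist_dist, NNReal.dist_eq]
  rcases le_total a b with h | h
  · have h' := NNReal.coe_le_coe.2 h
    rw [ENNReal.ofReal_of_nonpos (p := (a : ℝ) - b) (by linarith), add_zero, abs_sub_comm,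
      abs_of_nonneg (by linarith)]
  · have h' := NNReal.coe_le_coe.2 h
    rw [ENNReal.ofReal_of_nonpos (p := (b : ℝ) - a) (by linarith), zero_add,
      abs_of_nonneg (by linarith)]

/-- The distance between two points is the length of the set of thresholds s that separate them;
then Tonelli. -/
theorem lintegral_edist_eq :
    ∫⁻ x, edist x.1 x.2 ∂π = ∫⁻ s in Ici (0 : ℝ),
      (π {x | (x.1 : ℝ) ≤ s ∧ s < x.2} + π {x | (x.2 : ℝ) ≤ s ∧ s < x.1}) := by
  have h1 := Measure.prod_apply (μ := π) (ν := volume.restrict (Ici (0 : ℝ))) measurableSet_le_lt_fst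
  have h2 := Measure.prod_apply (μ := π) (ν := volume.restrict (Ici (0 : ℝ))) measurableSet_le_lt_snd
  rw [Measure.prod_apply_symm measurableSet_le_lt_fst] at h1
  rw [Measure.prod_apply_symm measurableSet_le_lt_snd] at h2
  have m1 := measurable_measure_prodMk_right (μ := π) measurableSet_le_lt_fst
  simp only [preimage_ofPred_eq] at h1 h2 m1
  rw [lintegral_add_left m1, h1, h2, ← lintegral_add_left]
  · refine lintegral_congr fun x => ?_
    rw [volume_Ici_Ico, volume_Ici_Ico, edist_eq_ofReal_add]
  · simp only [volume_Ici_Ico]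
    fun_prop

end Coupling

theorem ofReal_distFun (μ : ProbabilityMeasure ℝ≥0) (s : ℝ) :
    ENNReal.ofReal (distFun μ s) = (μ : Measure ℝ≥0) {x | (x : ℝ) ≤ s} :=
  ENNReal.ofReal_toReal (measure_ne_top _ _)

/-- Under any coupling, the distribution functions at s differ by at most the probability that s
separates the two coordinates. -/
theorem lintegral_distFun_le_W1 (μ ν : ProbabilityMeasure ℝ≥0) :
    ∫⁻ s in Ici (0 : ℝ), ENNReal.ofReal |distFun μ s - distFun ν s| ≤ W1 μ ν := by
  refine le_iInf fun π => le_iInf fun h1 => le_iInf fun h2 => ?_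
  have hπ : IsProbabilityMeasure π := ⟨by
    rw [← preimage_univ (f := Prod.fst), ← Measure.map_apply measurable_fst MeasurableSet.univ, h1]
    exact measure_univ⟩
  rw [lintegral_edist_eq]
  refine lintegral_mono fun s => ?_
  have hs : MeasurableSet {x : ℝ≥0 | (x : ℝ) ≤ s} := measurableSet_le (by fun_prop) (by fun_prop)
  have e1 : ENNReal.ofReal (distFun μ s) = π {x | (x.1 : ℝ) ≤ s} := by
    rw [ofReal_distFun, ← h1, Measure.map_apply measurable_fst hs]; rfl
  have e2 : ENNReal.ofReal (distFun ν s) = π {x | (x.2 : ℝ) ≤ s} := by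
    rw [ofReal_distFun, ← h2, Measure.map_apply measurable_snd hs]; rfl
  have i1 : π {x | (x.1 : ℝ) ≤ s} ≤ π {x | (x.1 : ℝ) ≤ s ∧ s < x.2} + π {x | (x.2 : ℝ) ≤ s} := by
    refine (measure_mono fun x hx => ?_).trans (measure_union_le _ _)
    exact (lt_or_ge s x.2).imp (fun h => ⟨hx, h⟩) id
  have i2 : π {x | (x.2 : ℝ) ≤ s} ≤ π {x | (x.2 : ℝ) ≤ s ∧ s < x.1} + π {x | (x.1 : ℝ) ≤ s} := by
    refine (measure_mono fun x hx => ?_).trans (measure_union_le _ _)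
    exact (lt_or_ge s x.1).imp (fun h => ⟨hx, h⟩) id
  rw [← e1, ← e2] at i1 i2
  rcases abs_cases (distFun μ s - distFun ν s) with ⟨h, -⟩ | ⟨h, -⟩
  · rw [h, ENNReal.ofReal_sub _ (distFun_nonneg _ _), tsub_le_iff_right]
    exact i1.trans (add_le_add_left le_self_add _)
  · rw [h, neg_sub, ENNReal.ofReal_sub _ (distFun_nonneg _ _), tsub_le_iff_right]
    exact i2.trans (add_le_add_left le_add_self _)

/-! ### Optimality of the quantile coupling. -/

section Quantile

variable (μ ν : ProbabilityMeasure ℝ≥0)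

theorem quantile_le_of_lt {r : ℝ} {s : ℝ≥0}
    (h : ENNReal.ofReal r < (μ : Measure ℝ≥0) (Icc 0 s)) : quantile μ r ≤ s :=
  csInf_le (OrderBot.bddBelow _) h

theorem iUnion_Icc_natCast : ⋃ n : ℕ, Icc (0 : ℝ≥0) n = univ :=
  eq_univ_of_forall fun x => mem_iUnion.2 ((exists_nat_ge x).imp fun _ h => ⟨zero_le (a := x), h⟩)

theorem exists_lt_measure_Icc {r : ℝ} (hr : r < 1) :
    ∃ s : ℝ≥0, ENNReal.ofReal r < (μ : Measure ℝ≥0) (Icc 0 s) := by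
  have hmono : Monotone fun n : ℕ => Icc (0 : ℝ≥0) n := fun m n h =>
    Icc_subset_Icc_right (Nat.cast_le.2 h)
  have h := tendsto_measure_iUnion_atTop (μ := (μ : Measure ℝ≥0)) hmono
  rw [iUnion_Icc_natCast, measure_univ] at h
  have h1 : ENNReal.ofReal r < 1 := by rwa [ENNReal.ofReal_lt_one]
  obtain ⟨n, hn⟩ := (h.eventually (lt_mem_nhds h1)).exists
  exact ⟨n, hn⟩

/-- The defining inequality holds strictly just to the right of the quantile and passes to the limit
by continuity from above. -/
theorem le_measure_Icc_quantile {r : ℝ} (hr : r < 1) :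
    ENNReal.ofReal r ≤ (μ : Measure ℝ≥0) (Icc 0 (quantile μ r)) := by
  set s := quantile μ r with hs
  have hanti : Antitone fun n : ℕ => Icc (0 : ℝ≥0) (s + 1 / ((n : ℝ≥0) + 1)) := fun m n h => by
    refine Icc_subset_Icc_right ?_
    gcongr
  have h := tendsto_measure_iInter_atTop (μ := (μ : Measure ℝ≥0))
    (fun n : ℕ => (measurableSet_Icc (a := (0 : ℝ≥0)) (b := s + 1 / ((n : ℝ≥0) + 1))).nullMeasurableSet)
    hanti ⟨0, measure_ne_top _ _⟩
  have e : ⋂ n : ℕ, Icc (0 : ℝ≥0) (s + 1 / ((n : ℝ≥0) + 1)) = Icc 0 s := by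
    refine Subset.antisymm (fun x hx => ⟨zero_le (a := x), ?_⟩) (subset_iInter fun n =>
      Icc_subset_Icc_right le_self_add)
    have hx' : ∀ n : ℕ, x ≤ s + 1 / ((n : ℝ≥0) + 1) := fun n => (mem_iInter.1 hx n).2
    have ht : Tendsto (fun n : ℕ => s + 1 / ((n : ℝ≥0) + 1)) atTop (𝓝 (s + 0)) :=
      tendsto_const_nhds.add (by
        rw [← NNReal.tendsto_coe]
        simpa using tendsto_one_div_add_atTop_nhds_zero_nat (𝕜 := ℝ))
    rw [add_zero] at ht
    exact ge_of_tendsto' ht hx'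
  rw [e] at h
  refine ge_of_tendsto' h fun n => ?_
  have hlt : s < s + 1 / ((n : ℝ≥0) + 1) := lt_add_of_pos_right _ (by positivity)
  obtain ⟨u, hu, hus⟩ := exists_lt_of_csInf_lt (exists_lt_measure_Icc μ hr) hlt
  exact (le_of_lt hu).trans (measure_mono (Icc_subset_Icc_right hus.le))

theorem le_measure_of_quantile_le {r : ℝ} (hr : r < 1) {s : ℝ≥0} (h : quantile μ r ≤ s) :
    ENNReal.ofReal r ≤ (μ : Measure ℝ≥0) (Icc 0 s) :=
  (le_measure_Icc_quantile μ hr).trans (measure_mono (Icc_subset_Icc_right h))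

theorem monotoneOn_quantile : MonotoneOn (quantile μ) (Ico 0 1) := fun _ _ _ hr' h =>
  csInf_le_csInf (OrderBot.bddBelow _) (exists_lt_measure_Icc μ hr'.2)
    fun _ hs => (ENNReal.ofReal_le_ofReal h).trans_lt hs

/-- The uniform measure on the unit interval. -/
def unif : Measure ℝ := volume.restrict (Ico 0 1)

/-- The endpoint r = 1 is discarded because there the set defining the quantile is empty and its
infimum is 0, which breaks monotonicity. -/
theorem restrict_Icc_eq_unif : (volume : Measure ℝ).restrict (Icc 0 1) = unif :=
  (Measure.restrict_congr_set Ico_ae_eq_Icc).symm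

instance : IsProbabilityMeasure unif := ⟨by simp [unif]⟩

theorem aemeasurable_quantile : AEMeasurable (quantile μ) unif :=
  aemeasurable_restrict_of_monotoneOn measurableSet_Ico (monotoneOn_quantile μ)

theorem setOf_coe_le_eq_Icc (s : ℝ≥0) : {x : ℝ≥0 | (x : ℝ) ≤ s} = Icc 0 s := by
  ext x; simp

theorem ofReal_distFun_coe (s : ℝ≥0) :
    ENNReal.ofReal (distFun μ s) = (μ : Measure ℝ≥0) (Icc 0 s) := by
  rw [ofReal_distFun, setOf_coe_le_eq_Icc]

theorem quantile_le_of_lt_distFun {r : ℝ} {s : ℝ≥0} (h : r < distFun μ s) (h0 : 0 ≤ r) :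
    quantile μ r ≤ s := by
  refine quantile_le_of_lt μ ?_
  rw [← ofReal_distFun_coe]
  exact (ENNReal.ofReal_lt_ofReal_iff_of_nonneg h0).2 h

theorem le_distFun_of_quantile_le {r : ℝ} (hr : r < 1) {s : ℝ≥0} (h : quantile μ r ≤ s) :
    r ≤ distFun μ s := by
  have := le_measure_of_quantile_le μ hr h
  rw [← ofReal_distFun_coe] at this
  exact (ENNReal.ofReal_le_ofReal_iff (distFun_nonneg _ _)).1 this

theorem distFun_le_of_lt_quantile {r : ℝ} (h0 : 0 ≤ r) {s : ℝ≥0} (h : s < quantile μ r) :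
    distFun μ s ≤ r := by
  by_contra hc
  exact absurd (quantile_le_of_lt_distFun μ (not_le.1 hc) h0) (not_le.2 h)

theorem distFun_le_one (s : ℝ) : distFun μ s ≤ 1 := measureReal_le_one

/-- Up to its right endpoint, the set of r in [0, 1) whose quantile is at most s is [0, F(s)]. -/
theorem map_quantile : unif.map (quantile μ) = (μ : Measure ℝ≥0) := by
  have hm := aemeasurable_quantile μ
  have : IsProbabilityMeasure (unif.map (quantile μ)) := Measure.isProbabilityMeasure_map hm
  refine Measure.ext_of_Iic _ _ fun s => ?_
  have e : (μ : Measure ℝ≥0) (Iic s) = ENNReal.ofReal (distFun μ s) := by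
    rw [ofReal_distFun_coe]; congr 1; ext x; simp
  rw [e, Measure.map_apply_of_aemeasurable hm measurableSet_Iic, unif,
    Measure.restrict_apply' measurableSet_Ico]
  refine le_antisymm ?_ ?_
  · have h : quantile μ ⁻¹' Iic s ∩ Ico 0 1 ⊆ Icc 0 (distFun μ s) := fun r hr =>
      ⟨hr.2.1, le_distFun_of_quantile_le μ hr.2.2 hr.1⟩
    simpa using measure_mono (μ := volume) h
  · have h : Ico 0 (distFun μ s) ⊆ quantile μ ⁻¹' Iic s ∩ Ico 0 1 := fun r hr =>
      ⟨quantile_le_of_lt_distFun μ hr.2 hr.1, hr.1, hr.2.trans_le (distFun_le_one μ s)⟩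
    simpa using measure_mono (μ := volume) h

theorem unif_quantile_le (s : ℝ≥0) :
    unif {r | (quantile μ r : ℝ) ≤ s ∧ (s : ℝ) < quantile ν r} ≤
      ENNReal.ofReal (distFun μ s - distFun ν s) := by
  rw [unif, Measure.restrict_apply' measurableSet_Ico, ← Real.volume_Icc]
  refine measure_mono fun r hr => ⟨?_, ?_⟩
  · exact distFun_le_of_lt_quantile ν hr.2.1 (NNReal.coe_lt_coe.1 hr.1.2)
  · exact le_distFun_of_quantile_le μ hr.2.2 (NNReal.coe_le_coe.1 hr.1.1)

theorem W1_le_lintegral_quantile :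
    W1 μ ν ≤ ∫⁻ r, edist (quantile μ r) (quantile ν r) ∂unif := by
  have h1 := aemeasurable_quantile μ
  have h2 := aemeasurable_quantile ν
  refine (iInf₂_le (unif.map fun r => (quantile μ r, quantile ν r)) ?_).trans
    ((iInf_le _ ?_).trans_eq ?_)
  · rw [AEMeasurable.map_map_of_aemeasurable measurable_fst.aemeasurable (h1.prodMk h2)]
    exact map_quantile μ
  · rw [AEMeasurable.map_map_of_aemeasurable measurable_snd.aemeasurable (h1.prodMk h2)]
    exact map_quantile ν
  · rw [lintegral_map' (by fun_prop) (h1.prodMk h2)]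

/-- For the quantile coupling, a threshold s separates the coordinates only when r lies between the
two values of the distribution functions at s. This makes the general inequality for couplings an
equality and closes a cycle of inequalities. -/
theorem lintegral_quantile_le_lintegral_distFun :
    ∫⁻ r, edist (quantile μ r) (quantile ν r) ∂unif ≤
      ∫⁻ s in Ici (0 : ℝ), ENNReal.ofReal |distFun μ s - distFun ν s| := by
  have hm := (aemeasurable_quantile μ).prodMk (aemeasurable_quantile ν)
  have e : ∫⁻ r, edist (quantile μ r) (quantile ν r) ∂unif =
      ∫⁻ x, edist x.1 x.2 ∂(unif.map fun r => (quantile μ r, quantile ν r)) := by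
    rw [lintegral_map' (by fun_prop) hm]
  rw [e, lintegral_edist_eq]
  refine setLIntegral_mono' measurableSet_Ici fun s hs => ?_
  lift s to ℝ≥0 using hs
  have m1 : MeasurableSet {x : ℝ≥0 × ℝ≥0 | (x.1 : ℝ) ≤ s ∧ (s : ℝ) < x.2} :=
    measurableSet_le_lt (by fun_prop) (by fun_prop) (by fun_prop)
  have m2 : MeasurableSet {x : ℝ≥0 × ℝ≥0 | (x.2 : ℝ) ≤ s ∧ (s : ℝ) < x.1} :=
    measurableSet_le_lt (by fun_prop) (by fun_prop) (by fun_prop)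
  rw [Measure.map_apply_of_aemeasurable hm m1, Measure.map_apply_of_aemeasurable hm m2]
  refine (add_le_add (unif_quantile_le μ ν s) (unif_quantile_le ν μ s)).trans ?_
  rcases le_total (distFun μ s) (distFun ν s) with h | h
  · rw [ENNReal.ofReal_of_nonpos (by linarith), zero_add, abs_sub_comm, abs_of_nonneg (by linarith)]
  · rw [ENNReal.ofReal_of_nonpos (p := distFun ν s - distFun μ s) (by linarith), add_zero,
      abs_of_nonneg (by linarith)]

theorem W1_eq_lintegral_quantile :
    W1 μ ν = ∫⁻ r, edist (quantile μ r) (quantile ν r) ∂unif :=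
  (W1_le_lintegral_quantile μ ν).antisymm
    ((lintegral_quantile_le_lintegral_distFun μ ν).trans (lintegral_distFun_le_W1 μ ν))

variable {μ ν}

theorem integrable_quantile (hμ : HasFirstMoment μ) :
    Integrable (fun r => (quantile μ r : ℝ)) unif := by
  have hm := aemeasurable_quantile μ
  refine ⟨hm.coe_nnreal_real.aestronglyMeasurable, ?_⟩
  rw [hasFiniteIntegral_def]
  have e : ∀ r, ‖(quantile μ r : ℝ)‖ₑ = (quantile μ r : ℝ≥0∞) := fun r => by simp
  simp only [e]
  rw [← lintegral_map' (f := fun x : ℝ≥0 => (x : ℝ≥0∞)) (by fun_prop) hm, map_quantile]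
  exact hμ

theorem integrable_quantile_sub (hμ : HasFirstMoment μ) (hν : HasFirstMoment ν) :
    Integrable (fun r => |(quantile μ r : ℝ) - quantile ν r|) unif :=
  ((integrable_quantile hμ).sub (integrable_quantile hν)).abs

theorem quantileDist_eq (μ ν : ProbabilityMeasure ℝ≥0) :
    quantileDist μ ν = ∫ r, |(quantile μ r : ℝ) - quantile ν r| ∂unif := by
  rw [quantileDist, restrict_Icc_eq_unif]

/-- The quantile coupling is optimal. -/
theorem ofReal_quantileDist (hμ : HasFirstMoment μ) (hν : HasFirstMoment ν) :
    ENNReal.ofReal (quantileDist μ ν) = W1 μ ν := by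
  rw [quantileDist_eq, ofReal_integral_eq_lintegral_ofReal (integrable_quantile_sub hμ hν)
    (ae_of_all _ fun _ => abs_nonneg _), W1_eq_lintegral_quantile]
  refine lintegral_congr fun r => ?_
  rw [edist_dist, NNReal.dist_eq]

theorem quantileDist_comm (μ ν : ProbabilityMeasure ℝ≥0) : quantileDist μ ν = quantileDist ν μ := by
  simp only [quantileDist, abs_sub_comm]

theorem quantileDist_nonneg (μ ν : ProbabilityMeasure ℝ≥0) : 0 ≤ quantileDist μ ν :=
  integral_nonneg fun _ => abs_nonneg _

theorem quantileDist_triangle {ρ : ProbabilityMeasure ℝ≥0} (hμ : HasFirstMoment μ)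
    (hν : HasFirstMoment ν) (hρ : HasFirstMoment ρ) :
    quantileDist μ ρ ≤ quantileDist μ ν + quantileDist ν ρ := by
  simp only [quantileDist_eq]
  rw [← integral_add (integrable_quantile_sub hμ hν) (integrable_quantile_sub hν hρ)]
  exact integral_mono (integrable_quantile_sub hμ hρ)
    ((integrable_quantile_sub hμ hν).add (integrable_quantile_sub hν hρ)) fun r => abs_sub_le _ _ _

end Quantile

/-! ### Density of finite supports and extension by continuity. -/

theorem HasFiniteSupport.hasFirstMoment {μ : ProbabilityMeasure ℝ≥0} (h : HasFiniteSupport μ) :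
    HasFirstMoment μ := by
  obtain ⟨s, hs⟩ := h
  rw [HasFirstMoment, eq_sum_atoms s hs, lintegral_finsetSum_measure]
  refine ENNReal.sum_lt_top.2 fun x _ => ?_
  rw [lintegral_smul_measure, lintegral_dirac]
  exact ENNReal.mul_lt_top (measure_lt_top _ _) ENNReal.coe_lt_top

/-- The measures of finite support are dense. -/
theorem exists_hasFiniteSupport_W1_lt {μ : ProbabilityMeasure ℝ≥0} (hμ : HasFirstMoment μ)
    {δ : ℝ≥0∞} (hδ : 0 < δ) : ∃ ν : ProbabilityMeasure ℝ≥0, HasFiniteSupport ν ∧ W1 μ ν < δ := by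
  -- Simple approximations of the identity with base point 0 satisfy |x - g_n(x)| ≤ x, so the first
  -- moment dominates; the pairs (x, g_n(x)) give the coupling.
  let g : ℕ → SimpleFunc ℝ≥0 ℝ≥0 := SimpleFunc.approxOn id measurable_id univ 0 (mem_univ _)
  have hlim : Tendsto (fun n => ∫⁻ x, edist x (g n x) ∂(μ : Measure ℝ≥0)) atTop (𝓝 0) := by
    have h := tendsto_lintegral_of_dominated_convergence (μ := (μ : Measure ℝ≥0))
      (F := fun n x => edist x (g n x)) (f := fun _ => 0) (fun x : ℝ≥0 => (x : ℝ≥0∞))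
      (fun n => by have := (g n).measurable; fun_prop) (fun n => ae_of_all _ fun x => ?_) hμ.ne
      (ae_of_all _ fun x => ?_)
    · simpa using h
    · have := SimpleFunc.edist_approxOn_le measurable_id (mem_univ (0 : ℝ≥0)) x n
      simp only
      rw [edist_comm]
      refine this.trans_eq ?_
      rw [edist_dist, NNReal.dist_eq]
      simp
    · have := SimpleFunc.tendsto_approxOn measurable_id (mem_univ (0 : ℝ≥0)) (x := x) (by simp)
      have h2 := tendsto_const_nhds (x := x).edist this
      simpa using h2
  obtain ⟨n, hn⟩ := (hlim.eventually (gt_mem_nhds hδ)).exists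
  have hg := (g n).measurable
  refine ⟨⟨(μ : Measure ℝ≥0).map (g n), Measure.isProbabilityMeasure_map hg.aemeasurable⟩,
    ⟨(g n).range, ?_⟩, lt_of_le_of_lt ?_ hn⟩
  · change (μ : Measure ℝ≥0).map (g n) _ = 0
    rw [Measure.map_apply hg (Finset.measurableSet _).compl]
    have e : g n ⁻¹' ((g n).range : Set ℝ≥0)ᶜ = ∅ := by ext x; simp
    rw [e, measure_empty]
  · refine (iInf₂_le ((μ : Measure ℝ≥0).map fun x => (x, g n x)) ?_).trans
      ((iInf_le _ ?_).trans_eq ?_)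
    · rw [Measure.map_map measurable_fst (by fun_prop)]
      exact Measure.map_id
    · rw [Measure.map_map measurable_snd (by fun_prop)]
      rfl
    · rw [lintegral_map (by fun_prop) (by fun_prop)]

section Extension

/-- The `L¹`-Wasserstein distance as a pseudo-metric, in its quantile form. -/
abbrev quantilePseudoMetric : PseudoMetricSpace P1 where
  dist μ ν := quantileDist μ.1 ν.1
  dist_self μ := by simp [quantileDist]
  dist_comm μ ν := quantileDist_comm _ _
  dist_triangle μ ν ρ := quantileDist_triangle μ.2 ν.2 ρ.2

/-- A function on the measures of finite support which is `1`-Lipschitz for the Wasserstein distance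
has exactly one continuous extension. -/
theorem existsUnique_W1Continuous (f : ∀ μ : ProbabilityMeasure ℝ≥0, HasFiniteSupport μ → ℝ)
    (hf : ∀ μ ν hμ hν, |f μ hμ - f ν hν| ≤ quantileDist μ ν) :
    ∃! G : P1 → ℝ, W1Continuous G ∧ ∀ (μ : P1) (hμ : HasFiniteSupport μ.1), G μ = f μ.1 hμ := by
  classical
  refine existsUnique_of_exists_of_unique ?_ ?_
  · let _ : PseudoMetricSpace P1 := quantilePseudoMetric
    have hlip : LipschitzOnWith 1 (fun μ : P1 => if h : HasFiniteSupport μ.1 then f μ.1 h else 0)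
        {μ : P1 | HasFiniteSupport μ.1} := by
      refine LipschitzOnWith.of_dist_le_mul fun μ hμ ν hν => ?_
      have hμ' : HasFiniteSupport μ.1 := hμ
      have hν' : HasFiniteSupport ν.1 := hν
      rw [dif_pos hμ', dif_pos hν', Real.dist_eq, NNReal.coe_one, one_mul]
      exact hf _ _ _ _
    -- A real Lipschitz function on any subset extends with the same constant, so no completeness is
    -- needed.
    obtain ⟨G, hG, hGf⟩ := hlip.extend_real
    refine ⟨G, fun μ ε hε => ⟨ENNReal.ofReal ε, ENNReal.ofReal_pos.2 hε, fun ν hν => ?_⟩,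
      fun μ hμ => ?_⟩
    · rw [← ofReal_quantileDist μ.2 ν.2, ENNReal.ofReal_lt_ofReal_iff hε] at hν
      have h := hG.dist_le_mul ν μ
      rw [NNReal.coe_one, one_mul, Real.dist_eq] at h
      refine h.trans_lt ?_
      rw [dist_comm]
      exact hν
    · have h := hGf (show μ ∈ {μ : P1 | HasFiniteSupport μ.1} from hμ)
      simp only [dif_pos hμ] at h
      exact h.symm
  · rintro G G' ⟨hG, hGf⟩ ⟨hG', hGf'⟩
    ext μ
    refine eq_of_forall_dist_le fun ε hε => ?_
    obtain ⟨δ, hδ, h⟩ := hG μ (ε / 2) (by positivity)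
    obtain ⟨δ', hδ', h'⟩ := hG' μ (ε / 2) (by positivity)
    obtain ⟨ν, hν, hlt⟩ := exists_hasFiniteSupport_W1_lt μ.2 (lt_min hδ hδ')
    have h1 := h ⟨ν, hν.hasFirstMoment⟩ (hlt.trans_le (min_le_left _ _))
    have h2 := h' ⟨ν, hν.hasFirstMoment⟩ (hlt.trans_le (min_le_right _ _))
    rw [hGf _ hν] at h1
    rw [hGf' _ hν] at h2
    rw [Real.dist_eq]
    rw [abs_lt] at h1 h2
    rw [abs_le]
    constructor <;> linarith [h1.1, h1.2, h2.1, h2.2]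

end Extension

/-! ### The Lipschitz estimate and the proposition. -/

section Continuity

variable {N : ℕ} {P : Measure (EuclideanSpace ℝ (Fin N))} [IsProbabilityMeasure P]

theorem abs_integral_freeEnergy_sub_le (hN : 1 ≤ N) (hP : ∀ᵐ σ ∂P, ‖σ‖ ^ 2 ≤ N)
    (β : ℕ →₀ ℝ) (t : ℝ) {μ ν : ProbabilityMeasure ℝ≥0} (hμ : HasFirstMoment μ)
    (hν : HasFirstMoment ν) (A : AtomicRep μ) (B : AtomicRep ν) :
    |∫ ω, freeEnergy β P t A ω ∂(law N) - ∫ ω, freeEnergy β P t B ω ∂(law N)| ≤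
      quantileDist μ ν := by
  rw [← ENNReal.ofReal_le_ofReal_iff (quantileDist_nonneg μ ν), ofReal_quantileDist hμ hν]
  exact (ofReal_abs_integral_freeEnergy_sub_le hN hP β t A B).trans (lintegral_distFun_le_W1 μ ν)

end Continuity

end

end SpinGlass

theorem propositionp (N : ℕ) (hN : 1 ≤ N)
    (β : ℕ →₀ ℝ) (hβ : ∀ p, 0 ≤ β p) (hβ_two : ∀ p, p < 2 → β p = 0)
    (P : Measure (EuclideanSpace ℝ (Fin N))) (hP : IsProbabilityMeasure P)
    (hsupp : ∀ᵐ σ ∂P, ‖σ‖ ^ 2 ≤ N)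
    (t : ℝ) (ht : 0 ≤ t) :
    -- the averaged free energy is well defined, whatever the representation of `μ` in use
    (∀ (μ : ProbabilityMeasure ℝ≥0) (hμ : HasFiniteSupport μ) (A : AtomicRep μ),
      (∀ᵐ ω ∂(law N), 0 < partitionFunction β P t A ω ∧ partitionFunction β P t A ω < ∞) ∧
      Integrable (freeEnergy β P t A) (law N) ∧
      ∫ ω, freeEnergy β P t A ω ∂(law N) = meanFreeEnergy β P t μ hμ) ∧
    -- the continuity estimate
    (∀ (μ μ' : ProbabilityMeasure ℝ≥0) (hμ : HasFiniteSupport μ) (hμ' : HasFiniteSupport μ'),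
      |meanFreeEnergy β P t μ' hμ' - meanFreeEnergy β P t μ hμ| ≤ quantileDist μ' μ ∧
      ENNReal.ofReal (quantileDist μ' μ) = W1 μ' μ) ∧
    -- the extension by continuity
    (∃! G : P1 → ℝ, W1Continuous G ∧
      ∀ (μ : P1) (hμ : HasFiniteSupport μ.1), G μ = meanFreeEnergy β P t μ.1 hμ) := by
  have hlip : ∀ μ ν hμ hν, |meanFreeEnergy β P t μ hμ - meanFreeEnergy β P t ν hν| ≤
      quantileDist μ ν := fun μ ν hμ hν =>
    abs_integral_freeEnergy_sub_le hN hsupp β t hμ.hasFirstMoment hν.hasFirstMoment _ _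
  refine ⟨fun μ hμ A => ⟨ae_partitionFunction_pos_lt_top hsupp β t A,
    (integrable_log_partitionFunction hsupp β t A).const_mul _, ?_⟩, fun μ μ' hμ hμ' =>
    ⟨hlip μ' μ hμ' hμ, ofReal_quantileDist hμ'.hasFirstMoment hμ.hasFirstMoment⟩,
    existsUnique_W1Continuous _ hlip⟩
  -- Independence of the representation is the Lipschitz estimate between two representations of the
  -- same measure, at distance 0.
  have h := abs_integral_freeEnergy_sub_le hN hsupp β t hμ.hasFirstMoment hμ.hasFirstMoment A
    (nonempty_atomicRep hμ).some
  have h0 : quantileDist μ μ = 0 := by simp [quantileDist]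
  rw [h0] at h
  exact sub_eq_zero.1 (abs_eq_zero.1 (le_antisymm h (abs_nonneg _)))
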